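/- Let $N\ge 2$, $Y=[-1/2,1/2)^N$, and let $G$ be an open set with Lipschitz boundary such that $\overline G\subset(-1/2,1/2)^N$ and $Y\setminus\overline G$ is connected. Put $Y^*=Y\setminus G$, and let $\sigma$ be the surface measure on $\partial G$. Let $W^{1,2}_{per}(Y^*)$ be the space of $Y$-periodic $W^{1,2}$-functions on the periodically perforated space (the $\mathbb Z^N$-translates of $\overline G$ being removed). Let $a:\mathbb R^N\times Y\to\mathbb R^N$ and $g:\mathbb R\times\partial G\to\mathbb R$ (understood to be extended $Y$-periodically in $y$) satisfy, with constants $\kappa,C_1,\dots,C_8>0$, for a.e. $y$ and all $\xi,\zeta\in\mathbb R^N$, $u,v\in\mathbb R$: (i) $a\in C(\mathbb R^N;L^\infty(Y))$ and $g\in C(\mathbb R;L^\infty(\partial G))$, with $a(\cdot,y)$ continuous and $g(\cdot,y)$ differentiable; (ii) $(a(\xi,y)-a(\zeta,y))\cdot(\xi-\zeta)\ge\kappa|\xi-\zeta|^2$; (iii) $-C_1+C_2|\xi|^2\le a(\xi,y)\cdot\xi$, $|a(\xi,y)|\le C_3|\xi|+C_4$, $|g(u,y)|\le C_5|u|+C_6$,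 $|g(u,y)-g(v,y)|\le C_7|u-v|$, $|g'_u(u,y)-g'_u(v,y)|\le C_8|u-v|(1+|u|+|v|)^{-1}$; (iv) $\int_{\partial G}g(u,y)\,d\sigma_y=0$ for every $u$. For $\xi\in\mathbb R^N$ and $u\in\mathbb R$ consider the cell problem: find $w\in W^{1,2}_{per}(Y^*)$ such that $$\int_{Y^*}a(\xi+Dw,y)\cdot Dv\,dy=\int_{\partial G}g(u,y)\,v\,d\sigma_y\qquad\text{for all }v\in W^{1,2}_{per}(Y^*),$$ that is, in the weak sense, $\mathrm{div}\,a(\xi+D_yw,y)=0$ in $Y^*$, $a(\xi+D_yw,y)\cdot\nu=g(u,y)$ on $\partial G$, $w$ is $Y$-periodic. Then for all $\xi,u$ the cell problem has a solution $w=w(\cdot;\xi,u)$, which is unique up to an additive constant, and $$a^*(\xi,u)=\int_{Y^*}a(\xi+D_yw,y)\,dy,\qquad b^*(\xi,u)=\int_{\partial G}g'_u(u,y)\,w\,d\sigma_y$$ do not depend on the choice of the solution. The functions $a^*$ and $b^*$ are continuous on $\mathbb R^N\times\mathbb R$, and there are constants $\gamma,\alpha,r>0$ and $C$ such that for all $\xi,\zeta\in\mathbb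 R^N$ and $u,v\in\mathbb R$ $$a^*(\xi,u)\cdot\xi\ge\gamma|\xi|^2-C(|u|^2+1),\qquad |a^*(\xi,u)|\le C(|\xi|+|u|+1),$$ $$(a^*(\xi,u)-a^*(\zeta,v))\cdot(\xi-\zeta)\ge\alpha|\xi-\zeta|^2-r(u-v)^2,$$ $$|b^*(\xi,u)|\le C(|\xi|+|u|+1),$$ $$(b^*(\xi,u)-b^*(\zeta,v))(v-u)\le\tfrac14(a^*(\xi,u)-a^*(\zeta,v))\cdot(\xi-\zeta)+C\Bigl(|u-v|^2+\frac{|u-v|^2(|\xi|+|u|+1)}{1+|u-v|}\Bigr).$$ -/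

import Mathlib

open MeasureTheory Filter Topology Set
open scoped ContDiff ENNReal NNReal

namespace PerforatedCell

noncomputable section

/-- `ℝ^N` with its Euclidean norm. -/
abbrev Space (N : ℕ) : Type := EuclideanSpace ℝ (Fin N)

/-- The unit cube `Y = [-1/2, 1/2)^N`. -/
def unitCube (N : ℕ) : Set (Space N) := {y | ∀ i, y i ∈ Ico (-(1 / 2) : ℝ) (1 / 2)}

/-- The open cube `(-1/2, 1/2)^N`. -/
def openCube (N : ℕ) : Set (Space N) := {y | ∀ i, y i ∈ Ioo (-(1 / 2) : ℝ) (1 / 2)}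

/-- `G` has Lipschitz boundary: near each boundary point, and in a suitable orthonormal frame
with last vector `e`, the set `G` is the strict supergraph of a Lipschitz function `h` of the
component orthogonal to `e`. -/
def HasLipschitzBoundary {N : ℕ} (G : Set (Space N)) : Prop :=
  ∀ p ∈ frontier G, ∃ (e : Space N) (h : Space N → ℝ) (K : ℝ≥0) (ρ : ℝ),
    ‖e‖ = 1 ∧ LipschitzWith K h ∧ 0 < ρ ∧
      ∀ x ∈ Metric.ball p ρ, x ∈ G ↔ h (x - inner ℝ x e • e) < inner ℝ x e

/-- The admissible holes: `G` is open with Lipschitz boundary, its closure lies in the open cube,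
and the cell minus the closed hole is connected. -/
structure IsHole {N : ℕ} (G : Set (Space N)) : Prop where
  isOpen : IsOpen G
  closure_subset : closure G ⊆ openCube N
  lipschitz : HasLipschitzBoundary G
  connected : IsConnected (unitCube N \ closure G)

/-- The perforated cell `Y* = Y \ G`. -/
def cell {N : ℕ} (G : Set (Space N)) : Set (Space N) := unitCube N \ G

/-- Lebesgue measure on `Y*`. -/
def cellMeasure {N : ℕ} (G : Set (Space N)) : Measure (Space N) := volume.restrict (cell G)

/-- The surface measure `σ` on `S ∩ Y`, which is `∂G` because the closure of `G` lies in the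
open cube: the `(N - 1)`-dimensional Hausdorff measure, normalised so as to agree with Lebesgue
measure on hyperplanes. -/
def surfaceMeasure {N : ℕ} (G : Set (Space N)) : Measure (Space N) :=
  (Measure.euclideanHausdorffMeasure (N - 1)).restrict (frontier G)

/-- `Y`-periodicity (`ℤ^N`-periodicity) of a function on `ℝ^N`. -/
def IsYPeriodic {N : ℕ} (φ : Space N → ℝ) : Prop :=
  ∀ i : Fin N, Function.Periodic φ (EuclideanSpace.single i (1 : ℝ))

/-- `F` is the weak gradient of `w` on the flat torus `ℝ^N / ℤ^N` minus the closed hole: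
the test functions are the smooth periodic functions that vanish near the closure of `G`.
Only values on `Y*` enter; `w` and `F` stand for their periodic extensions, and the fact that
test functions need not vanish near the faces of `Y` expresses periodicity of `w`. -/
def IsPeriodicWeakGradient {N : ℕ} (G : Set (Space N)) (w : Space N → ℝ)
    (F : Space N → Space N) : Prop :=
  ∀ φ : Space N → ℝ, ContDiff ℝ ∞ φ → IsYPeriodic φ → Disjoint (tsupport φ) (closure G) →
    ∫ y, w y • gradient φ y ∂(cellMeasure G) = - ∫ y, φ y • F y ∂(cellMeasure G)

/-- `t` is the trace on `∂G` of the Sobolev function `w` with weak gradient `F`: the `L²(∂G)`-limit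
of the restrictions of smooth periodic functions that converge to `w` in `W^{1,2}(Y*)`. -/
def IsTrace {N : ℕ} (G : Set (Space N)) (w : Space N → ℝ) (F : Space N → Space N)
    (t : Space N → ℝ) : Prop :=
  ∃ φ : ℕ → Space N → ℝ, (∀ n, ContDiff ℝ ∞ (φ n)) ∧ (∀ n, IsYPeriodic (φ n)) ∧
    Tendsto (fun n => eLpNorm (fun y => φ n y - w y) 2 (cellMeasure G)) atTop (𝓝 0) ∧
    Tendsto (fun n => eLpNorm (fun y => gradient (φ n) y - F y) 2 (cellMeasure G)) atTop (𝓝 0) ∧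
    Tendsto (fun n => eLpNorm (fun y => φ n y - t y) 2 (surfaceMeasure G)) atTop (𝓝 0)

/-- An element of `W^{1,2}_per(Y*)`, given with its weak gradient and its trace on `∂G`. -/
structure PerSobolev {N : ℕ} (G : Set (Space N)) where
  /-- the function -/
  val : Space N → ℝ
  /-- its weak gradient -/
  grad : Space N → Space N
  /-- its trace on `∂G` -/
  trace : Space N → ℝ
  memLp_val : MemLp val 2 (cellMeasure G)
  memLp_grad : MemLp grad 2 (cellMeasure G)
  memLp_trace : MemLp trace 2 (surfaceMeasure G)
  isWeakGradient : IsPeriodicWeakGradient G val grad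
  isTrace : IsTrace G val grad trace

/-- Conditions on `a(ξ, y)`: it belongs to `C(ℝ^N; L^∞(Y))` (represented by a function that is
continuous in `ξ` for almost every `y`), is strongly monotone, coercive and of linear growth. -/
structure IsFlux {N : ℕ} (a : Space N → Space N → Space N) : Prop where
  memLp : ∀ ξ, MemLp (a ξ) ∞ (volume.restrict (unitCube N))
  continuous_Linfty : ∀ ξ, Tendsto
    (fun ζ => eLpNorm (fun y => a ζ y - a ξ y) ∞ (volume.restrict (unitCube N))) (𝓝 ξ) (𝓝 0)
  continuous_ae : ∀ᵐ y ∂(volume.restrict (unitCube N)), Continuous fun ξ => a ξ y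
  monotone : ∃ κ : ℝ, 0 < κ ∧ ∀ᵐ y ∂(volume.restrict (unitCube N)), ∀ ξ ζ,
    κ * ‖ξ - ζ‖ ^ 2 ≤ inner ℝ (a ξ y - a ζ y) (ξ - ζ)
  coercive : ∃ C₁ C₂ : ℝ, 0 < C₁ ∧ 0 < C₂ ∧ ∀ᵐ y ∂(volume.restrict (unitCube N)), ∀ ξ,
    -C₁ + C₂ * ‖ξ‖ ^ 2 ≤ inner ℝ (a ξ y) ξ
  growth : ∃ C₃ C₄ : ℝ, 0 < C₃ ∧ 0 < C₄ ∧ ∀ᵐ y ∂(volume.restrict (unitCube N)), ∀ ξ,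
    ‖a ξ y‖ ≤ C₃ * ‖ξ‖ + C₄

/-- Conditions on `g(u, y)`: it belongs to `C(ℝ; L^∞(∂G))`, is differentiable in `u`, has linear
growth, is Lipschitz in `u`, has a derivative in `u` that satisfies the decay-weighted Lipschitz
condition, and has zero mean over `∂G` for every `u`. -/
structure IsBoundaryLaw {N : ℕ} (G : Set (Space N)) (g : ℝ → Space N → ℝ) : Prop where
  memLp : ∀ u, MemLp (g u) ∞ (surfaceMeasure G)
  continuous_Linfty : ∀ u, Tendsto
    (fun v => eLpNorm (fun y => g v y - g u y) ∞ (surfaceMeasure G)) (𝓝 u) (𝓝 0)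
  differentiable_ae : ∀ᵐ y ∂(surfaceMeasure G), Differentiable ℝ fun u => g u y
  growth : ∃ C₅ C₆ : ℝ, 0 < C₅ ∧ 0 < C₆ ∧ ∀ᵐ y ∂(surfaceMeasure G), ∀ u,
    |g u y| ≤ C₅ * |u| + C₆
  lipschitz : ∃ C₇ : ℝ, 0 < C₇ ∧ ∀ᵐ y ∂(surfaceMeasure G), ∀ u v,
    |g u y - g v y| ≤ C₇ * |u - v|
  deriv_lipschitz : ∃ C₈ : ℝ, 0 < C₈ ∧ ∀ᵐ y ∂(surfaceMeasure G), ∀ u v,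
    |deriv (fun s => g s y) u - deriv (fun s => g s y) v| ≤ C₈ * |u - v| * (1 + |u| + |v|)⁻¹
  mean_zero : ∀ u, ∫ y, g u y ∂(surfaceMeasure G) = 0

/-- `w` is a weak solution of the cell problem `div a(ξ + Dw, y) = 0` in `Y*`,
`a(ξ + Dw, y) · ν = g(u, y)` on `∂G`, `w` periodic. -/
def IsCellSolution {N : ℕ} (a : Space N → Space N → Space N) {G : Set (Space N)}
    (g : ℝ → Space N → ℝ) (ξ : Space N) (u : ℝ) (w : PerSobolev G) : Prop :=
  ∀ v : PerSobolev G,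
    ∫ y, inner ℝ (a (ξ + w.grad y) y) (v.grad y) ∂(cellMeasure G) =
      ∫ y, g u y * v.trace y ∂(surfaceMeasure G)

/-- `∫_{Y*} a(ξ + Dw, y) dy`. -/
def fluxOf {N : ℕ} (a : Space N → Space N → Space N) {G : Set (Space N)} (ξ : Space N)
    (w : PerSobolev G) : Space N :=
  ∫ y, a (ξ + w.grad y) y ∂(cellMeasure G)

/-- `∫_{∂G} g'_u(u, y) w dσ`. -/
def couplingOf {N : ℕ} {G : Set (Space N)} (g : ℝ → Space N → ℝ) (u : ℝ)
    (w : PerSobolev G) : ℝ :=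
  ∫ y, deriv (fun s => g s y) u * w.trace y ∂(surfaceMeasure G)

open Classical in
/-- The effective coefficient `a*(ξ, u)`, computed from a solution of the cell problem. -/
def aStar {N : ℕ} (a : Space N → Space N → Space N) (G : Set (Space N))
    (g : ℝ → Space N → ℝ) (ξ : Space N) (u : ℝ) : Space N :=
  if h : ∃ w : PerSobolev G, IsCellSolution a g ξ u w then fluxOf a ξ h.choose else 0

open Classical in
/-- The effective coefficient `b*(ξ, u)`, computed from a solution of the cell problem. -/
def bStar {N : ℕ} (a : Space N → Space N → Space N) (G : Set (Space N))
    (g : ℝ → Space N → ℝ) (ξ : Space N) (u : ℝ) : ℝ :=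
  if h : ∃ w : PerSobolev G, IsCellSolution a g ξ u w then couplingOf g u h.choose else 0

end

end PerforatedCell

/-! The cell problem is a strongly monotone equation for the gradient alone. On `gradSpace G`, the
closure in L²(Y*) of the gradients of smooth periodic functions, the field a(ξ + ·, y) induces a
strongly monotone hemicontinuous operator. The load v ↦ ∫ g(u,·) v dσ is a bounded functional of Dv:
since g(u,·) has zero mean, v may be shifted by a constant, and the Poincaré and trace inequalities
bound the shifted trace by Dv. Minty's theorem gives a solution, strong monotonicity determines its
gradient, and Poincaré determines the solution up to a constant. Differentiating the zero-mean
condition shows that g'_u has zero mean too, so b* does not see that constant.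

The geometry enters in three inequalities. The Poincaré inequality (`IsHole.supportsPoincare_cell`)
is glued from convex pieces and Lipschitz charts, using that the cell minus the closed hole is
connected. The trace inequality (`IsHole.exists_trace_le`) comes from averaging along a direction
transversal to the boundary. The bound ‖η‖ ≤ K‖η + Dw‖ (`IsHole.exists_norm_le_eLpNorm_add_grad`) is
not immediate, because Dw need not have zero mean over Y*; a cutoff depending on one coordinate and
supported away from the hole removes the other components of Dw. This is where N ≥ 2 matters.

The remaining claims rest on one energy estimate. Let X be the L² distance between ξ + Dw and ζ +
Dw'. Testing both problems with w - w' gives κX² ≤ (a*(ξ,u) - a*(ζ,v))·(ξ - ζ) + B|u - v|X.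
Absorbing the last term gives uniqueness, the monotonicity of a* and X → 0 as the data converge,
hence continuity. For b* one has |b*(ξ,u) - b*(ζ,v)| ≤ BX + B‖Dw‖|u - v|/(1 + |u - v|); after
multiplication by |u - v| the first term is absorbed by κX²/4, which produces the factor 1/4.
Coercivity and growth come from testing a single problem with its own solution. -/

namespace PerforatedCell

/-! ### Minty's theorem for monotone operators on a Hilbert space -/

section Minty

variable {H : Type*} [NormedAddCommGroup H] [InnerProductSpace ℝ H]

/-- Minimax duality. The claim is that max over i of ‖z‖² + ⟨y i - x i, z⟩ - ⟨y i, x i⟩ is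
nonpositive for some z. The average with weights l is minimal at z = -q/2, with value D l.
Monotonicity gives D ≤ 0 on the simplex, and first-order optimality at a maximiser carries the bound
over to every i. -/
theorem exists_forall_inner_nonneg_of_monotone {ι : Type*} [Fintype ι] [Nonempty ι] (x y : ι → H)
    (hmono : ∀ i j, 0 ≤ inner ℝ (y i - y j) (x i - x j)) :
    ∃ z : H, ∀ i, 0 ≤ inner ℝ (y i + z) (x i - z) := by
  classical
  let D : (ι → ℝ) → ℝ := fun l => -(‖∑ i, l i • (y i - x i)‖ ^ 2 / 4) - ∑ i, l i * inner ℝ (y i) (x i)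
  have hD : Continuous D := by fun_prop
  obtain ⟨l, hl, hmax⟩ := (isCompact_stdSimplex ℝ ι).exists_isMaxOn
    ⟨_, single_mem_stdSimplex ℝ (Classical.arbitrary ι)⟩ hD.continuousOn
  set q : H := ∑ i, l i • (y i - x i) with hq
  set s := ∑ i, l i * inner ℝ (y i) (x i) with hs
  -- This is D l ≤ 0: the weighted double sum equals 2(s - ⟨Z, X⟩), and ‖Z - X‖² ≥ -4⟨Z, X⟩.
  have hs0 : -s ≤ ‖q‖ ^ 2 / 4 := by
    set X : H := ∑ i, l i • x i with hX
    set Z : H := ∑ i, l i • y i with hZ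
    have h1 : 0 ≤ ∑ i, ∑ j, l i * l j * inner ℝ (y i - y j) (x i - x j) :=
      Finset.sum_nonneg fun i _ => Finset.sum_nonneg fun j _ =>
        mul_nonneg (mul_nonneg (hl.1 i) (hl.1 j)) (hmono i j)
    have hZX : inner ℝ Z X = ∑ i, ∑ j, l i * l j * inner ℝ (y i) (x j) := by
      simp only [hZ, hX, sum_inner, inner_sum, inner_smul_left, inner_smul_right,
        Finset.mul_sum]
      rw [Finset.sum_comm]
      refine Finset.sum_congr rfl fun i _ => Finset.sum_congr rfl fun j _ => ?_
      simp; ring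
    have hZX' : inner ℝ Z X = ∑ i, ∑ j, l i * l j * inner ℝ (y j) (x i) := by
      rw [hZX, Finset.sum_comm]
      refine Finset.sum_congr rfl fun i _ => Finset.sum_congr rfl fun j _ => by ring
    have hs1 : s = ∑ i, ∑ j, l i * l j * inner ℝ (y i) (x i) := by
      rw [hs]
      refine Finset.sum_congr rfl fun i _ => ?_
      rw [← Finset.sum_mul, ← Finset.mul_sum, hl.2, mul_one]
    have hs2 : s = ∑ i, ∑ j, l i * l j * inner ℝ (y j) (x j) := by
      rw [hs1, Finset.sum_comm]
      refine Finset.sum_congr rfl fun i _ => Finset.sum_congr rfl fun j _ => by ring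
    have h2 : ∑ i, ∑ j, l i * l j * inner ℝ (y i - y j) (x i - x j)
        = s + s - inner ℝ Z X - inner ℝ Z X := by
      nth_rewrite 1 [hs1]; nth_rewrite 1 [hs2]; nth_rewrite 1 [hZX]; rw [hZX']
      simp only [← Finset.sum_add_distrib, ← Finset.sum_sub_distrib]
      refine Finset.sum_congr rfl fun i _ => Finset.sum_congr rfl fun j _ => ?_
      simp only [inner_sub_left, inner_sub_right]; ring
    have hqZ : q = Z - X := by
      simp only [hq, hZ, hX, smul_sub, Finset.sum_sub_distrib]
    have h3 : 0 ≤ ‖Z + X‖ ^ 2 := by positivity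
    rw [norm_add_sq_real] at h3
    rw [hqZ, norm_sub_sq_real]
    linarith
  refine ⟨-(1 / 2 : ℝ) • q, fun i => ?_⟩
  -- Maximality of l compared with points on the segment from l to the i-th vertex; letting t → 0
  -- leaves the one-sided derivative.
  have key : ∀ t ∈ Ioo (0 : ℝ) 1, -inner ℝ q (y i - x i - q) / 2 - inner ℝ (y i) (x i) + s
      ≤ t * (‖y i - x i - q‖ ^ 2 / 4) := by
    intro t ht
    have hmem : (1 - t) • l + t • (Pi.single i 1 : ι → ℝ) ∈ stdSimplex ℝ ι :=
      (convex_stdSimplex ℝ ι) hl (single_mem_stdSimplex ℝ i) (by linarith [ht.2]) ht.1.le (by ring)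
    have h := hmax hmem
    have h1 : ∑ j, ((1 - t) • l + t • (Pi.single i 1 : ι → ℝ)) j • (y j - x j)
        = q + t • (y i - x i - q) := by
      simp only [Pi.add_apply, Pi.smul_apply, smul_eq_mul, add_smul, Finset.sum_add_distrib,
        mul_smul, ← Finset.smul_sum, ← hq]
      simp [Pi.single_apply, ite_smul]
      module
    have h2 : ∑ j, ((1 - t) • l + t • (Pi.single i 1 : ι → ℝ)) j * inner ℝ (y j) (x j)
        = s + t * (inner ℝ (y i) (x i) - s) := by
      simp only [Pi.add_apply, Pi.smul_apply, smul_eq_mul, add_mul, Finset.sum_add_distrib,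
        mul_assoc, ← Finset.mul_sum, ← hs]
      simp [Pi.single_apply, ite_mul]
      ring
    simp only [D, mem_ofPred_eq, h1, h2, ← hq, ← hs] at h
    rw [norm_add_sq_real, norm_smul, mul_pow, inner_smul_right, Real.norm_eq_abs, sq_abs] at h
    have h3 : t * (-inner ℝ q (y i - x i - q) / 2 - inner ℝ (y i) (x i) + s)
      ≤ t * (t * (‖y i - x i - q‖ ^ 2 / 4)) := by linarith
    exact le_of_mul_le_mul_left h3 ht.1
  have key2 : -inner ℝ q (y i - x i - q) / 2 - inner ℝ (y i) (x i) + s ≤ 0 := by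
    have hlim : Tendsto (fun t : ℝ => t * (‖y i - x i - q‖ ^ 2 / 4)) (𝓝[>] 0) (𝓝 0) := by
      have : Tendsto (fun t : ℝ => t * (‖y i - x i - q‖ ^ 2 / 4)) (𝓝 0)
          (𝓝 (0 * (‖y i - x i - q‖ ^ 2 / 4))) := (tendsto_id).mul_const _
      rw [zero_mul] at this
      exact this.mono_left nhdsWithin_le_nhds
    exact ge_of_tendsto hlim (by
      filter_upwards [Ioo_mem_nhdsGT (zero_lt_one' ℝ)] with t ht using key t ht)
  simp only [inner_add_left, inner_sub_right, inner_smul_left, inner_smul_right] at key2 ⊢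
  rw [real_inner_self_eq_norm_sq] at key2 ⊢
  have e1 := real_inner_comm q (y i)
  have e2 := real_inner_comm q (x i)
  simp
  nlinarith

/-- Each condition on z describes a closed ball. Such balls are weak-* compact in the dual, and the
finite case is the finite intersection property. -/
theorem exists_forall_inner_add_nonneg_of_monotone [CompleteSpace H] (S : H → H)
    (hmono : ∀ x y, 0 ≤ inner ℝ (S x - S y) (x - y)) :
    ∃ z, ∀ x, 0 ≤ inner ℝ (S x + z) (x - z) := by
  have hball : ∀ x z : H, z ∈ Metric.closedBall ((1 / 2 : ℝ) • (x - S x)) (1 / 2 * ‖x + S x‖) ↔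
      0 ≤ inner ℝ (S x + z) (x - z) := by
    intro x z
    rw [mem_closedBall_iff_norm, ← abs_of_nonneg (norm_nonneg (z - _)),
      ← abs_of_nonneg (by positivity : 0 ≤ 1 / 2 * ‖x + S x‖), ← sq_le_sq, mul_pow,
      norm_add_sq_real, norm_sub_sq_real, norm_smul, mul_pow, norm_sub_sq_real]
    simp only [inner_add_left, inner_sub_right, inner_smul_right, real_inner_self_eq_norm_sq]
    rw [real_inner_comm (S x) x, real_inner_comm z (S x)]
    norm_num
    constructor <;> intro h <;> nlinarith
  let B : H → Set (WeakDual ℝ H) := fun x => WeakDual.toStrongDual ⁻¹' Metric.closedBall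
    (InnerProductSpace.toDual ℝ H ((1 / 2 : ℝ) • (x - S x))) (1 / 2 * ‖x + S x‖)
  have hB : ∀ x z, StrongDual.toWeakDual (InnerProductSpace.toDual ℝ H z) ∈ B x ↔
      0 ≤ inner ℝ (S x + z) (x - z) := by
    intro x z
    rw [← hball]
    change InnerProductSpace.toDual ℝ H z ∈ Metric.closedBall _ _ ↔ _
    rw [Metric.mem_closedBall, Metric.mem_closedBall, LinearIsometryEquiv.dist_map]
  have hne : (B 0 ∩ ⋂ x, B x).Nonempty := by
    refine (WeakDual.isCompact_closedBall _ _).inter_iInter_nonempty B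
      (fun x => WeakDual.isClosed_closedBall _ _) fun u => ?_
    classical
    have : Nonempty ↥(insert (0 : H) u) := ⟨⟨0, Finset.mem_insert_self _ _⟩⟩
    obtain ⟨z, hz⟩ := exists_forall_inner_nonneg_of_monotone
      (fun i : ↥(insert (0 : H) u) => (i : H)) (fun i => S i) (fun i j => hmono i j)
    refine ⟨StrongDual.toWeakDual (InnerProductSpace.toDual ℝ H z),
      (hB 0 z).2 (hz ⟨0, Finset.mem_insert_self _ _⟩), ?_⟩
    simp only [mem_iInter]
    exact fun i hi => (hB i z).2 (hz ⟨i, Finset.mem_insert_of_mem hi⟩)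
  obtain ⟨f, -, hf⟩ := hne
  refine ⟨(InnerProductSpace.toDual ℝ H).symm (WeakDual.toStrongDual f), fun x => ?_⟩
  rw [← hB]
  simpa using mem_iInter.1 hf x

/-- **Minty's theorem**: a strongly monotone hemicontinuous operator on a Hilbert space
has a zero. -/
theorem exists_eq_zero_of_strongly_monotone [CompleteSpace H] (T : H → H) {κ : ℝ} (hκ : 0 < κ)
    (hmono : ∀ x y, κ * ‖x - y‖ ^ 2 ≤ inner ℝ (T x - T y) (x - y))
    (hcont : ∀ x h, Tendsto (fun t : ℝ => inner ℝ (T (x + t • h)) h) (𝓝 0)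
      (𝓝 (inner ℝ (T x) h))) :
    ∃ x, T x = 0 := by
  -- Strong monotonicity says that κ⁻¹T - id is still monotone. The resulting inequality, taken at z
  -- + t • h and divided by t, loses its quadratic term as t ↓ 0.
  obtain ⟨z, hz⟩ := exists_forall_inner_add_nonneg_of_monotone (fun x => κ⁻¹ • T x - x) (by
    intro x y
    have h : κ⁻¹ • T x - x - (κ⁻¹ • T y - y) = κ⁻¹ • (T x - T y) - (x - y) := by module
    rw [h, inner_sub_left, inner_smul_left, real_inner_self_eq_norm_sq, sub_nonneg]
    simp only [conj_trivial]
    rw [inv_mul_eq_div, le_div_iff₀ hκ]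
    linarith [hmono x y])
  refine ⟨z, ?_⟩
  have h1 : ∀ h, 0 ≤ inner ℝ (T z) h := by
    intro h
    have hlim : Tendsto (fun t : ℝ => κ⁻¹ * inner ℝ (T (z + t • h)) h - t * ‖h‖ ^ 2) (𝓝[>] 0)
        (𝓝 (κ⁻¹ * inner ℝ (T z) h - 0 * ‖h‖ ^ 2)) :=
      (((hcont z h).const_mul _).sub (tendsto_id.mul_const _)).mono_left nhdsWithin_le_nhds
    have : 0 ≤ κ⁻¹ * inner ℝ (T z) h - 0 * ‖h‖ ^ 2 := by
      refine ge_of_tendsto hlim ?_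
      filter_upwards [self_mem_nhdsWithin] with t (ht : 0 < t)
      have := hz (z + t • h)
      have e : κ⁻¹ • T (z + t • h) - (z + t • h) + z = κ⁻¹ • T (z + t • h) - t • h := by module
      rw [e, add_sub_cancel_left, inner_smul_right, inner_sub_left, inner_smul_left,
        inner_smul_left, real_inner_self_eq_norm_sq] at this
      simpa using nonneg_of_mul_nonneg_right this ht
    rw [zero_mul, sub_zero] at this
    exact nonneg_of_mul_nonneg_right this (inv_pos.2 hκ)
  have := h1 (-T z)
  rw [inner_neg_right, real_inner_self_eq_norm_sq] at this
  have h0 : ‖T z‖ ^ 2 = 0 := le_antisymm (by linarith) (by positivity)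
  simpa using h0

end Minty

set_option linter.unusedSectionVars false

/-! ### Poincaré inequalities on convex sets and on unions -/

section Poincare

theorem ennreal_add_sq_le (a b : ℝ≥0∞) : (a + b) ^ 2 ≤ 2 * a ^ 2 + 2 * b ^ 2 := by
  rcases eq_or_ne a ⊤ with rfl | ha
  · simp
  rcases eq_or_ne b ⊤ with rfl | hb
  · simp
  lift a to ℝ≥0 using ha
  lift b to ℝ≥0 using hb
  rw [← mul_add]
  exact_mod_cast add_sq_le (a := a) (b := b)

theorem enorm_add_sq_le {F : Type*} [NormedAddCommGroup F] (a b : F) :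
    ‖a + b‖ₑ ^ 2 ≤ 2 * ‖a‖ₑ ^ 2 + 2 * ‖b‖ₑ ^ 2 :=
  (pow_le_pow_left₀ zero_le (enorm_add_le a b) 2).trans (ennreal_add_sq_le _ _)

theorem enorm_sub_sq_le {F : Type*} [NormedAddCommGroup F] (a b c : F) :
    ‖a - c‖ₑ ^ 2 ≤ 2 * ‖a - b‖ₑ ^ 2 + 2 * ‖b - c‖ₑ ^ 2 := by
  simpa using enorm_add_sq_le (a - b) (b - c)

theorem lintegral_sq_le {α : Type*} [MeasurableSpace α] (μ : Measure α) {f : α → ℝ≥0∞}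
    (hf : AEMeasurable f μ) : (∫⁻ x, f x ∂μ) ^ 2 ≤ μ univ * ∫⁻ x, f x ^ 2 ∂μ := by
  have h := ENNReal.lintegral_mul_le_Lp_mul_Lq μ Real.HolderConjugate.two_two hf
    (aemeasurable_const (b := (1 : ℝ≥0∞)))
  have h2 := pow_le_pow_left₀ zero_le h 2
  simp only [Pi.mul_apply, mul_one, ENNReal.one_rpow, lintegral_const, one_mul, mul_pow,
    ← ENNReal.rpow_natCast, ← ENNReal.rpow_mul] at h2
  norm_num at h2
  rw [mul_comm]
  exact_mod_cast h2

variable {E : Type*} [NormedAddCommGroup E] [NormedSpace ℝ E]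

theorem enorm_sub_sq_le_lintegral_ray {φ : E → ℝ} (hφ : ContDiff ℝ 1 φ) (x v : E) {T : ℝ}
    (hT : 0 ≤ T) :
    ‖φ (x + T • v) - φ x‖ₑ ^ 2 ≤ ENNReal.ofReal T *
      (‖v‖ₑ ^ 2 * ∫⁻ t in Ioc (0 : ℝ) T, ‖fderiv ℝ φ (x + t • v)‖ₑ ^ 2) := by
  have hc : Continuous (fderiv ℝ φ) := hφ.continuous_fderiv one_ne_zero
  have hline : Continuous fun t : ℝ => x + t • v := by fun_prop
  have hd : ∀ t : ℝ, HasDerivAt (fun t : ℝ => φ (x + t • v)) (fderiv ℝ φ (x + t • v) v) t := by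
    intro t
    have h1 : HasDerivAt (fun t : ℝ => x + t • v) v t := by
      simpa using ((hasDerivAt_id t).smul_const v).const_add x
    exact ((hφ.differentiable one_ne_zero _).hasFDerivAt).comp_hasDerivAt t h1
  have hcont : Continuous fun t : ℝ => fderiv ℝ φ (x + t • v) v :=
    (hc.comp hline).clm_apply continuous_const
  have h := intervalIntegral.integral_eq_sub_of_hasDerivAt (fun t _ => hd t)
    (hcont.intervalIntegrable 0 T)
  rw [intervalIntegral.integral_of_le hT] at h
  simp only [zero_smul, add_zero] at h
  have h1 : ‖φ (x + T • v) - φ x‖ₑ ≤ ∫⁻ t in Ioc (0 : ℝ) T,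
      ‖fderiv ℝ φ (x + t • v)‖ₑ * ‖v‖ₑ := by
    rw [← h]
    exact (enorm_integral_le_lintegral_enorm _).trans
      (lintegral_mono fun t => ContinuousLinearMap.le_opENorm _ _)
  have hm : Measurable fun t : ℝ => ‖fderiv ℝ φ (x + t • v)‖ₑ :=
    (hc.comp hline).enorm.measurable
  rw [lintegral_mul_const _ hm] at h1
  refine (pow_le_pow_left₀ zero_le h1 2).trans ?_
  have h2 := lintegral_sq_le (volume.restrict (Ioc (0 : ℝ) T)) hm.aemeasurable
  rw [Measure.restrict_apply_univ, Real.volume_Ioc, sub_zero] at h2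
  rw [mul_pow]
  calc _ ≤ ENNReal.ofReal T * (∫⁻ t in Ioc (0 : ℝ) T, ‖fderiv ℝ φ (x + t • v)‖ₑ ^ 2) *
        ‖v‖ₑ ^ 2 := by gcongr
    _ = _ := by ring

theorem enorm_sub_sq_le_segment {φ : E → ℝ} (hφ : ContDiff ℝ 1 φ) (x y : E) :
    ‖φ x - φ y‖ₑ ^ 2 ≤
      ‖x - y‖ₑ ^ 2 * ∫⁻ t in Ioc (0 : ℝ) 1, ‖fderiv ℝ φ (x + t • (y - x))‖ₑ ^ 2 := by
  have h := enorm_sub_sq_le_lintegral_ray hφ x (y - x) zero_le_one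
  rw [← enorm_neg (φ x - φ y), neg_sub, ← enorm_neg (x - y), neg_sub]
  simpa using h

variable [FiniteDimensional ℝ E] [MeasurableSpace E] [BorelSpace E] (μ : Measure E)
  [μ.IsAddHaarMeasure]

/-- The contraction towards x maps a convex set into itself, and t ≥ 1/2 keeps the inverse Jacobian
below 2ⁿ. -/
theorem setLIntegral_comp_smul_add_le {A : Set E} (hA : Convex ℝ A)
    {f : E → ℝ≥0∞} (hf : Measurable f) (hAm : MeasurableSet A) {t : ℝ} (ht : 1 / 2 ≤ t)
    (ht1 : t ≤ 1) {x : E} (hx : x ∈ A) :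
    ∫⁻ y in A, f (x + t • (y - x)) ∂μ ≤ 2 ^ Module.finrank ℝ E * ∫⁻ y in A, f y ∂μ := by
  have ht0 : 0 < t := by linarith
  calc ∫⁻ y in A, f (x + t • (y - x)) ∂μ
      ≤ ∫⁻ y in A, A.indicator f ((x - t • x) + t • y) ∂μ := by
        refine setLIntegral_mono' hAm fun y hy => ?_
        have e : x + t • (y - x) = (x - t • x) + t • y := by module
        have hmem : (x - t • x) + t • y ∈ A := by
          rw [← e]; exact hA.add_smul_sub_mem hx hy ⟨ht0.le, ht1⟩
        rw [indicator_of_mem hmem, e]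
    _ ≤ ∫⁻ y, A.indicator f ((x - t • x) + t • y) ∂μ := setLIntegral_le_lintegral _ _
    _ = ∫⁻ z, A.indicator f ((x - t • x) + z) ∂(Measure.map (fun y => t • y) μ) := by
        rw [lintegral_map (f := fun z => A.indicator f ((x - t • x) + z))
          ((hf.indicator hAm).comp (measurable_const_add _)) (measurable_const_smul t)]
    _ = ENNReal.ofReal |(t ^ Module.finrank ℝ E)⁻¹| * ∫⁻ z in A, f z ∂μ := by
        rw [Measure.map_addHaar_smul μ ht0.ne', lintegral_smul_measure, smul_eq_mul,
          lintegral_add_left_eq_self (μ := μ) (fun z => A.indicator f z), lintegral_indicator hAm]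
    _ ≤ _ := by
        gcongr
        have h2 : |(t ^ Module.finrank ℝ E)⁻¹| ≤ 2 ^ Module.finrank ℝ E := by
          rw [abs_of_pos (by positivity), ← inv_pow]
          gcongr
          rw [inv_le_comm₀ ht0 two_pos]; linarith
        refine (ENNReal.ofReal_le_ofReal h2).trans (le_of_eq ?_)
        rw [ENNReal.ofReal_pow (by norm_num)]; simp

/-- The set `A` supports a Poincaré inequality whose right-hand side is the Dirichlet integral
over `R`. -/
def SupportsPoincare (R A : Set E) : Prop :=
  ∃ C : ℝ≥0, ∀ φ : E → ℝ, ContDiff ℝ 1 φ → ∃ c : ℝ,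
    ∫⁻ x in A, ‖φ x - c‖ₑ ^ 2 ∂μ ≤ C * ∫⁻ x in R, ‖fderiv ℝ φ x‖ₑ ^ 2 ∂μ

variable {μ}

theorem SupportsPoincare.mono {R A B : Set E} (h : SupportsPoincare μ R A) (hBA : B ⊆ A) :
    SupportsPoincare μ R B := by
  obtain ⟨C, hC⟩ := h
  refine ⟨C, fun φ hφ => ?_⟩
  obtain ⟨c, hc⟩ := hC φ hφ
  exact ⟨c, (lintegral_mono_set hBA).trans hc⟩

theorem supportsPoincare_of_measure_zero (R : Set E) {A : Set E} (hA : μ A = 0) :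
    SupportsPoincare μ R A := by
  refine ⟨0, fun φ _ => ⟨0, ?_⟩⟩
  rw [Measure.restrict_eq_zero.2 hA]
  simp

/-- Integrate |φ x - φ y|² over A × A, with Cauchy–Schwarz along segments. The point x + t(y - x) is
a controlled change of variable in y when t ≥ 1/2, and in x when t ≤ 1/2. -/
theorem supportsPoincare_of_convex {R A : Set E} (hA : Convex ℝ A) (hAm : MeasurableSet A)
    (hb : Bornology.IsBounded A) (hAR : A ⊆ R) : SupportsPoincare μ R A := by
  rcases eq_or_ne (μ A) 0 with h0 | h0
  · exact supportsPoincare_of_measure_zero R h0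
  have hfin : μ A ≠ ⊤ := hb.measure_lt_top.ne
  obtain ⟨d, hd⟩ := hb.exists_norm_le
  have hdiam : ∀ x ∈ A, ∀ y ∈ A, ‖x - y‖ₑ ^ 2 ≤ ((2 * d.toNNReal) ^ 2 : ℝ≥0) := by
    intro x hx y hy
    have h1 : ‖x - y‖₊ ≤ 2 * d.toNNReal := by
      have hx' := Real.le_toNNReal_iff_coe_le ((norm_nonneg x).trans (hd x hx)) |>.2
        (show ((‖x‖₊ : ℝ≥0) : ℝ) ≤ d from hd x hx)
      have hy' := Real.le_toNNReal_iff_coe_le ((norm_nonneg x).trans (hd x hx)) |>.2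
        (show ((‖y‖₊ : ℝ≥0) : ℝ) ≤ d from hd y hy)
      calc ‖x - y‖₊ ≤ ‖x‖₊ + ‖y‖₊ := nnnorm_sub_le x y
        _ ≤ _ := by rw [two_mul]; gcongr
    rw [ENNReal.coe_pow]
    gcongr
    exact_mod_cast h1
  refine ⟨(2 * d.toNNReal) ^ 2 * 2 ^ Module.finrank ℝ E, fun φ hφ => ?_⟩
  set D : E → ℝ≥0∞ := fun x => ‖fderiv ℝ φ x‖ₑ ^ 2 with hD
  have hDm : Measurable D := (hφ.continuous_fderiv one_ne_zero).enorm.measurable.pow_const 2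
  have hφm : Measurable φ := hφ.continuous.measurable
  have hsec : ∀ t ∈ Ioc (0 : ℝ) 1, ∫⁻ x in A, ∫⁻ y in A, D (x + t • (y - x)) ∂μ ∂μ ≤
      μ A * (2 ^ Module.finrank ℝ E * ∫⁻ y in A, D y ∂μ) := by
    intro t ht
    rcases le_total (1 / 2) t with h | h
    · calc _ ≤ ∫⁻ x in A, (2 ^ Module.finrank ℝ E * ∫⁻ y in A, D y ∂μ) ∂μ :=
            setLIntegral_mono' hAm fun x hx =>
              setLIntegral_comp_smul_add_le μ hA hDm hAm h ht.2 hx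
        _ = _ := by rw [setLIntegral_const, mul_comm]
    · rw [lintegral_lintegral_swap (by
        refine (hDm.comp ?_).aemeasurable
        exact Continuous.measurable (by fun_prop))]
      calc _ ≤ ∫⁻ x in A, (2 ^ Module.finrank ℝ E * ∫⁻ y in A, D y ∂μ) ∂μ := by
            refine setLIntegral_mono' hAm fun y hy => ?_
            have := setLIntegral_comp_smul_add_le μ hA hDm hAm (t := 1 - t) (by linarith)
              (by linarith [ht.1]) hy
            refine le_trans (le_of_eq ?_) this
            refine lintegral_congr fun x => ?_
            congr 1; module
        _ = _ := by rw [setLIntegral_const, mul_comm]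
  have hdouble : ∫⁻ x in A, ∫⁻ y in A, ‖φ y - φ x‖ₑ ^ 2 ∂μ ∂μ ≤
      ((2 * d.toNNReal) ^ 2 : ℝ≥0) * (μ A * (2 ^ Module.finrank ℝ E * ∫⁻ y in A, D y ∂μ)) := by
    calc _ ≤ ∫⁻ x in A, ∫⁻ y in A, ((2 * d.toNNReal) ^ 2 : ℝ≥0) *
            (∫⁻ t in Ioc (0 : ℝ) 1, D (x + t • (y - x))) ∂μ ∂μ := by
          refine setLIntegral_mono' hAm fun x hx => setLIntegral_mono' hAm fun y hy => ?_
          rw [← enorm_neg, neg_sub]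
          exact (enorm_sub_sq_le_segment hφ x y).trans (by gcongr; exact hdiam x hx y hy)
      _ = ((2 * d.toNNReal) ^ 2 : ℝ≥0) * ∫⁻ t in Ioc (0 : ℝ) 1,
            ∫⁻ x in A, ∫⁻ y in A, D (x + t • (y - x)) ∂μ ∂μ := by
          have hm4 : ∀ x, Measurable fun p : E × ℝ => D (x + p.2 • (p.1 - x)) := fun x =>
            hDm.comp (Continuous.measurable (by fun_prop))
          have hm2 : ∀ x, Measurable fun y : E => ∫⁻ t in Ioc (0 : ℝ) 1, D (x + t • (y - x)) :=
            fun x => (hm4 x).lintegral_prod_right'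
          have hm5 : Measurable fun p : (E × ℝ) × E => D (p.1.1 + p.1.2 • (p.2 - p.1.1)) :=
            hDm.comp (Continuous.measurable (by fun_prop))
          have e1 : ∀ x, ∫⁻ y in A, ((2 * d.toNNReal) ^ 2 : ℝ≥0) *
              (∫⁻ t in Ioc (0 : ℝ) 1, D (x + t • (y - x))) ∂μ =
              ((2 * d.toNNReal) ^ 2 : ℝ≥0) *
                ∫⁻ t in Ioc (0 : ℝ) 1, ∫⁻ y in A, D (x + t • (y - x)) ∂μ := by
            intro x
            rw [lintegral_const_mul _ (hm2 x),
              lintegral_lintegral_swap (hm4 x).aemeasurable]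
          simp_rw [e1]
          have hm6 : Measurable fun p : E × ℝ => ∫⁻ y in A, D (p.1 + p.2 • (y - p.1)) ∂μ :=
            hm5.lintegral_prod_right'
          rw [lintegral_const_mul _ hm6.lintegral_prod_right',
            lintegral_lintegral_swap hm6.aemeasurable]
      _ ≤ ((2 * d.toNNReal) ^ 2 : ℝ≥0) * ∫⁻ t in Ioc (0 : ℝ) 1,
            (μ A * (2 ^ Module.finrank ℝ E * ∫⁻ y in A, D y ∂μ)) := by
          exact mul_le_mul_right (setLIntegral_mono' measurableSet_Ioc hsec) _
      _ = _ := by simp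
  have hmeas : Measurable fun x => ∫⁻ y in A, ‖φ y - φ x‖ₑ ^ 2 ∂μ := by
    have : Measurable fun p : E × E => ‖φ p.2 - φ p.1‖ₑ ^ 2 :=
      (((hφm.comp measurable_snd).sub (hφm.comp measurable_fst)).enorm.pow_const 2)
    exact this.lintegral_prod_right'
  -- The constant is the value of φ at a point whose inner integral is at most the average.
  obtain ⟨x, -, hx⟩ := exists_le_setLAverage h0 hfin hmeas.aemeasurable.restrict
  refine ⟨φ x, hx.trans ?_⟩
  rw [setLAverage_eq]
  refine (ENNReal.div_le_of_le_mul ?_)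
  refine hdouble.trans ?_
  have hle : ∫⁻ y in A, D y ∂μ ≤ ∫⁻ y in R, D y ∂μ := lintegral_mono_set hAR
  push_cast
  calc _ ≤ ((2 * (d.toNNReal : ℝ≥0∞)) ^ 2) * (μ A * (2 ^ Module.finrank ℝ E *
        ∫⁻ y in R, D y ∂μ)) := by gcongr
    _ = _ := by ring

/-- On the overlap both constants approximate φ, so |c₂ - c₁|² times its measure is bounded by the
Dirichlet integral. The ratio K of the measures of B and of the overlap transfers this to all of B.
-/
theorem SupportsPoincare.union {R A B : Set E} (hA : SupportsPoincare μ R A)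
    (hB : SupportsPoincare μ R B) (hAB : μ (A ∩ B) ≠ 0) (hBfin : μ B ≠ ⊤) :
    SupportsPoincare μ R (A ∪ B) := by
  obtain ⟨C₁, h₁⟩ := hA
  obtain ⟨C₂, h₂⟩ := hB
  have hfin : μ (A ∩ B) ≠ ⊤ := measure_ne_top_of_subset inter_subset_right hBfin
  set K : ℝ≥0∞ := μ B * (μ (A ∩ B))⁻¹ with hK
  have hKfin : K ≠ ⊤ := ENNReal.mul_ne_top hBfin (ENNReal.inv_ne_top.2 hAB)
  refine ⟨C₁ + 2 * C₂ + 2 * (K.toNNReal * (2 * C₁ + 2 * C₂)), fun φ hφ => ?_⟩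
  obtain ⟨c₁, hc₁⟩ := h₁ φ hφ
  obtain ⟨c₂, hc₂⟩ := h₂ φ hφ
  set D := ∫⁻ x in R, ‖fderiv ℝ φ x‖ₑ ^ 2 ∂μ
  have hφm : Measurable φ := hφ.continuous.measurable
  have hm : ∀ c : ℝ, Measurable fun x => ‖φ x - c‖ₑ ^ 2 := fun c =>
    (hφm.sub_const c).enorm.pow_const 2
  have hdiff : ‖c₂ - c₁‖ₑ ^ 2 * μ (A ∩ B) ≤ (2 * C₁ + 2 * C₂) * D := by
    rw [← setLIntegral_const]
    calc _ ≤ ∫⁻ x in A ∩ B, (2 * ‖φ x - c₁‖ₑ ^ 2 + 2 * ‖φ x - c₂‖ₑ ^ 2) ∂μ := by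
          refine lintegral_mono fun x => ?_
          refine (enorm_sub_sq_le c₂ (φ x) c₁).trans ?_
          rw [← enorm_neg (c₂ - φ x), neg_sub, add_comm]
      _ = 2 * ∫⁻ x in A ∩ B, ‖φ x - c₁‖ₑ ^ 2 ∂μ + 2 * ∫⁻ x in A ∩ B, ‖φ x - c₂‖ₑ ^ 2 ∂μ := by
          rw [lintegral_add_left ((hm c₁).const_mul 2), lintegral_const_mul _ (hm c₁),
            lintegral_const_mul _ (hm c₂)]
      _ ≤ 2 * (C₁ * D) + 2 * (C₂ * D) := by
          gcongr
          · exact (lintegral_mono_set inter_subset_left).trans hc₁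
          · exact (lintegral_mono_set inter_subset_right).trans hc₂
      _ = _ := by ring
  have hdiff' : ‖c₂ - c₁‖ₑ ^ 2 * μ B ≤ K * ((2 * C₁ + 2 * C₂) * D) := by
    calc ‖c₂ - c₁‖ₑ ^ 2 * μ B = K * (‖c₂ - c₁‖ₑ ^ 2 * μ (A ∩ B)) := by
          rw [hK]
          calc _ = ‖c₂ - c₁‖ₑ ^ 2 * μ B * ((μ (A ∩ B))⁻¹ * μ (A ∩ B)) := by
                rw [ENNReal.inv_mul_cancel hAB hfin, mul_one]
            _ = _ := by ring
      _ ≤ _ := by gcongr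
  refine ⟨c₁, (lintegral_union_le _ _ _).trans ?_⟩
  have hB' : ∫⁻ x in B, ‖φ x - c₁‖ₑ ^ 2 ∂μ ≤
      2 * (C₂ * D) + 2 * (K * ((2 * C₁ + 2 * C₂) * D)) := by
    calc _ ≤ ∫⁻ x in B, (2 * ‖φ x - c₂‖ₑ ^ 2 + 2 * ‖c₂ - c₁‖ₑ ^ 2) ∂μ :=
          lintegral_mono fun x => enorm_sub_sq_le (φ x) c₂ c₁
      _ = 2 * ∫⁻ x in B, ‖φ x - c₂‖ₑ ^ 2 ∂μ + 2 * (‖c₂ - c₁‖ₑ ^ 2 * μ B) := by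
          rw [lintegral_add_left ((hm c₂).const_mul 2), lintegral_const_mul _ (hm c₂),
            setLIntegral_const, mul_assoc]
      _ ≤ _ := by gcongr
  refine (add_le_add hc₁ hB').trans (le_of_eq ?_)
  push_cast
  rw [ENNReal.coe_toNNReal hKfin]
  ring

end Poincare

/-! ### Lipschitz graphs and local inequalities in a chart -/

section Graph

variable {E : Type*} [NormedAddCommGroup E] [InnerProductSpace ℝ E]

/-- The graph, in the direction `e`, of a function `h` of the component orthogonal to `e`. -/
def graphOver (e : E) (h : E → ℝ) : Set E := {x | inner ℝ x e = h (x - inner ℝ x e • e)}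

/-- The parametrisation of `graphOver e h` by the hyperplane orthogonal to `e`. -/
def graphMap (e : E) (h : E → ℝ) (x : (ℝ ∙ e)ᗮ) : E := x + h x • e

variable {e : E} {h : E → ℝ} {K : ℝ≥0}

theorem inner_coe_orthogonal (x : (ℝ ∙ e)ᗮ) : inner ℝ (x : E) e = 0 := by
  rw [real_inner_comm]
  exact Submodule.mem_orthogonal_singleton_iff_inner_right.1 x.2

theorem sub_inner_smul_mem_orthogonal (he : ‖e‖ = 1) (x : E) :
    x - inner ℝ x e • e ∈ (ℝ ∙ e)ᗮ := by
  rw [Submodule.mem_orthogonal_singleton_iff_inner_right, inner_sub_right, inner_smul_right,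
    real_inner_self_eq_norm_sq, he, real_inner_comm]
  ring

theorem norm_le_norm_graphMap (x : (ℝ ∙ e)ᗮ) : ‖x‖ ≤ ‖graphMap e h x‖ := by
  have h1 : ‖graphMap e h x‖ ^ 2 = ‖(x : E)‖ ^ 2 + ‖h x • e‖ ^ 2 := by
    rw [graphMap, norm_add_sq_real, inner_smul_right, inner_coe_orthogonal]
    ring
  refine le_of_sq_le_sq ?_ (norm_nonneg _)
  rw [h1]
  simp

theorem lipschitzWith_graphMap (he : ‖e‖ = 1) (hh : LipschitzWith K h) :
    LipschitzWith (1 + K) (graphMap e h) := by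
  refine (LipschitzWith.subtype_val _).add ?_
  refine LipschitzWith.of_dist_le_mul fun x y => ?_
  rw [dist_eq_norm, ← sub_smul, norm_smul, he, mul_one, ← dist_eq_norm]
  exact hh.dist_le_mul _ _

theorem graphOver_subset_range (he : ‖e‖ = 1) : graphOver e h ⊆ range (graphMap e h) := by
  intro x hx
  refine ⟨⟨x - inner ℝ x e • e, sub_inner_smul_mem_orthogonal he x⟩, ?_⟩
  have hx' : inner ℝ x e = h (x - inner ℝ x e • e) := hx
  rw [graphMap]
  simp only [← hx', sub_add_cancel]

variable [FiniteDimensional ℝ E] [MeasurableSpace E] [BorelSpace E]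

/-- The graph lies in the image of a hyperplane under the (1 + K)-Lipschitz `graphMap`, which
enlarges d-dimensional measure by at most (1 + K)^d. -/
theorem euclideanHausdorffMeasure_graphOver_inter_le (he : ‖e‖ = 1) (hh : LipschitzWith K h)
    (d : ℕ) (S : Set E) :
    Measure.euclideanHausdorffMeasure d (S ∩ graphOver e h) ≤
      ((1 + K : ℝ≥0) : ℝ≥0∞) ^ d * Measure.euclideanHausdorffMeasure d (graphMap e h ⁻¹' S) := by
  have h1 : S ∩ graphOver e h ⊆ graphMap e h '' (graphMap e h ⁻¹' S) := by
    rw [image_preimage_eq_inter_range]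
    exact inter_subset_inter_right _ (graphOver_subset_range he)
  refine (measure_mono h1).trans ?_
  simp only [Measure.euclideanHausdorffMeasure_def, Measure.smul_apply]
  have h2 := (lipschitzWith_graphMap he hh).hausdorffMeasure_image_le (Nat.cast_nonneg d)
    (graphMap e h ⁻¹' S)
  simp only [ENNReal.smul_def, smul_eq_mul]
  rw [ENNReal.rpow_natCast] at h2
  calc _ ≤ _ := mul_le_mul_right h2 _
    _ = _ := by ring

theorem restrict_graphOver_le_map (he : ‖e‖ = 1) (hh : LipschitzWith K h) (d : ℕ) :
    (Measure.euclideanHausdorffMeasure d).restrict (graphOver e h) ≤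
      ((1 + K : ℝ≥0) : ℝ≥0∞) ^ d •
        Measure.map (graphMap e h) (Measure.euclideanHausdorffMeasure d) := by
  refine Measure.le_iff.2 fun S hS => ?_
  rw [Measure.restrict_apply hS, Measure.smul_apply, smul_eq_mul,
    Measure.map_apply (lipschitzWith_graphMap he hh).continuous.measurable hS]
  exact euclideanHausdorffMeasure_graphOver_inter_le he hh d S

/-- The hyperplane has dimension d, where the Euclidean Hausdorff measure is a Haar measure; bounded
sets are then of finite measure and Fubini applies. -/
theorem isAddHaarMeasure_orthogonal (he : ‖e‖ = 1) {d : ℕ} (hd : Module.finrank ℝ E = d + 1) :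
    (Measure.euclideanHausdorffMeasure d : Measure (ℝ ∙ e)ᗮ).IsAddHaarMeasure := by
  have : Fact (Module.finrank ℝ E = d + 1) := ⟨hd⟩
  have he0 : e ≠ 0 := fun h => by simp [h] at he
  have h := Submodule.finrank_orthogonal_span_singleton (𝕜 := ℝ) (n := d) he0
  have h2 : (Measure.euclideanHausdorffMeasure (Module.finrank ℝ (ℝ ∙ e)ᗮ) :
    Measure (ℝ ∙ e)ᗮ).IsAddHaarMeasure := inferInstance
  rwa [h] at h2

theorem euclideanHausdorffMeasure_graphOver_bounded_lt_top (he : ‖e‖ = 1)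
    (hh : LipschitzWith K h) {d : ℕ} (hd : Module.finrank ℝ E = d + 1) {B : Set E}
    (hB : Bornology.IsBounded B) :
    Measure.euclideanHausdorffMeasure d (B ∩ graphOver e h) < ⊤ := by
  have := isAddHaarMeasure_orthogonal he hd
  refine (euclideanHausdorffMeasure_graphOver_inter_le he hh d B).trans_lt ?_
  refine ENNReal.mul_lt_top (ENNReal.pow_lt_top ENNReal.coe_lt_top) ?_
  obtain ⟨R, hR⟩ := hB.exists_norm_le
  refine Bornology.IsBounded.measure_lt_top (isBounded_iff_forall_norm_le.2 ⟨R, fun x hx => ?_⟩)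
  exact (norm_le_norm_graphMap x).trans (hR _ hx)

theorem bijective_coprod_orthogonal (he : ‖e‖ = 1) : Function.Bijective
    ((Submodule.subtype (ℝ ∙ e)ᗮ).coprod (LinearMap.toSpanSingleton ℝ E e)) := by
  refine ⟨fun p q hpq => ?_, fun x => ?_⟩
  · simp only [LinearMap.coprod_apply, Submodule.subtype_apply,
      LinearMap.toSpanSingleton_apply] at hpq
    have h2 : p.2 = q.2 := by
      have := congrArg (fun z => inner ℝ z e) hpq
      simpa [inner_add_left, inner_coe_orthogonal, inner_smul_left, real_inner_self_eq_norm_sq,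
        he] using this
    rw [h2] at hpq
    exact Prod.ext (Subtype.ext (add_right_cancel hpq)) h2
  · refine ⟨(⟨x - inner ℝ x e • e, sub_inner_smul_mem_orthogonal he x⟩, inner ℝ x e), ?_⟩
    simp

variable (μ : Measure E) [μ.IsAddHaarMeasure]

/-- Sweeping a Lipschitz graph along `e` produces at most a multiple of Lebesgue measure. -/
theorem exists_lintegral_graphOver_layer_le (he : ‖e‖ = 1) (hh : LipschitzWith K h) {d : ℕ}
    (hd : Module.finrank ℝ E = d + 1) :
    ∃ C : ℝ≥0, ∀ f : E → ℝ≥0∞, Measurable f →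
      ∫⁻ t : ℝ, ∫⁻ x in graphOver e h, f (x - t • e) ∂(Measure.euclideanHausdorffMeasure d) ≤
        C * ∫⁻ x, f x ∂μ := by
  have := isAddHaarMeasure_orthogonal he hd
  set ν : Measure (ℝ ∙ e)ᗮ := Measure.euclideanHausdorffMeasure d
  -- Linear coordinates hyperplane × line. By uniqueness of Haar measure they carry the product
  -- measure to a multiple c of μ.
  let Φ : ((ℝ ∙ e)ᗮ × ℝ) ≃L[ℝ] E :=
    (LinearEquiv.ofBijective _ (bijective_coprod_orthogonal he)).toContinuousLinearEquiv
  have hΦ : ∀ p, Φ p = (p.1 : E) + p.2 • e := fun p => by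
    simp [Φ]
  have hΦm : Measurable Φ := Φ.continuous.measurable
  have hHaar : (Measure.map Φ (ν.prod volume)).IsAddHaarMeasure := Φ.isAddHaarMeasure_map _
  set c := (Measure.map Φ (ν.prod volume)).addHaarScalarFactor μ
  have hc : Measure.map Φ (ν.prod volume) = c • μ := Measure.isAddLeftInvariant_eq_smul _ _
  refine ⟨(1 + K) ^ d * c, fun f hf => ?_⟩
  have hFm : Measurable (graphMap e h) := (lipschitzWith_graphMap he hh).continuous.measurable
  have h1 : ∀ t : ℝ, ∫⁻ x in graphOver e h, f (x - t • e) ∂(Measure.euclideanHausdorffMeasure d) ≤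
      ((1 + K : ℝ≥0) : ℝ≥0∞) ^ d * ∫⁻ x, f (graphMap e h x - t • e) ∂ν := by
    intro t
    refine (lintegral_mono' (restrict_graphOver_le_map he hh d) le_rfl).trans ?_
    rw [lintegral_smul_measure, smul_eq_mul,
      lintegral_map (f := fun x => f (x - t • e)) (hf.comp (measurable_sub_const _)) hFm]
  have hm : Measurable fun p : ℝ × (ℝ ∙ e)ᗮ => f (graphMap e h p.2 - p.1 • e) :=
    hf.comp ((hFm.comp measurable_snd).sub (measurable_fst.smul_const e))
  calc _ ≤ ∫⁻ t : ℝ, ((1 + K : ℝ≥0) : ℝ≥0∞) ^ d * ∫⁻ x, f (graphMap e h x - t • e) ∂ν :=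
        lintegral_mono h1
    _ = ((1 + K : ℝ≥0) : ℝ≥0∞) ^ d * ∫⁻ x, (∫⁻ t : ℝ, f (graphMap e h x - t • e)) ∂ν := by
        rw [lintegral_const_mul _ hm.lintegral_prod_right', lintegral_lintegral_swap hm.aemeasurable]
    _ = ((1 + K : ℝ≥0) : ℝ≥0∞) ^ d * ∫⁻ x, (∫⁻ t : ℝ, f (Φ (x, t))) ∂ν := by
        congr 1
        refine lintegral_congr fun x => ?_
        -- For fixed x, the substitution t ↦ h x - t straightens the graph.
        rw [← lintegral_sub_left_eq_self (fun t : ℝ => f (Φ (x, t))) (h x)]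
        refine lintegral_congr fun t => ?_
        rw [hΦ, graphMap]
        congr 1
        simp only
        module
    _ = ((1 + K : ℝ≥0) : ℝ≥0∞) ^ d * ∫⁻ x, f x ∂(c • μ) := by
        rw [← hc, lintegral_map hf hΦm, lintegral_prod (fun q => f (Φ q)) (hf.comp hΦm).aemeasurable]
    _ = _ := by
        rw [lintegral_smul_measure, ENNReal.smul_def, smul_eq_mul]
        push_cast
        ring

theorem norm_sub_inner_smul_le (he : ‖e‖ = 1) (y : E) : ‖y - inner ℝ y e • e‖ ≤ ‖y‖ := by
  refine le_of_sq_le_sq ?_ (norm_nonneg _)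
  rw [norm_sub_sq_real, inner_smul_right, norm_smul, he, mul_one, Real.norm_eq_abs, sq_abs]
  nlinarith [sq_nonneg (inner ℝ y e)]

theorem sub_smul_sub_inner_smul (he : ‖e‖ = 1) (x : E) (t : ℝ) :
    (x - t • e) - inner ℝ (x - t • e) e • e = x - inner ℝ x e • e := by
  rw [inner_sub_left, inner_smul_left, real_inner_self_eq_norm_sq, he]
  simp only [conj_trivial]
  module

variable {R : Set E} {p : E} {ρ : ℝ}

/-- Motion against e lowers the height and keeps the orthogonal component, so it stays below the
graph; r + t ≤ ρ keeps it inside the chart. -/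
theorem sub_smul_mem_of_subgraph (he : ‖e‖ = 1)
    (hR : ∀ x ∈ Metric.ball p ρ, x ∈ R ↔ inner ℝ x e ≤ h (x - inner ℝ x e • e)) {x : E} {r t : ℝ}
    (hx : x ∈ Metric.ball p r) (hxh : inner ℝ x e ≤ h (x - inner ℝ x e • e)) (ht : 0 ≤ t)
    (hrt : r + t ≤ ρ) : x - t • e ∈ R := by
  rw [mem_ball_iff_norm] at hx
  have hmem : x - t • e ∈ Metric.ball p ρ := by
    rw [mem_ball_iff_norm]
    calc ‖x - t • e - p‖ = ‖(x - p) - t • e‖ := by congr 1; module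
      _ ≤ ‖x - p‖ + ‖t • e‖ := norm_sub_le _ _
      _ = ‖x - p‖ + t := by rw [norm_smul, he, mul_one, Real.norm_of_nonneg ht]
      _ < ρ := by linarith
  rw [hR _ hmem, sub_smul_sub_inner_smul he, inner_sub_left, inner_smul_left,
    real_inner_self_eq_norm_sq, he]
  simp only [conj_trivial]
  linarith

/-- A displacement y raises the height by at most ‖y‖ and lowers the graph by at most K‖y‖. A
descent by s ≥ (1 + K)r compensates for both. -/
theorem ball_sub_smul_subset_of_subgraph (he : ‖e‖ = 1) (hh : LipschitzWith K h)
    (hR : ∀ x ∈ Metric.ball p ρ, x ∈ R ↔ inner ℝ x e ≤ h (x - inner ℝ x e • e))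
    (hp : p ∈ graphOver e h) {r s : ℝ} (hs : 0 ≤ s) (hrs : r + s ≤ ρ) (hr : (1 + K) * r ≤ s) :
    Metric.ball (p - s • e) r ⊆ R := by
  intro x hx
  rw [mem_ball_iff_norm] at hx
  set y := x - (p - s • e) with hy
  have hxy : x = y + p - s • e := by rw [hy]; module
  have hmem : x ∈ Metric.ball p ρ := by
    rw [mem_ball_iff_norm]
    calc ‖x - p‖ = ‖y - s • e‖ := by congr 1; rw [hy]; module
      _ ≤ ‖y‖ + ‖s • e‖ := norm_sub_le _ _
      _ = ‖y‖ + s := by rw [norm_smul, he, mul_one, Real.norm_of_nonneg hs]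
      _ < ρ := by linarith
  rw [hR x hmem, hxy, sub_smul_sub_inner_smul he, inner_sub_left, inner_add_left, inner_smul_left,
    real_inner_self_eq_norm_sq, he]
  have hp' : inner ℝ p e = h (p - inner ℝ p e • e) := hp
  have h1 : dist (h (y + p - (inner ℝ y e + inner ℝ p e) • e)) (h (p - inner ℝ p e • e)) ≤
      K * ‖y‖ := by
    refine (hh.dist_le_mul _ _).trans ?_
    rw [dist_eq_norm]
    gcongr
    refine le_trans (le_of_eq ?_) (norm_sub_inner_smul_le he y)
    congr 1; module
  have h2 : inner ℝ y e ≤ ‖y‖ := by simpa [he] using real_inner_le_norm y e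
  rw [Real.dist_eq, abs_le] at h1
  have h3 : (1 + K) * ‖y‖ ≤ (1 + K) * r := by gcongr
  simp only [conj_trivial]
  rw [← hp'] at h1
  linarith [h1.1]

variable {μ}

/-- The part of R near p is translated by -s • e into a ball inside R, where the convex case
applies; the translation costs a Dirichlet integral over R. The ball is kept in the union so that
the chart can later be glued to the rest of the cell. -/
theorem exists_supportsPoincare_of_subgraph (he : ‖e‖ = 1) (hh : LipschitzWith K h)
    (hρ : 0 < ρ) (hR : ∀ x ∈ Metric.ball p ρ, x ∈ R ↔ inner ℝ x e ≤ h (x - inner ℝ x e • e))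
    (hp : p ∈ graphOver e h) (hRm : MeasurableSet R) :
    ∃ r z, 0 < r ∧ Metric.ball z r ⊆ R ∧
      SupportsPoincare μ R ((Metric.ball p r ∩ R) ∪ Metric.ball z r) := by
  have hK : (0 : ℝ) < 1 + K := by positivity
  set s := ρ / 2 with hs
  set r := s / (1 + K) with hr
  have hs0 : 0 < s := by positivity
  have hr0 : 0 < r := by positivity
  have hrs : (1 + K) * r ≤ s := by rw [hr]; field_simp; exact le_rfl
  have hrs' : r ≤ s := by
    have : (0 : ℝ) ≤ K * r := by positivity
    linarith
  have hrρ : r + s ≤ ρ := by linarith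
  have hball := ball_sub_smul_subset_of_subgraph he hh hR hp hs0.le hrρ hrs
  obtain ⟨C, hC⟩ := supportsPoincare_of_convex (μ := μ) (convex_ball (p - s • e) r)
    measurableSet_ball Metric.isBounded_ball hball
  refine ⟨r, p - s • e, hr0, hball, 2 * (s.toNNReal * s.toNNReal) + 2 * C + C, fun φ hφ => ?_⟩
  obtain ⟨c, hc⟩ := hC φ hφ
  refine ⟨c, (lintegral_union_le _ _ _).trans ?_⟩
  set A := Metric.ball p r ∩ R with hA
  have hAm : MeasurableSet A := measurableSet_ball.inter hRm
  set D : E → ℝ≥0∞ := fun x => ‖fderiv ℝ φ x‖ₑ ^ 2 with hD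
  have hDm : Measurable D := (hφ.continuous_fderiv one_ne_zero).enorm.measurable.pow_const 2
  have hφm : Measurable φ := hφ.continuous.measurable
  have hsub : ∀ x ∈ A, ∀ t, 0 ≤ t → t ≤ s → x - t • e ∈ R := fun x hx t ht hts =>
    sub_smul_mem_of_subgraph he hR hx.1
      ((hR x (Metric.ball_subset_ball (by linarith) hx.1)).1 hx.2) ht (by linarith)
  have hshift : ∀ t ∈ Ioc (0 : ℝ) s, ∫⁻ x in A, D (x - t • e) ∂μ ≤ ∫⁻ x in R, D x ∂μ := by
    intro t ht
    calc _ ≤ ∫⁻ x in A, R.indicator D (x - t • e) ∂μ :=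
          setLIntegral_mono' hAm fun x hx => by
            rw [indicator_of_mem (hsub x hx t ht.1.le ht.2)]
      _ ≤ ∫⁻ x, R.indicator D (x - t • e) ∂μ := setLIntegral_le_lintegral _ _
      _ = _ := by rw [lintegral_sub_right_eq_self (fun x => R.indicator D x),
                    lintegral_indicator hRm]
  have hm2 : Measurable fun q : E × ℝ => D (q.1 - q.2 • e) :=
    hDm.comp (Continuous.measurable (by fun_prop))
  have h1 : ∫⁻ x in A, ‖φ x - φ (x - s • e)‖ₑ ^ 2 ∂μ ≤
      ENNReal.ofReal s * (ENNReal.ofReal s * ∫⁻ x in R, D x ∂μ) := by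
    calc _ ≤ ∫⁻ x in A, ENNReal.ofReal s * (∫⁻ t in Ioc (0 : ℝ) s, D (x - t • e)) ∂μ := by
          refine lintegral_mono fun x => ?_
          have := enorm_sub_sq_le_lintegral_ray hφ x (-e) hs0.le
          have he1 : ‖e‖ₑ = 1 := by rw [← ofReal_norm, he, ENNReal.ofReal_one]
          rw [enorm_neg, he1, one_pow, one_mul] at this
          simp only [smul_neg, ← sub_eq_add_neg] at this
          rw [← enorm_neg, neg_sub]
          exact this
      _ = ENNReal.ofReal s * ∫⁻ t in Ioc (0 : ℝ) s, ∫⁻ x in A, D (x - t • e) ∂μ := by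
          rw [lintegral_const_mul _ hm2.lintegral_prod_right',
            lintegral_lintegral_swap hm2.aemeasurable]
      _ ≤ ENNReal.ofReal s * ∫⁻ t in Ioc (0 : ℝ) s, ∫⁻ x in R, D x ∂μ :=
          mul_le_mul_right (setLIntegral_mono' measurableSet_Ioc hshift) _
      _ = _ := by rw [setLIntegral_const, Real.volume_Ioc, sub_zero, mul_comm (∫⁻ x in R, D x ∂μ)]
  have h2 : ∫⁻ x in A, ‖φ (x - s • e) - c‖ₑ ^ 2 ∂μ ≤ C * ∫⁻ x in R, D x ∂μ := by
    refine le_trans ?_ hc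
    calc _ ≤ ∫⁻ x in A, (Metric.ball (p - s • e) r).indicator (fun y => ‖φ y - c‖ₑ ^ 2)
            (x - s • e) ∂μ := by
          refine setLIntegral_mono' hAm fun x hx => ?_
          rw [indicator_of_mem]
          have := hx.1
          rw [mem_ball_iff_norm] at this ⊢
          simpa using this
      _ ≤ ∫⁻ x, (Metric.ball (p - s • e) r).indicator (fun y => ‖φ y - c‖ₑ ^ 2)
            (x - s • e) ∂μ := setLIntegral_le_lintegral _ _
      _ = _ := by
          rw [lintegral_sub_right_eq_self (fun x => (Metric.ball (p - s • e) r).indicator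
            (fun y => ‖φ y - c‖ₑ ^ 2) x), lintegral_indicator measurableSet_ball]
  have h3 : ∫⁻ x in A, ‖φ x - c‖ₑ ^ 2 ∂μ ≤
      2 * (ENNReal.ofReal s * (ENNReal.ofReal s * ∫⁻ x in R, D x ∂μ)) +
        2 * (C * ∫⁻ x in R, D x ∂μ) := by
    have hm3 : Measurable fun x => ‖φ x - φ (x - s • e)‖ₑ ^ 2 :=
      (hφm.sub (hφm.comp (measurable_sub_const _))).enorm.pow_const 2
    have hm4 : Measurable fun x => ‖φ (x - s • e) - c‖ₑ ^ 2 :=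
      ((hφm.comp (measurable_sub_const _)).sub_const c).enorm.pow_const 2
    calc _ ≤ ∫⁻ x in A, (2 * ‖φ x - φ (x - s • e)‖ₑ ^ 2 + 2 * ‖φ (x - s • e) - c‖ₑ ^ 2) ∂μ :=
          lintegral_mono fun x => enorm_sub_sq_le _ _ _
      _ = 2 * ∫⁻ x in A, ‖φ x - φ (x - s • e)‖ₑ ^ 2 ∂μ +
            2 * ∫⁻ x in A, ‖φ (x - s • e) - c‖ₑ ^ 2 ∂μ := by
          rw [lintegral_add_left (hm3.const_mul 2), lintegral_const_mul _ hm3,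
            lintegral_const_mul _ hm4]
      _ ≤ _ := by gcongr
  refine (add_le_add h3 hc).trans (le_of_eq ?_)
  push_cast
  rw [ENNReal.ofReal]
  ring

/-- Compare φ x with φ (x - t • e) and average over 0 < t ≤ s. The translated graphs sweep out at
most a multiple of μ by `exists_lintegral_graphOver_layer_le`. -/
theorem exists_trace_le_of_subgraph (he : ‖e‖ = 1) (hh : LipschitzWith K h) {d : ℕ}
    (hd : Module.finrank ℝ E = d + 1) (hρ : 0 < ρ)
    (hR : ∀ x ∈ Metric.ball p ρ, x ∈ R ↔ inner ℝ x e ≤ h (x - inner ℝ x e • e))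
    (hRm : MeasurableSet R) :
    ∃ r > 0, ∃ C : ℝ≥0, ∀ φ : E → ℝ, ContDiff ℝ 1 φ → ∀ c : ℝ,
      ∫⁻ x in Metric.ball p r ∩ graphOver e h, ‖φ x - c‖ₑ ^ 2
          ∂(Measure.euclideanHausdorffMeasure d) ≤
        C * (∫⁻ x in R, ‖φ x - c‖ₑ ^ 2 ∂μ + ∫⁻ x in R, ‖fderiv ℝ φ x‖ₑ ^ 2 ∂μ) := by
  obtain ⟨C, hC⟩ := exists_lintegral_graphOver_layer_le μ he hh hd
  set s := ρ / 2 with hs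
  have hs0 : 0 < s := by positivity
  have hΓm : MeasurableSet (graphOver e h) :=
    (isClosed_eq (by fun_prop) (hh.continuous.comp (by fun_prop))).measurableSet
  set S := Metric.ball p s ∩ graphOver e h with hS
  have hSm : MeasurableSet S := measurableSet_ball.inter hΓm
  set σ := (Measure.euclideanHausdorffMeasure d : Measure E).restrict S with hσ
  have : IsFiniteMeasure σ := ⟨by
    rw [hσ, Measure.restrict_apply_univ]
    exact euclideanHausdorffMeasure_graphOver_bounded_lt_top he hh hd Metric.isBounded_ball⟩
  have hsub : ∀ x ∈ S, ∀ t ∈ Ioc (0 : ℝ) s, x - t • e ∈ R := fun x hx t ht =>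
    sub_smul_mem_of_subgraph he hR hx.1 (le_of_eq hx.2) ht.1.le (by linarith [ht.2])
  have hlayer : ∀ f : E → ℝ≥0∞, Measurable f →
      ∫⁻ t in Ioc (0 : ℝ) s, ∫⁻ x, f (x - t • e) ∂σ ≤ C * ∫⁻ x in R, f x ∂μ := by
    intro f hf
    calc _ ≤ ∫⁻ t in Ioc (0 : ℝ) s, ∫⁻ x, R.indicator f (x - t • e) ∂σ := by
          refine setLIntegral_mono' measurableSet_Ioc fun t ht => setLIntegral_mono' hSm fun x hx => ?_
          rw [indicator_of_mem (hsub x hx t ht)]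
      _ ≤ ∫⁻ t : ℝ, ∫⁻ x, R.indicator f (x - t • e) ∂σ := setLIntegral_le_lintegral _ _
      _ ≤ ∫⁻ t : ℝ, ∫⁻ x in graphOver e h, R.indicator f (x - t • e)
            ∂(Measure.euclideanHausdorffMeasure d) :=
          lintegral_mono fun t => lintegral_mono_set inter_subset_right
      _ ≤ C * ∫⁻ x, R.indicator f x ∂μ := hC _ (hf.indicator hRm)
      _ = _ := by rw [lintegral_indicator hRm]
  have hsE : ENNReal.ofReal s ≠ 0 := by simpa using hs0
  refine ⟨s, hs0, (ENNReal.ofReal s)⁻¹.toNNReal * 2 * C * (1 + s.toNNReal * s.toNNReal),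
    fun φ hφ c => ?_⟩
  set D : E → ℝ≥0∞ := fun x => ‖fderiv ℝ φ x‖ₑ ^ 2 with hD
  have hDm : Measurable D := (hφ.continuous_fderiv one_ne_zero).enorm.measurable.pow_const 2
  have hφm : Measurable φ := hφ.continuous.measurable
  have hcm : Measurable fun x => ‖φ x - c‖ₑ ^ 2 := (hφm.sub_const c).enorm.pow_const 2
  have hm2 : Measurable fun q : E × ℝ => D (q.1 - q.2 • e) :=
    hDm.comp (Continuous.measurable (by fun_prop))
  have hT : ∀ t ∈ Ioc (0 : ℝ) s, ∫⁻ x, ‖φ x - φ (x - t • e)‖ₑ ^ 2 ∂σ ≤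
      ENNReal.ofReal s * (C * ∫⁻ x in R, D x ∂μ) := by
    intro t ht
    calc _ ≤ ∫⁻ x, ENNReal.ofReal s * (∫⁻ t in Ioc (0 : ℝ) s, D (x - t • e)) ∂σ := by
          refine lintegral_mono fun x => ?_
          have := enorm_sub_sq_le_lintegral_ray hφ x (-e) ht.1.le
          have he1 : ‖e‖ₑ = 1 := by rw [← ofReal_norm, he, ENNReal.ofReal_one]
          rw [enorm_neg, he1, one_pow, one_mul] at this
          simp only [smul_neg, ← sub_eq_add_neg] at this
          rw [← enorm_neg, neg_sub]
          refine this.trans (mul_le_mul' (ENNReal.ofReal_le_ofReal ht.2) ?_)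
          exact lintegral_mono_set (Ioc_subset_Ioc_right ht.2)
      _ = ENNReal.ofReal s * ∫⁻ t in Ioc (0 : ℝ) s, ∫⁻ x, D (x - t • e) ∂σ := by
          rw [lintegral_const_mul _ hm2.lintegral_prod_right',
            lintegral_lintegral_swap hm2.aemeasurable]
      _ ≤ _ := mul_le_mul_right (hlayer D hDm) _
  have hpt : ∀ t ∈ Ioc (0 : ℝ) s, ∫⁻ x, ‖φ x - c‖ₑ ^ 2 ∂σ ≤
      2 * (ENNReal.ofReal s * (C * ∫⁻ x in R, D x ∂μ)) +
        2 * ∫⁻ x, ‖φ (x - t • e) - c‖ₑ ^ 2 ∂σ := by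
    intro t ht
    have hm3 : Measurable fun x => ‖φ x - φ (x - t • e)‖ₑ ^ 2 :=
      (hφm.sub (hφm.comp (measurable_sub_const _))).enorm.pow_const 2
    have hm4 : Measurable fun x => ‖φ (x - t • e) - c‖ₑ ^ 2 :=
      ((hφm.comp (measurable_sub_const _)).sub_const c).enorm.pow_const 2
    calc _ ≤ ∫⁻ x, (2 * ‖φ x - φ (x - t • e)‖ₑ ^ 2 + 2 * ‖φ (x - t • e) - c‖ₑ ^ 2) ∂σ :=
          lintegral_mono fun x => enorm_sub_sq_le _ _ _
      _ = 2 * ∫⁻ x, ‖φ x - φ (x - t • e)‖ₑ ^ 2 ∂σ +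
            2 * ∫⁻ x, ‖φ (x - t • e) - c‖ₑ ^ 2 ∂σ := by
          rw [lintegral_add_left (hm3.const_mul 2), lintegral_const_mul _ hm3,
            lintegral_const_mul _ hm4]
      _ ≤ _ := by gcongr; exact hT t ht
  -- The left side does not depend on t, so integration multiplies it by s; `hmain` divides this
  -- factor out.
  have hint := setLIntegral_mono' (μ := volume) measurableSet_Ioc hpt
  have hm5 : Measurable fun t : ℝ => ∫⁻ x, ‖φ (x - t • e) - c‖ₑ ^ 2 ∂σ := by
    have : Measurable fun q : ℝ × E => ‖φ (q.2 - q.1 • e) - c‖ₑ ^ 2 :=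
      hcm.comp (g := fun x => ‖φ x - c‖ₑ ^ 2) (Continuous.measurable (by fun_prop))
    exact this.lintegral_prod_right'
  rw [setLIntegral_const, lintegral_add_left measurable_const, setLIntegral_const,
    lintegral_const_mul _ hm5, Real.volume_Ioc, sub_zero] at hint
  have hint2 := hint.trans (add_le_add le_rfl (mul_le_mul_right (hlayer _ hcm) 2))
  have hmain : ∫⁻ x, ‖φ x - c‖ₑ ^ 2 ∂σ ≤ (ENNReal.ofReal s)⁻¹ *
      (2 * (ENNReal.ofReal s * (C * ∫⁻ x in R, D x ∂μ)) * ENNReal.ofReal s +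
        2 * (C * ∫⁻ x in R, ‖φ x - c‖ₑ ^ 2 ∂μ)) := by
    rw [← ENNReal.mul_le_iff_le_inv hsE ENNReal.ofReal_ne_top, mul_comm]
    exact hint2
  refine hmain.trans ?_
  push_cast
  rw [ENNReal.coe_toNNReal (ENNReal.inv_ne_top.2 hsE)]
  set X := ∫⁻ x in R, D x ∂μ
  set Y := ∫⁻ x in R, ‖φ x - c‖ₑ ^ 2 ∂μ
  calc _ = (ENNReal.ofReal s)⁻¹ * (2 * (C * (ENNReal.ofReal s * ENNReal.ofReal s * X + Y))) := by
        ring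
    _ ≤ (ENNReal.ofReal s)⁻¹ *
          (2 * (C * ((1 + ENNReal.ofReal s * ENNReal.ofReal s) * (Y + X)))) := by
        gcongr
        calc _ ≤ (ENNReal.ofReal s * ENNReal.ofReal s * X + Y) +
              (X + ENNReal.ofReal s * ENNReal.ofReal s * Y) := le_self_add
          _ = _ := by ring
    _ = _ := by rw [ENNReal.ofReal]; ring

end Graph

/-! ### The unit cube -/

section Cube

variable {N : ℕ}

theorem unitCube_subset_closedCube :
    unitCube N ⊆ {y | ∀ i, y i ∈ Icc (-(1 / 2) : ℝ) (1 / 2)} :=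
  fun _ hy i => Ico_subset_Icc_self (hy i)

theorem isCompact_closedCube (N : ℕ) :
    IsCompact {y : Space N | ∀ i, y i ∈ Icc (-(1 / 2) : ℝ) (1 / 2)} := by
  have h := (isCompact_univ_pi fun _ : Fin N => isCompact_Icc (a := (-(1 / 2) : ℝ)) (b := 1 / 2))
  have h2 := h.image (EuclideanSpace.equiv (Fin N) ℝ).symm.continuous
  convert h2 using 1
  ext y
  constructor
  · intro hy
    exact ⟨EuclideanSpace.equiv (Fin N) ℝ y, fun i _ => hy i, by simp⟩
  · rintro ⟨z, hz, rfl⟩ i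
    exact hz i (mem_univ i)

theorem isBounded_unitCube : Bornology.IsBounded (unitCube N) :=
  (isCompact_closedCube N).isBounded.subset unitCube_subset_closedCube

theorem convex_unitCube : Convex ℝ (unitCube N) := by
  intro x hx y hy a b ha hb hab i
  exact convex_Ico _ _ (hx i) (hy i) ha hb hab

theorem measurableSet_unitCube : MeasurableSet (unitCube N) := by
  have : unitCube N = ⋂ i, (fun y : Space N => y i) ⁻¹' Ico (-(1 / 2) : ℝ) (1 / 2) := by
    ext y; simp [unitCube]
  rw [this]
  refine MeasurableSet.iInter fun i => measurableSet_Ico.preimage ?_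
  exact Continuous.measurable (by fun_prop)

theorem isOpen_openCube : IsOpen (openCube N) := by
  have : openCube N = ⋂ i, (fun y : Space N => y i) ⁻¹' Ioo (-(1 / 2) : ℝ) (1 / 2) := by
    ext y; simp [openCube]
  rw [this]
  exact isOpen_iInter_of_finite fun i => isOpen_Ioo.preimage (by fun_prop)

theorem openCube_subset_unitCube : openCube N ⊆ unitCube N :=
  fun _ hy i => Ioo_subset_Ico_self (hy i)

theorem closedCube_subset_closure_openCube :
    {y : Space N | ∀ i, y i ∈ Icc (-(1 / 2) : ℝ) (1 / 2)} ⊆ closure (openCube N) := by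
  intro y hy
  have hlim : Tendsto (fun t : ℝ => (1 - t) • y) (𝓝[>] 0) (𝓝 y) := by
    have : Tendsto (fun t : ℝ => (1 - t) • y) (𝓝 0) (𝓝 ((1 - 0 : ℝ) • y)) :=
      Continuous.tendsto (by fun_prop) 0
    rw [sub_zero, one_smul] at this
    exact this.mono_left nhdsWithin_le_nhds
  refine mem_closure_of_tendsto hlim ?_
  filter_upwards [Ioo_mem_nhdsGT (zero_lt_one' ℝ)] with t ht i
  have h := hy i
  simp only [PiLp.smul_apply, smul_eq_mul]
  constructor <;> nlinarith [ht.1, ht.2, h.1, h.2]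

/-- Every point of the closed cube, including the faces absent from `unitCube`, is a limit of points
of the open cube. -/
theorem volume_inter_unitCube_ne_zero {U : Set (Space N)} (hU : IsOpen U) {y : Space N}
    (hyU : y ∈ U) (hy : ∀ i, y i ∈ Icc (-(1 / 2) : ℝ) (1 / 2)) :
    volume (U ∩ unitCube N) ≠ 0 := by
  obtain ⟨z, hz⟩ := mem_closure_iff.1 (closedCube_subset_closure_openCube hy) U hU hyU
  have h := (hU.inter isOpen_openCube).measure_pos volume ⟨z, hz⟩
  exact (h.trans_le (measure_mono (inter_subset_inter_right U openCube_subset_unitCube))).ne'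

end Cube

/-! ### Poincaré and trace inequalities on the perforated cell -/

section Hole

variable {N : ℕ} {G : Set (Space N)}

theorem cell_subset_unitCube : cell G ⊆ unitCube N := sdiff_subset

theorem IsHole.measurableSet_cell (hG : IsHole G) : MeasurableSet (cell G) :=
  measurableSet_unitCube.diff hG.isOpen.measurableSet

theorem volume_cell_lt_top : volume (cell G) < ⊤ :=
  (isBounded_unitCube.subset cell_subset_unitCube).measure_lt_top

instance : IsFiniteMeasure (cellMeasure G) :=
  ⟨by rw [cellMeasure, Measure.restrict_apply_univ]; exact volume_cell_lt_top⟩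

/-- In suitable coordinates near a boundary point, the perforated cell is a Lipschitz subgraph. -/
theorem IsHole.exists_chart (hG : IsHole G) {p : Space N} (hp : p ∈ frontier G) :
    ∃ (e : Space N) (h : Space N → ℝ) (K : ℝ≥0) (ρ : ℝ), ‖e‖ = 1 ∧ LipschitzWith K h ∧ 0 < ρ ∧
      (∀ x ∈ Metric.ball p ρ, x ∈ cell G ↔ inner ℝ x e ≤ h (x - inner ℝ x e • e)) ∧
      Metric.ball p ρ ∩ frontier G ⊆ graphOver e h := by
  obtain ⟨e, h, K, ρ, he, hh, hρ, hx⟩ := hG.lipschitz p hp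
  have hpc : p ∈ openCube N := hG.closure_subset (frontier_subset_closure hp)
  obtain ⟨ρ', hρ', hsub⟩ := Metric.isOpen_iff.1 isOpen_openCube p hpc
  refine ⟨e, h, K, min ρ ρ', he, hh, lt_min hρ hρ', fun x hxb => ?_, fun x hxb => ?_⟩
  · have h1 := hx x (Metric.ball_subset_ball (min_le_left _ _) hxb)
    have h2 := openCube_subset_unitCube (hsub (Metric.ball_subset_ball (min_le_right _ _) hxb))
    rw [← not_lt, ← h1]
    exact ⟨fun h => h.2, fun h => ⟨h2, h⟩⟩
  · have hb := Metric.ball_subset_ball (min_le_left _ _) hxb.1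
    have hxG : x ∉ G := fun hmem => by
      have := hxb.2
      rw [hG.isOpen.frontier_eq] at this
      exact this.2 hmem
    have hle : inner ℝ x e ≤ h (x - inner ℝ x e • e) := by
      rw [← not_lt, ← hx x hb]; exact hxG
    -- A boundary point strictly below the graph would have a neighbourhood without points of G.
    refine le_antisymm hle ?_
    by_contra hlt
    rw [not_le] at hlt
    have hc : Continuous fun y : Space N => h (y - inner ℝ y e • e) :=
      hh.continuous.comp (by fun_prop)
    have hopen : IsOpen {y : Space N | inner ℝ y e < h (y - inner ℝ y e • e)} :=
      isOpen_lt (by fun_prop) hc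
    obtain ⟨z, ⟨hz1, hz2⟩, hz3⟩ := mem_closure_iff.1 (frontier_subset_closure hxb.2) _
      (hopen.inter Metric.isOpen_ball) ⟨hlt, hb⟩
    exact absurd ((hx z hz2).1 hz3) (not_lt.2 (le_of_lt hz1))

theorem ball_inter_cell_of_disjoint {x : Space N} {r : ℝ}
    (h : Metric.ball x r ⊆ (closure G)ᶜ) : Metric.ball x r ∩ cell G = Metric.ball x r ∩ unitCube N := by
  ext y
  exact ⟨fun hy => ⟨hy.1, hy.2.1⟩, fun hy => ⟨hy.1, hy.2, fun hyG => h hy.1 (subset_closure hyG)⟩⟩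

theorem supportsPoincare_ball_inter_cell {x : Space N} {r : ℝ}
    (h : Metric.ball x r ⊆ (closure G)ᶜ) :
    SupportsPoincare volume (cell G) (Metric.ball x r ∩ cell G) := by
  refine supportsPoincare_of_convex ?_ ?_ ?_ inter_subset_right
  · rw [ball_inter_cell_of_disjoint h]; exact (convex_ball x r).inter convex_unitCube
  · rw [ball_inter_cell_of_disjoint h]; exact measurableSet_ball.inter measurableSet_unitCube
  · exact Metric.isBounded_ball.subset inter_subset_left

theorem exists_ball_subset_compl_closure {x : Space N} (hx : x ∉ closure G) :
    ∃ r > 0, Metric.ball x r ⊆ (closure G)ᶜ :=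
  Metric.isOpen_iff.1 isClosed_closure.isOpen_compl x hx

theorem volume_ball_inter_cell_ne_zero {x : Space N} (hx : x ∉ closure G)
    (hxc : ∀ i, x i ∈ Icc (-(1 / 2) : ℝ) (1 / 2)) {r : ℝ} (hr : 0 < r) :
    volume (Metric.ball x r ∩ cell G) ≠ 0 := by
  have h := volume_inter_unitCube_ne_zero (Metric.isOpen_ball.inter isClosed_closure.isOpen_compl)
    ⟨Metric.mem_ball_self hr, hx⟩ hxc
  refine fun h0 => h (measure_mono_null ?_ h0)
  exact fun y hy => ⟨hy.1.1, hy.2, fun hyG => hy.1.2 (subset_closure hyG)⟩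

/-- Both sets contain a small ball about y intersected with the cell, so the overlap needed for the
union has positive measure. -/
theorem SupportsPoincare.glue_at {A B : Set (Space N)} {y : Space N} {r s : ℝ}
    (hy : y ∈ unitCube N \ closure G) (hr : 0 < r) (hs : 0 < s)
    (hA : SupportsPoincare volume (cell G) A) (hB : SupportsPoincare volume (cell G) B)
    (hAy : Metric.ball y r ∩ cell G ⊆ A) (hBy : Metric.ball y s ∩ cell G ⊆ B)
    (hBc : B ⊆ cell G) : SupportsPoincare volume (cell G) (A ∪ B) := by
  refine hA.union hB ?_ ((measure_mono hBc).trans_lt volume_cell_lt_top).ne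
  have h := volume_ball_inter_cell_ne_zero hy.2 (unitCube_subset_closedCube hy.1) (lt_min hr hs)
  refine fun h0 => h (measure_mono_null (subset_inter ?_ ?_) h0)
  · exact (inter_subset_inter_left _ (Metric.ball_subset_ball (min_le_left _ _))).trans hAy
  · exact (inter_subset_inter_left _ (Metric.ball_subset_ball (min_le_right _ _))).trans hBy

/-- A chain of balls in disguise: the relation is local (one ball off the hole meets the cube in a
convex set), transitive by gluing at the middle point, and symmetric. Hence it relates any two
points of a connected set. -/
theorem IsHole.exists_supportsPoincare_pair (hG : IsHole G) {x y : Space N}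
    (hx : x ∈ unitCube N \ closure G) (hy : y ∈ unitCube N \ closure G) :
    ∃ r > 0, ∃ s > 0, SupportsPoincare volume (cell G)
      ((Metric.ball x r ∩ cell G) ∪ (Metric.ball y s ∩ cell G)) := by
  refine hG.connected.isPreconnected.induction₂ (fun x y => ∃ r > 0, ∃ s > 0,
    SupportsPoincare volume (cell G) ((Metric.ball x r ∩ cell G) ∪ (Metric.ball y s ∩ cell G)))
    (fun x hx => ?_) (fun x y z _ hy _ hxy hyz => ?_) (fun x y _ _ hxy => ?_) hx hy
  · obtain ⟨r, hr, hsub⟩ := exists_ball_subset_compl_closure hx.2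
    filter_upwards [nhdsWithin_le_nhds (Metric.ball_mem_nhds x hr)] with y hy
    obtain ⟨s, hs, hys⟩ := Metric.isOpen_iff.1 Metric.isOpen_ball y hy
    refine ⟨r, hr, s, hs, (supportsPoincare_ball_inter_cell hsub).mono ?_⟩
    exact union_subset Subset.rfl (inter_subset_inter_left _ hys)
  · obtain ⟨r₁, hr₁, s₁, hs₁, h₁⟩ := hxy
    obtain ⟨r₂, hr₂, s₂, hs₂, h₂⟩ := hyz
    refine ⟨r₁, hr₁, s₂, hs₂, (SupportsPoincare.glue_at hy hs₁ hr₂ h₁ h₂ subset_union_right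
      subset_union_left (union_subset inter_subset_right inter_subset_right)).mono ?_⟩
    exact union_subset_union subset_union_left subset_union_right
  · obtain ⟨r, hr, s, hs, h⟩ := hxy
    exact ⟨s, hs, r, hr, by rwa [union_comm]⟩

/-- **Poincaré inequality** on the perforated cell. -/
theorem IsHole.supportsPoincare_cell (hG : IsHole G) :
    SupportsPoincare volume (cell G) (cell G) := by
  obtain ⟨x₀, hx₀⟩ := hG.connected.nonempty
  have hempty : ∃ r > 0, SupportsPoincare volume (cell G)
      ((∅ ∩ cell G) ∪ (Metric.ball x₀ r ∩ cell G)) := by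
    obtain ⟨r, hr, s, hs, h⟩ := hG.exists_supportsPoincare_pair hx₀ hx₀
    exact ⟨r, hr, h.mono (by simp)⟩
  -- Compactness argument over the closed cube. Every piece carries a ball about the anchor x₀, so
  -- any two pieces overlap and can be glued.
  have key := (isCompact_closedCube N).induction_on
    (p := fun S => ∃ r > 0, SupportsPoincare volume (cell G)
      ((S ∩ cell G) ∪ (Metric.ball x₀ r ∩ cell G))) hempty ?_ ?_ ?_
  · obtain ⟨r, hr, h⟩ := key
    refine h.mono fun x hx => Or.inl ⟨unitCube_subset_closedCube hx.1, hx⟩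
  · rintro s t hst ⟨r, hr, h⟩
    exact ⟨r, hr, h.mono (union_subset_union_left _ (inter_subset_inter_left _ hst))⟩
  · rintro s t ⟨r₁, hr₁, h₁⟩ ⟨r₂, hr₂, h₂⟩
    refine ⟨r₁, hr₁, (SupportsPoincare.glue_at hx₀ hr₁ hr₂ h₁ h₂ subset_union_right
      subset_union_right (union_subset inter_subset_right inter_subset_right)).mono ?_⟩
    rw [union_inter_distrib_right]
    exact union_subset (union_subset_union subset_union_left subset_union_left)
      (subset_union_right.trans subset_union_left)
  · intro x hx
    by_cases hxG : x ∈ closure G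
    · by_cases hxG' : x ∈ G
      · refine ⟨G, nhdsWithin_le_nhds (hG.isOpen.mem_nhds hxG'), ?_⟩
        obtain ⟨r, hr, h⟩ := hempty
        refine ⟨r, hr, h.mono (union_subset_union_left _ fun y hy => ?_)⟩
        exact absurd hy.1 hy.2.2
      · have hxf : x ∈ frontier G := by rw [hG.isOpen.frontier_eq]; exact ⟨hxG, hxG'⟩
        obtain ⟨e, h, K, ρ, he, hh, hρ, hR, hgraph⟩ := hG.exists_chart hxf
        obtain ⟨r, z, hr, hz, hP⟩ := exists_supportsPoincare_of_subgraph (μ := volume) he hh hρ hR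
          (hgraph ⟨Metric.mem_ball_self hρ, hxf⟩) hG.measurableSet_cell
        refine ⟨Metric.ball x r, nhdsWithin_le_nhds (Metric.ball_mem_nhds x hr), ?_⟩
        -- The inner ball of the chart is open and avoids G, so its centre is off the closure of G
        -- and can be joined to x₀.
        have hzK : z ∈ unitCube N \ closure G := by
          refine ⟨(hz (Metric.mem_ball_self hr)).1, fun hzG => ?_⟩
          obtain ⟨w, hw, hwG⟩ := mem_closure_iff.1 hzG _ Metric.isOpen_ball (Metric.mem_ball_self hr)
          exact (hz hw).2 hwG
        obtain ⟨r₁, hr₁, s₁, hs₁, h₁⟩ := hG.exists_supportsPoincare_pair hzK hx₀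
        refine ⟨s₁, hs₁, (SupportsPoincare.glue_at hzK hr hr₁ hP h₁
          (inter_subset_left.trans subset_union_right) subset_union_left
          (union_subset inter_subset_right inter_subset_right)).mono ?_⟩
        exact union_subset_union subset_union_left subset_union_right
    · obtain ⟨r, hr, hsub⟩ := exists_ball_subset_compl_closure hxG
      refine ⟨Metric.ball x r, nhdsWithin_le_nhds (Metric.ball_mem_nhds x hr), ?_⟩
      -- Since x may lie on a face excluded from the half-open cube, a nearby point z of the cube is
      -- joined to x₀ instead.
      obtain ⟨z, hz⟩ := nonempty_of_measure_ne_zero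
        (volume_inter_unitCube_ne_zero Metric.isOpen_ball (Metric.mem_ball_self hr) hx)
      obtain ⟨s, hs, hzs⟩ := Metric.isOpen_iff.1 Metric.isOpen_ball z hz.1
      have hzK : z ∈ unitCube N \ closure G := ⟨hz.2, hsub hz.1⟩
      obtain ⟨r₁, hr₁, s₁, hs₁, h₁⟩ := hG.exists_supportsPoincare_pair hzK hx₀
      refine ⟨s₁, hs₁, (SupportsPoincare.glue_at hzK hs hr₁ (supportsPoincare_ball_inter_cell hsub)
        h₁ (inter_subset_inter_left _ hzs) subset_union_left
        (union_subset inter_subset_right inter_subset_right)).mono ?_⟩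
      exact union_subset_union Subset.rfl subset_union_right

theorem IsHole.isCompact_frontier (hG : IsHole G) : IsCompact (frontier G) :=
  (isCompact_closedCube N).of_isClosed_subset isClosed_frontier <|
    (frontier_subset_closure.trans hG.closure_subset).trans
      (openCube_subset_unitCube.trans unitCube_subset_closedCube)

theorem IsHole.isFiniteMeasure_surfaceMeasure (hG : IsHole G) (hN : 1 ≤ N) :
    IsFiniteMeasure (surfaceMeasure G) := by
  refine ⟨?_⟩
  rw [surfaceMeasure, Measure.restrict_apply_univ]
  refine hG.isCompact_frontier.measure_lt_top_of_nhdsWithin fun x hx => ?_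
  obtain ⟨e, h, K, ρ, he, hh, hρ, -, hgraph⟩ := hG.exists_chart hx
  refine ⟨Metric.ball x ρ ∩ frontier G, inter_mem (nhdsWithin_le_nhds (Metric.ball_mem_nhds x hρ))
    self_mem_nhdsWithin, ?_⟩
  refine (measure_mono (subset_inter inter_subset_left hgraph)).trans_lt ?_
  exact euclideanHausdorffMeasure_graphOver_bounded_lt_top he hh
    (by rw [finrank_euclideanSpace_fin]; omega) Metric.isBounded_ball

/-- **Trace inequality** on the boundary of the hole. -/
theorem IsHole.exists_trace_le (hG : IsHole G) (hN : 1 ≤ N) :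
    ∃ C : ℝ≥0, ∀ φ : Space N → ℝ, ContDiff ℝ 1 φ → ∀ c : ℝ,
      ∫⁻ x, ‖φ x - c‖ₑ ^ 2 ∂(surfaceMeasure G) ≤
        C * ((∫⁻ x in cell G, ‖φ x - c‖ₑ ^ 2) + ∫⁻ x in cell G, ‖fderiv ℝ φ x‖ₑ ^ 2) := by
  have key := hG.isCompact_frontier.induction_on
    (p := fun S => ∃ C : ℝ≥0, ∀ φ : Space N → ℝ, ContDiff ℝ 1 φ → ∀ c : ℝ,
      ∫⁻ x in S, ‖φ x - c‖ₑ ^ 2 ∂(Measure.euclideanHausdorffMeasure (N - 1)) ≤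
        C * ((∫⁻ x in cell G, ‖φ x - c‖ₑ ^ 2) + ∫⁻ x in cell G, ‖fderiv ℝ φ x‖ₑ ^ 2))
    ⟨0, fun φ _ c => by simp⟩ ?_ ?_ ?_
  · exact key
  · rintro s t hst ⟨C, hC⟩
    exact ⟨C, fun φ hφ c => (lintegral_mono_set hst).trans (hC φ hφ c)⟩
  · rintro s t ⟨C₁, h₁⟩ ⟨C₂, h₂⟩
    refine ⟨C₁ + C₂, fun φ hφ c => (lintegral_union_le _ _ _).trans ?_⟩
    rw [ENNReal.coe_add, add_mul]
    exact add_le_add (h₁ φ hφ c) (h₂ φ hφ c)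
  · intro x hx
    obtain ⟨e, h, K, ρ, he, hh, hρ, hR, hgraph⟩ := hG.exists_chart hx
    obtain ⟨r, hr, C, hC⟩ := exists_trace_le_of_subgraph (μ := volume) he hh (d := N - 1)
      (by rw [finrank_euclideanSpace_fin]; omega) hρ hR hG.measurableSet_cell
    refine ⟨Metric.ball x (min r ρ) ∩ frontier G,
      inter_mem (nhdsWithin_le_nhds (Metric.ball_mem_nhds x (lt_min hr hρ)))
      self_mem_nhdsWithin, C, fun φ hφ c => ?_⟩
    refine (lintegral_mono_set (subset_inter ?_ ?_)).trans (hC φ hφ c)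
    · exact inter_subset_left.trans (Metric.ball_subset_ball (min_le_left _ _))
    · exact (inter_subset_inter_left _ (Metric.ball_subset_ball (min_le_right _ _))).trans hgraph

theorem IsHole.volume_cell_ne_zero (hG : IsHole G) : volume (cell G) ≠ 0 := by
  obtain ⟨x, hx⟩ := hG.connected.nonempty
  exact fun h => volume_ball_inter_cell_ne_zero hx.2 (unitCube_subset_closedCube hx.1) one_pos
    (measure_mono_null inter_subset_right h)

end Hole

/-! ### Normalisation by zero mean -/

section MeanZero

variable {N : ℕ} {G : Set (Space N)}

theorem eLpNorm_two_sq {α F : Type*} [MeasurableSpace α] [NormedAddCommGroup F] (f : α → F)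
    (μ : Measure α) : eLpNorm f 2 μ ^ 2 = ∫⁻ x, ‖f x‖ₑ ^ 2 ∂μ := by
  have h := eLpNorm_nnreal_pow_eq_lintegral (μ := μ) (f := f) (p := 2) two_ne_zero
  simp only [NNReal.coe_ofNat, ENNReal.coe_ofNat] at h
  exact_mod_cast h

theorem enorm_gradient (φ : Space N → ℝ) (x : Space N) : ‖gradient φ x‖ₑ = ‖fderiv ℝ φ x‖ₑ := by
  rw [gradient, ← ofReal_norm, LinearIsometryEquiv.norm_map, ofReal_norm]

/-- The function φ - c integrates to -c μ(univ), so Cauchy–Schwarz bounds |c|² μ(univ) by the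
integral of |φ - c|². -/
theorem lintegral_sq_le_of_mean_zero {α : Type*} [MeasurableSpace α] {μ : Measure α}
    [IsFiniteMeasure μ] {φ : α → ℝ} (hφ : Integrable φ μ) (h0 : ∫ x, φ x ∂μ = 0) (c : ℝ) :
    ∫⁻ x, ‖φ x‖ₑ ^ 2 ∂μ ≤ 4 * ∫⁻ x, ‖φ x - c‖ₑ ^ 2 ∂μ := by
  rcases eq_or_ne μ 0 with rfl | hμ
  · simp
  have hμ0 : μ univ ≠ 0 := by simpa using hμ
  have hm : AEMeasurable (fun x => ‖φ x - c‖ₑ) μ :=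
    (hφ.aestronglyMeasurable.aemeasurable.sub_const c).enorm
  have h1 : ‖c‖ₑ * μ univ ≤ ∫⁻ x, ‖φ x - c‖ₑ ∂μ := by
    refine le_trans (le_of_eq ?_) (enorm_integral_le_lintegral_enorm _)
    rw [integral_sub hφ (integrable_const c), h0, zero_sub, enorm_neg, integral_const, smul_eq_mul,
      enorm_mul, mul_comm, measureReal_def]
    congr 1
    rw [Real.enorm_eq_ofReal ENNReal.toReal_nonneg, ENNReal.ofReal_toReal (measure_ne_top _ _)]
  have h2 : ‖c‖ₑ ^ 2 * μ univ ≤ ∫⁻ x, ‖φ x - c‖ₑ ^ 2 ∂μ := by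
    have h3 := (pow_le_pow_left₀ zero_le h1 2).trans (lintegral_sq_le μ hm)
    rw [mul_pow, sq (μ univ), ← mul_assoc, mul_comm (μ univ)] at h3
    exact (ENNReal.mul_le_mul_iff_left hμ0 (measure_ne_top _ _)).1 h3
  calc _ ≤ ∫⁻ x, (2 * ‖φ x - c‖ₑ ^ 2 + 2 * ‖c‖ₑ ^ 2) ∂μ := by
        refine lintegral_mono fun x => ?_
        simpa using enorm_sub_sq_le (φ x) c 0
    _ = 2 * ∫⁻ x, ‖φ x - c‖ₑ ^ 2 ∂μ + 2 * (‖c‖ₑ ^ 2 * μ univ) := by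
        rw [lintegral_add_right _ measurable_const, lintegral_const_mul'' _ (hm.pow_const 2),
          lintegral_const, mul_assoc]
    _ ≤ 2 * ∫⁻ x, ‖φ x - c‖ₑ ^ 2 ∂μ + 2 * ∫⁻ x, ‖φ x - c‖ₑ ^ 2 ∂μ := by gcongr
    _ = _ := by ring

theorem memLp_cellMeasure_of_continuous {F : Type*} [NormedAddCommGroup F]
    [SecondCountableTopology F] {f : Space N → F} (hf : Continuous f) (p : ℝ≥0∞) :
    MemLp f p (cellMeasure G) := by
  obtain ⟨C, hC⟩ := (isCompact_closedCube N).exists_bound_of_continuousOn hf.continuousOn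
  refine MemLp.of_bound hf.aestronglyMeasurable C ?_
  refine ae_restrict_of_ae_restrict_of_subset cell_subset_unitCube ?_
  filter_upwards [ae_restrict_mem measurableSet_unitCube] with x hx
  exact hC x (unitCube_subset_closedCube hx)

theorem IsHole.memLp_surfaceMeasure_of_continuous (hG : IsHole G) (hN : 1 ≤ N) {f : Space N → ℝ}
    (hf : Continuous f) (p : ℝ≥0∞) : MemLp f p (surfaceMeasure G) := by
  have := hG.isFiniteMeasure_surfaceMeasure hN
  obtain ⟨C, hC⟩ := hG.isCompact_frontier.exists_bound_of_continuousOn hf.continuousOn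
  refine MemLp.of_bound hf.aestronglyMeasurable C ?_
  rw [surfaceMeasure]
  filter_upwards [ae_restrict_mem isClosed_frontier.measurableSet] with x hx
  exact hC x hx

theorem continuous_gradient {φ : Space N → ℝ} (hφ : ContDiff ℝ 1 φ) : Continuous (gradient φ) :=
  (InnerProductSpace.toDual ℝ (Space N)).symm.continuous.comp (hφ.continuous_fderiv one_ne_zero)

/-- Poincaré and trace inequalities for functions with zero mean over the perforated cell. -/
theorem IsHole.exists_poincare_trace (hG : IsHole G) (hN : 1 ≤ N) :
    ∃ C : ℝ≥0, ∀ φ : Space N → ℝ, ContDiff ℝ 1 φ → ∫ y, φ y ∂(cellMeasure G) = 0 →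
      eLpNorm φ 2 (cellMeasure G) ≤ C * eLpNorm (gradient φ) 2 (cellMeasure G) ∧
      eLpNorm φ 2 (surfaceMeasure G) ≤ C * eLpNorm (gradient φ) 2 (cellMeasure G) := by
  obtain ⟨C₁, h₁⟩ := hG.supportsPoincare_cell
  obtain ⟨C₂, h₂⟩ := hG.exists_trace_le hN
  refine ⟨1 + 4 * C₁ + C₂ * (4 * C₁ + 1), fun φ hφ h0 => ?_⟩
  obtain ⟨c, hc⟩ := h₁ φ hφ
  set D := ∫⁻ x in cell G, ‖fderiv ℝ φ x‖ₑ ^ 2 with hD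
  have hgrad : eLpNorm (gradient φ) 2 (cellMeasure G) ^ 2 = D := by
    rw [eLpNorm_two_sq]
    exact lintegral_congr fun x => by rw [enorm_gradient]
  have hcell : ∫⁻ x in cell G, ‖φ x‖ₑ ^ 2 ≤ 4 * C₁ * D := by
    rw [mul_assoc]
    refine (lintegral_sq_le_of_mean_zero (μ := cellMeasure G) ?_ h0 c).trans ?_
    · exact (memLp_cellMeasure_of_continuous hφ.continuous 1).integrable le_rfl
    · exact mul_le_mul_right hc _
  have htrace : ∫⁻ x, ‖φ x‖ₑ ^ 2 ∂(surfaceMeasure G) ≤ C₂ * ((4 * C₁ + 1) * D) := by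
    have h := h₂ φ hφ 0
    simp only [sub_zero] at h
    refine h.trans (mul_le_mul_right ?_ _)
    rw [add_mul, one_mul]
    exact add_le_add hcell le_rfl
  -- A constant that is at least 1 is below its own square, so it serves for norms as well as for
  -- squared norms.
  have hone : (1 : ℝ≥0∞) ≤ ((1 + 4 * C₁ + C₂ * (4 * C₁ + 1) : ℝ≥0) : ℝ≥0∞) := by
    rw [add_assoc]; push_cast; exact le_self_add
  have hfin : ∀ X : ℝ≥0∞, X ^ 2 ≤ ((1 + 4 * C₁ + C₂ * (4 * C₁ + 1) : ℝ≥0) : ℝ≥0∞) * D →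
      X ≤ ((1 + 4 * C₁ + C₂ * (4 * C₁ + 1) : ℝ≥0) : ℝ≥0∞) *
        eLpNorm (gradient φ) 2 (cellMeasure G) := by
    intro X hX
    refine (ENNReal.pow_right_strictMono two_ne_zero).le_iff_le.1 ?_
    simp only [mul_pow, hgrad]
    refine hX.trans (mul_le_mul_left ?_ _)
    exact le_self_pow₀ hone two_ne_zero
  constructor
  · refine hfin _ ?_
    rw [eLpNorm_two_sq]
    refine hcell.trans (mul_le_mul_left ?_ _)
    push_cast
    rw [add_comm 1, add_assoc]
    exact le_self_add
  · refine hfin _ ?_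
    rw [eLpNorm_two_sq]
    refine htrace.trans ?_
    rw [← mul_assoc]
    refine mul_le_mul_left ?_ _
    push_cast
    exact le_add_self

end MeanZero

/-! ### Integration by parts on the torus and weak gradients -/

section Torus

variable {N : ℕ} {G : Set (Space N)}

theorem IsYPeriodic.mul {φ ψ : Space N → ℝ} (hφ : IsYPeriodic φ) (hψ : IsYPeriodic ψ) :
    IsYPeriodic fun y => φ y * ψ y := fun i y => by simp only [hφ i y, hψ i y]

/-- Divergence theorem for the field whose only component is χ in direction i: opposite faces cancel
by periodicity. -/
theorem setIntegral_unitCube_fderiv_single {χ : Space N → ℝ} (hχ : ContDiff ℝ 1 χ)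
    (hper : IsYPeriodic χ) (i : Fin N) :
    ∫ y in unitCube N, fderiv ℝ χ y (EuclideanSpace.single i 1) = 0 := by
  obtain _ | n := N
  · exact i.elim0
  let L := (EuclideanSpace.equiv (Fin (n + 1)) ℝ).symm
  let f : (Fin (n + 1) → ℝ) → Fin (n + 1) → ℝ := fun x => Pi.single i (χ (L x))
  let f' : (Fin (n + 1) → ℝ) → (Fin (n + 1) → ℝ) →L[ℝ] Fin (n + 1) → ℝ := fun x =>
    (ContinuousLinearMap.single ℝ (fun _ : Fin (n + 1) => ℝ) i) ∘L
      (fderiv ℝ χ (L x) ∘L (L : (Fin (n + 1) → ℝ) →L[ℝ] Space (n + 1)))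
  have hf' : ∀ x, HasFDerivAt f (f' x) x := fun x =>
    (ContinuousLinearMap.single ℝ (fun _ : Fin (n + 1) => ℝ) i).hasFDerivAt.comp x
      ((hχ.differentiable one_ne_zero (L x)).hasFDerivAt.comp x L.hasFDerivAt)
  have hsum : ∀ x, ∑ j, f' x (Pi.single j 1) j = fderiv ℝ χ (L x) (EuclideanSpace.single i 1) := by
    intro x
    rw [Finset.sum_eq_single i]
    · simp [f', L]
    · intro j _ hj
      simp [f', hj]
    · simp
  have hcont : Continuous fun x => fderiv ℝ χ (L x) (EuclideanSpace.single i 1) :=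
    ((hχ.continuous_fderiv one_ne_zero).comp L.continuous).clm_apply continuous_const
  have hdiv := integral_divergence_of_hasFDerivAt_off_countable
    (fun _ : Fin (n + 1) => (-(1 / 2) : ℝ)) (fun _ => 1 / 2) (fun _ => by norm_num) f f' ∅
    countable_empty (fun x _ => (hf' x).continuousAt.continuousWithinAt) (fun x _ => hf' x)
    (by simp only [hsum]; exact hcont.continuousOn.integrableOn_compact isCompact_Icc)
  have hzero : ∀ j : Fin (n + 1), ∀ x : Fin n → ℝ,
      f (j.insertNth (1 / 2 : ℝ) x) j = f (j.insertNth (-(1 / 2) : ℝ) x) j := by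
    intro j x
    by_cases hj : j = i
    · subst hj
      simp only [f, Pi.single_eq_same]
      rw [← hper j (L (j.insertNth (-(1 / 2) : ℝ) x))]
      congr 1
      ext k
      by_cases hk : k = j
      · subst hk
        simp [L]
        norm_num
      · obtain ⟨l, rfl⟩ := Fin.exists_succAbove_eq hk
        simp [L]
    · simp [f, hj]
  simp only [hzero, sub_self, Finset.sum_const_zero, hsum] at hdiv
  have hmp := EuclideanSpace.volume_preserving_symm_measurableEquiv_toLp (Fin (n + 1))
  have h1 := hmp.setIntegral_preimage_emb (MeasurableEquiv.measurableEmbedding _)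
    (fun x => fderiv ℝ χ (L x) (EuclideanSpace.single i 1))
    (univ.pi fun _ => Ico (-(1 / 2) : ℝ) (1 / 2))
  have h2 : (univ.pi fun _ : Fin (n + 1) => Ico (-(1 / 2) : ℝ) (1 / 2)) =ᵐ[volume]
      Icc (fun _ => (-(1 / 2) : ℝ)) (fun _ => 1 / 2) := Measure.univ_pi_Ico_ae_eq_Icc
  rw [setIntegral_congr_set h2, hdiv] at h1
  have h3 : unitCube (n + 1) = (MeasurableEquiv.toLp 2 (Fin (n + 1) → ℝ)).symm ⁻¹'
      (univ.pi fun _ => Ico (-(1 / 2) : ℝ) (1 / 2)) := by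
    ext y
    simp [unitCube]
  rw [h3]
  exact h1

theorem setIntegral_unitCube_gradient {χ : Space N → ℝ} (hχ : ContDiff ℝ 1 χ)
    (hper : IsYPeriodic χ) : ∫ y in unitCube N, gradient χ y = 0 := by
  have hint : Integrable (gradient χ) (volume.restrict (unitCube N)) := by
    have h := ((continuous_gradient hχ).continuousOn.integrableOn_compact (isCompact_closedCube N)
      (μ := volume))
    exact h.mono_set unitCube_subset_closedCube
  ext i
  have h := (EuclideanSpace.proj (𝕜 := ℝ) i : Space N →L[ℝ] ℝ).integral_comp_comm hint
  change ∫ y in unitCube N, gradient χ y i = (∫ y in unitCube N, gradient χ y) i at h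
  rw [← h, PiLp.zero_apply, ← setIntegral_unitCube_fderiv_single hχ hper i]
  refine integral_congr_ae (ae_of_all _ fun y => ?_)
  beta_reduce
  have h2 : inner ℝ (gradient χ y) (EuclideanSpace.single i (1 : ℝ)) =
      fderiv ℝ χ y (EuclideanSpace.single i 1) := by
    rw [gradient, InnerProductSpace.toDual_symm_apply]
  rw [← h2, EuclideanSpace.inner_single_right]
  simp

theorem gradient_mul {φ ψ : Space N → ℝ} {y : Space N} (hφ : DifferentiableAt ℝ φ y)
    (hψ : DifferentiableAt ℝ ψ y) :
    gradient (fun y => φ y * ψ y) y = φ y • gradient ψ y + ψ y • gradient φ y := by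
  simp only [gradient]
  rw [fderiv_fun_mul hφ hψ, map_add, map_smulₛₗ, map_smulₛₗ]
  rfl

/-- The gradient of the periodic product φψ has zero integral over the cube. It vanishes on G,
because ψ vanishes near the closure of G, so only Y* contributes. -/
theorem isPeriodicWeakGradient_gradient {φ : Space N → ℝ}
    (hφ : ContDiff ℝ ∞ φ) (hper : IsYPeriodic φ) : IsPeriodicWeakGradient G φ (gradient φ) := by
  intro ψ hψ hψper hdisj
  have hφ1 : ContDiff ℝ 1 φ := hφ.of_le (by exact_mod_cast le_top)
  have hψ1 : ContDiff ℝ 1 ψ := hψ.of_le (by exact_mod_cast le_top)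
  have hdφ : Differentiable ℝ φ := hφ1.differentiable one_ne_zero
  have hdψ : Differentiable ℝ ψ := hψ1.differentiable one_ne_zero
  have h1 := setIntegral_unitCube_gradient (hφ1.mul hψ1) (hper.mul hψper)
  have hzero : ∀ y ∈ unitCube N \ cell G, gradient (fun y => φ y * ψ y) y = 0 := by
    intro y hy
    have hyG : y ∈ G := by
      by_contra h
      exact hy.2 ⟨hy.1, h⟩
    have hyt : y ∉ tsupport ψ := fun h => disjoint_left.1 hdisj h (subset_closure hyG)
    have hψy : ψ y = 0 := image_eq_zero_of_notMem_tsupport hyt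
    have hψ' : gradient ψ y = 0 := by
      have hev : ψ =ᶠ[𝓝 y] fun _ => 0 := by
        exact notMem_tsupport_iff_eventuallyEq.1 hyt
      rw [gradient, hev.fderiv_eq]
      simp
    rw [gradient_mul (hdφ y) (hdψ y), hψy, hψ']
    simp
  have h2 : ∫ y in cell G, gradient (fun y => φ y * ψ y) y = 0 := by
    rw [← h1]
    exact (setIntegral_eq_of_subset_of_forall_sdiff_eq_zero measurableSet_unitCube
      cell_subset_unitCube hzero).symm
  have hi1 : Integrable (fun y => φ y • gradient ψ y) (cellMeasure G) :=
    (memLp_cellMeasure_of_continuous (hφ1.continuous.smul (continuous_gradient hψ1)) 1).integrable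
      le_rfl
  have hi2 : Integrable (fun y => ψ y • gradient φ y) (cellMeasure G) :=
    (memLp_cellMeasure_of_continuous (hψ1.continuous.smul (continuous_gradient hφ1)) 1).integrable
      le_rfl
  rw [eq_neg_iff_add_eq_zero, ← integral_add hi1 hi2, cellMeasure, ← h2]
  exact integral_congr_ae (ae_of_all _ fun y => (gradient_mul (hdφ y) (hdψ y)).symm)

theorem isPeriodicWeakGradient_of_tendsto {φ : ℕ → Space N → ℝ} {F : ℕ → Space N → Space N}
    {w : Space N → ℝ} {W : Space N → Space N} (hφ : ∀ n, MemLp (φ n) 2 (cellMeasure G))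
    (hF : ∀ n, MemLp (F n) 2 (cellMeasure G)) (hw : MemLp w 2 (cellMeasure G))
    (hW : MemLp W 2 (cellMeasure G)) (hwg : ∀ n, IsPeriodicWeakGradient G (φ n) (F n))
    (h1 : Tendsto (fun n => eLpNorm (fun y => φ n y - w y) 2 (cellMeasure G)) atTop (𝓝 0))
    (h2 : Tendsto (fun n => eLpNorm (fun y => F n y - W y) 2 (cellMeasure G)) atTop (𝓝 0)) :
    IsPeriodicWeakGradient G w W := by
  intro ψ hψ hψper hdisj
  have hψ1 : ContDiff ℝ 1 ψ := hψ.of_le (by exact_mod_cast le_top)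
  have hψL : MemLp ψ 2 (cellMeasure G) := memLp_cellMeasure_of_continuous hψ1.continuous 2
  have hψG : MemLp (gradient ψ) 2 (cellMeasure G) :=
    memLp_cellMeasure_of_continuous (continuous_gradient hψ1) 2
  have hlim : ∀ {C : ℝ≥0∞} {f : ℕ → ℝ≥0∞}, C ≠ ⊤ → Tendsto f atTop (𝓝 0) →
      Tendsto (fun n => f n * C) atTop (𝓝 0) := by
    intro C f hC hf
    simpa using ENNReal.Tendsto.mul_const hf (Or.inr hC)
  have hl : Tendsto (fun n => ∫ y, φ n y • gradient ψ y ∂(cellMeasure G)) atTop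
      (𝓝 (∫ y, w y • gradient ψ y ∂(cellMeasure G))) := by
    refine tendsto_integral_of_L1' _ (hψG.smul (p := 2) (q := 2) (r := 1) hw).1
      (Eventually.of_forall fun n => memLp_one_iff_integrable.1
        (hψG.smul (p := 2) (q := 2) (r := 1) (hφ n))) ?_
    refine tendsto_of_tendsto_of_tendsto_of_le_of_le tendsto_const_nhds (hlim hψG.2.ne h1)
      (fun _ => zero_le) fun n => ?_
    refine le_trans (le_of_eq ?_) (eLpNorm_smul_le_mul_eLpNorm (p := 2) (q := 2) (r := 1) hψG.1
      ((hφ n).sub hw).1)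
    congr 1
    ext1 y
    simp [sub_smul]
  have hr : Tendsto (fun n => ∫ y, ψ y • F n y ∂(cellMeasure G)) atTop
      (𝓝 (∫ y, ψ y • W y ∂(cellMeasure G))) := by
    refine tendsto_integral_of_L1' _ (hW.smul (p := 2) (q := 2) (r := 1) hψL).1
      (Eventually.of_forall fun n => memLp_one_iff_integrable.1
        ((hF n).smul (p := 2) (q := 2) (r := 1) hψL)) ?_
    refine tendsto_of_tendsto_of_tendsto_of_le_of_le tendsto_const_nhds (hlim hψL.2.ne h2)
      (fun _ => zero_le) fun n => ?_
    rw [mul_comm]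
    refine le_trans (le_of_eq ?_) (eLpNorm_smul_le_mul_eLpNorm (p := 2) (q := 2) (r := 1)
      ((hF n).sub hW).1 hψL.1)
    congr 1
    ext1 y
    simp [smul_sub]
  refine tendsto_nhds_unique hl ?_
  simp only [fun n => hwg n ψ hψ hψper hdisj]
  exact hr.neg

end Torus

/-! ### Estimates in L² -/

section Aux

variable {α F : Type*} [MeasurableSpace α] {μ : Measure α} [NormedAddCommGroup F]

theorem tendsto_eLpNorm_linearComb [NormedSpace ℝ F] {f f' : ℕ → α → F} {g g' : α → F} (a b : ℝ)
    (hf : ∀ n, AEStronglyMeasurable (f n) μ) (hf' : ∀ n, AEStronglyMeasurable (f' n) μ)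
    (hg : AEStronglyMeasurable g μ) (hg' : AEStronglyMeasurable g' μ)
    (h : Tendsto (fun n => eLpNorm (fun y => f n y - g y) 2 μ) atTop (𝓝 0))
    (h' : Tendsto (fun n => eLpNorm (fun y => f' n y - g' y) 2 μ) atTop (𝓝 0)) :
    Tendsto (fun n => eLpNorm (fun y => (a • f n y + b • f' n y) - (a • g y + b • g' y)) 2 μ)
      atTop (𝓝 0) := by
  have hlim : Tendsto (fun n => ‖a‖ₑ * eLpNorm (fun y => f n y - g y) 2 μ +
      ‖b‖ₑ * eLpNorm (fun y => f' n y - g' y) 2 μ) atTop (𝓝 0) := by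
    have h1 := ENNReal.Tendsto.const_mul h (Or.inr (enorm_ne_top (x := a)))
    have h2 := ENNReal.Tendsto.const_mul h' (Or.inr (enorm_ne_top (x := b)))
    simpa using h1.add h2
  refine tendsto_of_tendsto_of_tendsto_of_le_of_le tendsto_const_nhds hlim (fun _ => zero_le)
    fun n => ?_
  have e : (fun y => (a • f n y + b • f' n y) - (a • g y + b • g' y)) =
      a • (fun y => f n y - g y) + b • (fun y => f' n y - g' y) := by
    ext1 y
    simp only [Pi.add_apply, Pi.smul_apply]
    module
  rw [e]
  refine (eLpNorm_add_le (((hf n).sub hg).const_smul a) (((hf' n).sub hg').const_smul b)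
    one_le_two).trans (le_of_eq ?_)
  rw [eLpNorm_const_smul, eLpNorm_const_smul]
  rfl

theorem abs_integral_inner_le [InnerProductSpace ℝ F] {f g : α → F} (hf : MemLp f 2 μ)
    (hg : MemLp g 2 μ) :
    |∫ x, inner ℝ (f x) (g x) ∂μ| ≤ (eLpNorm f 2 μ).toReal * (eLpNorm g 2 μ).toReal := by
  have h := abs_real_inner_le_norm (hf.toLp f) (hg.toLp g)
  rw [L2.inner_def, Lp.norm_toLp, Lp.norm_toLp] at h
  refine le_trans (le_of_eq ?_) h
  congr 1
  refine integral_congr_ae ?_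
  filter_upwards [hf.coeFn_toLp, hg.coeFn_toLp] with x h1 h2
  rw [h1, h2]

theorem abs_integral_mul_le {f g : α → ℝ} (hf : MemLp f 2 μ) (hg : MemLp g 2 μ) :
    |∫ x, f x * g x ∂μ| ≤ (eLpNorm f 2 μ).toReal * (eLpNorm g 2 μ).toReal := by
  refine le_trans (le_of_eq ?_) (abs_integral_inner_le hf hg)
  congr 1
  exact integral_congr_ae (ae_of_all _ fun x => by simp [mul_comm])

theorem cauchySeq_of_dist_le_mul {X Z : Type*} [PseudoMetricSpace X] [PseudoMetricSpace Z]
    {u : ℕ → X} {v : ℕ → Z} (hv : CauchySeq v) (C : ℝ≥0)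
    (h : ∀ n k, dist (u n) (u k) ≤ C * dist (v n) (v k)) : CauchySeq u := by
  rw [Metric.cauchySeq_iff] at hv ⊢
  intro ε hε
  obtain ⟨n₀, hn₀⟩ := hv (ε / (C + 1)) (by positivity)
  refine ⟨n₀, fun n hn k hk => (h n k).trans_lt ?_⟩
  have h1 := hn₀ n hn k hk
  rw [lt_div_iff₀ (by positivity)] at h1
  nlinarith [dist_nonneg (x := v n) (y := v k)]

theorem eLpNorm_two_const [IsFiniteMeasure μ] (c : F) :
    eLpNorm (fun _ : α => c) 2 μ = ‖c‖ₑ * μ univ ^ (1 / 2 : ℝ) := by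
  rcases eq_or_ne μ 0 with rfl | h
  · simp
  · simpa using eLpNorm_const (μ := μ) c two_ne_zero h

end Aux

/-! ### The periodic Sobolev space -/

section Sobolev

variable {N : ℕ} {G : Set (Space N)}

theorem contDiff_one_of_infty {φ : Space N → ℝ} (hφ : ContDiff ℝ ∞ φ) : ContDiff ℝ 1 φ :=
  hφ.of_le (by exact_mod_cast le_top)

theorem IsYPeriodic.linearComb {φ ψ : Space N → ℝ} (hφ : IsYPeriodic φ) (hψ : IsYPeriodic ψ)
    (a b : ℝ) : IsYPeriodic fun y => a • φ y + b • ψ y :=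
  fun i y => by simp only [hφ i y, hψ i y]

theorem gradient_linearComb {φ ψ : Space N → ℝ} {y : Space N} (hφ : DifferentiableAt ℝ φ y)
    (hψ : DifferentiableAt ℝ ψ y) (a b : ℝ) :
    gradient (fun y => a • φ y + b • ψ y) y = a • gradient φ y + b • gradient ψ y := by
  have h : fderiv ℝ (fun y => a • φ y + b • ψ y) y = a • fderiv ℝ φ y + b • fderiv ℝ ψ y :=
    ((hφ.hasFDerivAt.const_smul a).add (hψ.hasFDerivAt.const_smul b)).fderiv
  simp only [gradient]
  rw [h, map_add, map_smulₛₗ, map_smulₛₗ]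
  rfl

theorem gradient_sub_const (φ : Space N → ℝ) (c : ℝ) (y : Space N) :
    gradient (fun y => φ y - c) y = gradient φ y := by
  simp only [gradient]
  rw [fderiv_sub_const]

/-- The approximating functions satisfy the weak-gradient identity, which survives L² limits. To
build an element of `PerSobolev` it therefore suffices, apart from integrability, to approximate. -/
theorem IsTrace.isPeriodicWeakGradient {w t : Space N → ℝ} {F : Space N → Space N}
    (h : IsTrace G w F t) (hw : MemLp w 2 (cellMeasure G)) (hF : MemLp F 2 (cellMeasure G)) :
    IsPeriodicWeakGradient G w F := by
  obtain ⟨φ, hφ, hper, h1, h2, -⟩ := h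
  exact isPeriodicWeakGradient_of_tendsto
    (fun n => memLp_cellMeasure_of_continuous (hφ n).continuous 2)
    (fun n => memLp_cellMeasure_of_continuous (continuous_gradient (contDiff_one_of_infty (hφ n))) 2)
    hw hF (fun n => isPeriodicWeakGradient_gradient (hφ n) (hper n)) h1 h2

/-- Linear combinations in `W^{1,2}_per(Y*)`. -/
def PerSobolev.linearComb (a b : ℝ) (w w' : PerSobolev G) : PerSobolev G :=
  have h1 : MemLp (fun y => a • w.val y + b • w'.val y) 2 (cellMeasure G) :=
    (w.memLp_val.const_smul a).add (w'.memLp_val.const_smul b)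
  have h2 : MemLp (fun y => a • w.grad y + b • w'.grad y) 2 (cellMeasure G) :=
    (w.memLp_grad.const_smul a).add (w'.memLp_grad.const_smul b)
  have h3 : IsTrace G (fun y => a • w.val y + b • w'.val y)
      (fun y => a • w.grad y + b • w'.grad y) (fun y => a • w.trace y + b • w'.trace y) := by
    obtain ⟨φ, hφ, hφp, hφ1, hφ2, hφ3⟩ := w.isTrace
    obtain ⟨ψ, hψ, hψp, hψ1, hψ2, hψ3⟩ := w'.isTrace
    refine ⟨fun n y => a • φ n y + b • ψ n y,
      fun n => ((hφ n).const_smul a).add ((hψ n).const_smul b),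
      fun n => (hφp n).linearComb (hψp n) a b, ?_, ?_, ?_⟩
    · exact tendsto_eLpNorm_linearComb a b (fun n => (hφ n).continuous.aestronglyMeasurable)
        (fun n => (hψ n).continuous.aestronglyMeasurable) w.memLp_val.1 w'.memLp_val.1 hφ1 hψ1
    · have h := tendsto_eLpNorm_linearComb a b
        (fun n => (continuous_gradient (contDiff_one_of_infty (hφ n))).aestronglyMeasurable)
        (fun n => (continuous_gradient (contDiff_one_of_infty (hψ n))).aestronglyMeasurable)
        w.memLp_grad.1 w'.memLp_grad.1 hφ2 hψ2
      refine h.congr fun n => ?_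
      congr 1
      ext1 y
      rw [gradient_linearComb ((contDiff_one_of_infty (hφ n)).differentiable one_ne_zero y)
        ((contDiff_one_of_infty (hψ n)).differentiable one_ne_zero y)]
    · exact tendsto_eLpNorm_linearComb a b (fun n => (hφ n).continuous.aestronglyMeasurable)
        (fun n => (hψ n).continuous.aestronglyMeasurable) w.memLp_trace.1 w'.memLp_trace.1 hφ3 hψ3
  { val := fun y => a • w.val y + b • w'.val y
    grad := fun y => a • w.grad y + b • w'.grad y
    trace := fun y => a • w.trace y + b • w'.trace y
    memLp_val := h1
    memLp_grad := h2
    memLp_trace := (w.memLp_trace.const_smul a).add (w'.memLp_trace.const_smul b)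
    isWeakGradient := h3.isPeriodicWeakGradient h1 h2
    isTrace := h3 }

/-- Poincaré and trace inequalities in `W^{1,2}_per(Y*)`. -/
theorem IsHole.exists_poincare_trace_perSobolev (hG : IsHole G) (hN : 1 ≤ N) :
    ∃ C : ℝ≥0, ∀ w : PerSobolev G, ∃ c : ℝ,
      eLpNorm (fun y => w.val y - c) 2 (cellMeasure G) ≤ C * eLpNorm w.grad 2 (cellMeasure G) ∧
      eLpNorm (fun y => w.trace y - c) 2 (surfaceMeasure G) ≤
        C * eLpNorm w.grad 2 (cellMeasure G) := by
  have := hG.isFiniteMeasure_surfaceMeasure hN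
  obtain ⟨C, hC⟩ := hG.exists_poincare_trace hN
  refine ⟨C, fun w => ?_⟩
  obtain ⟨φ, hφ, hper, h1, h2, h3⟩ := w.isTrace
  set m := cellMeasure G
  have hm0 : m.real univ ≠ 0 := by
    have h : m univ ≠ 0 := by
      simp only [m, cellMeasure, Measure.restrict_apply_univ]; exact hG.volume_cell_ne_zero
    exact ENNReal.toReal_ne_zero.2 ⟨h, measure_ne_top _ _⟩
  set c : ℝ := (m.real univ)⁻¹ * ∫ y, w.val y ∂m
  let d : ℕ → ℝ := fun n => (m.real univ)⁻¹ * ∫ y, φ n y ∂m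
  have hφL : ∀ n, MemLp (φ n) 2 m := fun n =>
    memLp_cellMeasure_of_continuous (hφ n).continuous 2
  have hφi : ∀ n, Integrable (φ n) m := fun n => (hφL n).integrable one_le_two
  have hφg : ∀ n, MemLp (gradient (φ n)) 2 m := fun n =>
    memLp_cellMeasure_of_continuous (continuous_gradient (contDiff_one_of_infty (hφ n))) 2
  have hd : Tendsto d atTop (𝓝 c) := by
    refine Tendsto.const_mul _ ?_
    refine tendsto_integral_of_L1' _ w.memLp_val.1 (Eventually.of_forall hφi) ?_
    have hlim : Tendsto (fun n => eLpNorm (fun y => φ n y - w.val y) 2 m *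
        m univ ^ (1 / (1 : ℝ≥0∞).toReal - 1 / (2 : ℝ≥0∞).toReal)) atTop (𝓝 0) := by
      have := ENNReal.Tendsto.mul_const h1 (b := m univ ^ (1 / (1 : ℝ≥0∞).toReal -
        1 / (2 : ℝ≥0∞).toReal)) (Or.inr (ENNReal.rpow_ne_top_of_nonneg (by norm_num)
          (measure_ne_top _ _)))
      simpa using this
    exact tendsto_of_tendsto_of_tendsto_of_le_of_le tendsto_const_nhds hlim (fun _ => zero_le)
      fun n => eLpNorm_le_eLpNorm_mul_rpow_measure_univ one_le_two ((hφL n).sub w.memLp_val).1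
  have hde : Tendsto (fun n => ‖d n - c‖ₑ) atTop (𝓝 0) := by
    have := (hd.sub_const c).enorm
    simpa using this
  have hest : ∀ n, eLpNorm (fun y => φ n y - d n) 2 m ≤ C * eLpNorm (gradient (φ n)) 2 m ∧
      eLpNorm (fun y => φ n y - d n) 2 (surfaceMeasure G) ≤ C * eLpNorm (gradient (φ n)) 2 m := by
    intro n
    have h := hC (fun y => φ n y - d n) ((contDiff_one_of_infty (hφ n)).sub contDiff_const) (by
      rw [integral_sub (hφi n) (integrable_const _), integral_const, smul_eq_mul]
      simp only [d]
      field_simp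
      ring)
    simpa only [funext (gradient_sub_const (φ n) (d n))] using h
  have hgrad : ∀ n, eLpNorm (gradient (φ n)) 2 m ≤
      eLpNorm (fun y => gradient (φ n) y - w.grad y) 2 m + eLpNorm w.grad 2 m := by
    intro n
    refine le_trans (le_of_eq ?_) (eLpNorm_add_le ((hφg n).sub w.memLp_grad).1 w.memLp_grad.1
      one_le_two)
    congr 1
    ext1 y
    simp
  -- One limit argument for both measures, with the same c: the means d n over Y* converge to the
  -- mean c of w.
  have key : ∀ (μ : Measure (Space N)) [IsFiniteMeasure μ] (t : Space N → ℝ),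
      AEStronglyMeasurable t μ →
      Tendsto (fun n => eLpNorm (fun y => φ n y - t y) 2 μ) atTop (𝓝 0) →
      (∀ n, eLpNorm (fun y => φ n y - d n) 2 μ ≤ C * eLpNorm (gradient (φ n)) 2 m) →
      eLpNorm (fun y => t y - c) 2 μ ≤ C * eLpNorm w.grad 2 m := by
    intro μ _ t ht htend hb
    have hfin : μ univ ^ (1 / 2 : ℝ) ≠ ⊤ :=
      ENNReal.rpow_ne_top_of_nonneg (by norm_num) (measure_ne_top _ _)
    have hlim : Tendsto (fun n => eLpNorm (fun y => φ n y - t y) 2 μ +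
        ‖d n - c‖ₑ * μ univ ^ (1 / 2 : ℝ) +
        C * (eLpNorm (fun y => gradient (φ n) y - w.grad y) 2 m + eLpNorm w.grad 2 m))
        atTop (𝓝 (C * eLpNorm w.grad 2 m)) := by
      have e1 := ENNReal.Tendsto.mul_const hde (Or.inr hfin)
      have e2 := ENNReal.Tendsto.const_mul (h2.add (tendsto_const_nhds (x := eLpNorm w.grad 2 m)))
        (Or.inr (ENNReal.coe_ne_top (r := C)))
      simpa using (htend.add e1).add e2
    refine ge_of_tendsto' hlim fun n => ?_
    have e : (fun y => t y - c) = (fun y => -(φ n y - t y)) + ((fun _ => d n - c) +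
        (fun y => φ n y - d n)) := by
      ext1 y
      simp only [Pi.add_apply]
      ring
    have hφμ : AEStronglyMeasurable (φ n) μ := (hφ n).continuous.aestronglyMeasurable
    rw [e, add_assoc]
    refine (eLpNorm_add_le (hφμ.sub ht).neg (aestronglyMeasurable_const.add
      (hφμ.sub aestronglyMeasurable_const)) one_le_two).trans ?_
    refine add_le_add (le_of_eq (eLpNorm_neg (φ n - t) 2 μ)) ?_
    refine (eLpNorm_add_le aestronglyMeasurable_const
      (hφμ.sub aestronglyMeasurable_const) one_le_two).trans ?_
    refine add_le_add (le_of_eq (eLpNorm_two_const _)) ((hb n).trans ?_)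
    exact mul_le_mul_right (hgrad n) _
  exact ⟨c, key m w.val w.memLp_val.1 h1 fun n => (hest n).1,
    key (surfaceMeasure G) w.trace w.memLp_trace.1 h3 fun n => (hest n).2⟩

end Sobolev

/-! ### The space of gradients and functionals on it -/

section GradSpace

variable {N : ℕ} {G : Set (Space N)}

noncomputable section

/-- Gradients of smooth periodic functions, as a subspace of `L²(Y*)`. -/
def smoothGradients (G : Set (Space N)) : Submodule ℝ (Lp (Space N) 2 (cellMeasure G)) where
  carrier := {f | ∃ φ : Space N → ℝ, ContDiff ℝ ∞ φ ∧ IsYPeriodic φ ∧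
    gradient φ =ᵐ[cellMeasure G] f}
  add_mem' := by
    rintro f g ⟨φ, hφ, hφp, hf⟩ ⟨ψ, hψ, hψp, hg⟩
    refine ⟨fun y => (1 : ℝ) • φ y + (1 : ℝ) • ψ y, (hφ.const_smul _).add (hψ.const_smul _),
      hφp.linearComb hψp 1 1, ?_⟩
    filter_upwards [hf, hg, Lp.coeFn_add f g] with y h1 h2 h3
    rw [h3, Pi.add_apply, ← h1, ← h2,
      gradient_linearComb ((contDiff_one_of_infty hφ).differentiable one_ne_zero y)
        ((contDiff_one_of_infty hψ).differentiable one_ne_zero y), one_smul, one_smul]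
  zero_mem' := by
    refine ⟨fun _ => 0, contDiff_const, fun i y => rfl, ?_⟩
    filter_upwards [Lp.coeFn_zero (Space N) 2 (cellMeasure G)] with y h
    rw [h]
    simp [gradient]
  smul_mem' := by
    rintro c f ⟨φ, hφ, hφp, hf⟩
    refine ⟨fun y => c • φ y + (0 : ℝ) • φ y, (hφ.const_smul _).add (hφ.const_smul _),
      hφp.linearComb hφp c 0, ?_⟩
    filter_upwards [hf, Lp.coeFn_smul c f] with y h1 h3
    rw [h3, Pi.smul_apply, ← h1,
      gradient_linearComb ((contDiff_one_of_infty hφ).differentiable one_ne_zero y)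
        ((contDiff_one_of_infty hφ).differentiable one_ne_zero y), zero_smul, add_zero]

/-- The closure in `L²(Y*)` of the gradients of smooth periodic functions. -/
def gradSpace (G : Set (Space N)) : Submodule ℝ (Lp (Space N) 2 (cellMeasure G)) :=
  (smoothGradients G).topologicalClosure

theorem isClosed_gradSpace : IsClosed (gradSpace G : Set (Lp (Space N) 2 (cellMeasure G))) :=
  Submodule.isClosed_topologicalClosure _

instance : CompleteSpace (gradSpace G) := isClosed_gradSpace.completeSpace_coe

theorem PerSobolev.toLp_grad_mem (w : PerSobolev G) : w.memLp_grad.toLp w.grad ∈ gradSpace G := by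
  obtain ⟨φ, hφ, hper, -, h2, -⟩ := w.isTrace
  have hφL : ∀ n, MemLp (gradient (φ n)) 2 (cellMeasure G) := fun n =>
    memLp_cellMeasure_of_continuous (continuous_gradient (contDiff_one_of_infty (hφ n))) 2
  have hlim : Tendsto (fun n => (hφL n).toLp (gradient (φ n))) atTop
      (𝓝 (w.memLp_grad.toLp w.grad)) :=
    (Lp.tendsto_Lp_iff_tendsto_eLpNorm'' _ hφL _ w.memLp_grad).2 h2
  exact mem_closure_of_tendsto hlim (Eventually.of_forall fun n =>
    ⟨φ n, hφ n, hper n, (hφL n).coeFn_toLp.symm⟩)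

/-- Approximating potentials, centred to zero mean, are Cauchy in L²(Y*) and in L²(∂G) by the
Poincaré and trace inequalities; the limits are the function and its trace. This turns an abstract
solution in `gradSpace G` into a Sobolev function. -/
theorem IsHole.exists_perSobolev_of_mem_gradSpace (hG : IsHole G) (hN : 1 ≤ N)
    {f : Lp (Space N) 2 (cellMeasure G)} (hf : f ∈ gradSpace G) :
    ∃ w : PerSobolev G, w.grad = f := by
  have := hG.isFiniteMeasure_surfaceMeasure hN
  obtain ⟨C, hC⟩ := hG.exists_poincare_trace hN
  have hm0 : (cellMeasure G).real univ ≠ 0 := by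
    have h : cellMeasure G univ ≠ 0 := by
      simp only [cellMeasure, Measure.restrict_apply_univ]; exact hG.volume_cell_ne_zero
    exact ENNReal.toReal_ne_zero.2 ⟨h, measure_ne_top _ _⟩
  obtain ⟨u, hu, hlim⟩ := mem_closure_iff_seq_limit.1 hf
  choose φ hφ hper hφu using hu
  let ψ : ℕ → Space N → ℝ := fun n y => φ n y - ((cellMeasure G).real univ)⁻¹ * ∫ y, φ n y ∂(cellMeasure G)
  have hψ : ∀ n, ContDiff ℝ ∞ (ψ n) := fun n => (hφ n).sub contDiff_const
  have hψp : ∀ n, IsYPeriodic (ψ n) := fun n i y => by simp only [ψ, hper n i y]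
  have hφi : ∀ n, Integrable (φ n) (cellMeasure G) := fun n =>
    (memLp_cellMeasure_of_continuous (hφ n).continuous 1).integrable le_rfl
  have hψi : ∀ n, Integrable (ψ n) (cellMeasure G) := fun n =>
    (memLp_cellMeasure_of_continuous (hψ n).continuous 1).integrable le_rfl
  have hψ0 : ∀ n, ∫ y, ψ n y ∂(cellMeasure G) = 0 := fun n => by
    simp only [ψ]
    rw [integral_sub (hφi n) (integrable_const _), integral_const, smul_eq_mul]
    field_simp
    ring
  have hψu : ∀ n, gradient (ψ n) =ᵐ[cellMeasure G] u n := fun n => by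
    filter_upwards [hφu n] with y hy
    rw [← hy]
    exact gradient_sub_const _ _ _
  have hψd : ∀ n, Differentiable ℝ (ψ n) := fun n =>
    (contDiff_one_of_infty (hψ n)).differentiable one_ne_zero
  have hest : ∀ n k, eLpNorm (ψ n - ψ k) 2 (cellMeasure G) ≤ C * edist (u n) (u k) ∧
      eLpNorm (ψ n - ψ k) 2 (surfaceMeasure G) ≤ C * edist (u n) (u k) := by
    intro n k
    have h := hC (ψ n - ψ k) ((contDiff_one_of_infty (hψ n)).sub (contDiff_one_of_infty (hψ k)))
      (by simp only [Pi.sub_apply]; rw [integral_sub (hψi n) (hψi k), hψ0, hψ0, sub_zero])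
    have e : eLpNorm (gradient (ψ n - ψ k)) 2 (cellMeasure G) = edist (u n) (u k) := by
      rw [Lp.edist_def]
      refine eLpNorm_congr_ae ?_
      filter_upwards [hψu n, hψu k] with y h1 h2
      rw [Pi.sub_apply, ← h1, ← h2]
      have := gradient_linearComb (hψd n y) (hψd k y) 1 (-1)
      simp only [one_smul, neg_smul, ← sub_eq_add_neg] at this
      exact this
    rwa [e] at h
  have hψL : ∀ n, MemLp (ψ n) 2 (cellMeasure G) := fun n => memLp_cellMeasure_of_continuous (hψ n).continuous 2
  have hψS : ∀ n, MemLp (ψ n) 2 (surfaceMeasure G) := fun n =>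
    hG.memLp_surfaceMeasure_of_continuous hN (hψ n).continuous 2
  have hcu : CauchySeq u := hlim.cauchySeq
  have hdist : ∀ (μ : Measure (Space N)) (hμ : ∀ n, MemLp (ψ n) 2 μ),
      (∀ n k, eLpNorm (ψ n - ψ k) 2 μ ≤ C * edist (u n) (u k)) →
      ∃ t : Space N → ℝ, MemLp t 2 μ ∧
        Tendsto (fun n => eLpNorm (fun y => ψ n y - t y) 2 μ) atTop (𝓝 0) := by
    intro μ hμ h
    have hc : CauchySeq fun n => (hμ n).toLp (ψ n) := by
      refine cauchySeq_of_dist_le_mul hcu C fun n k => ?_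
      rw [dist_edist, dist_edist, ← ENNReal.coe_toReal, ← ENNReal.toReal_mul, Lp.edist_toLp_toLp]
      exact ENNReal.toReal_mono (ENNReal.mul_ne_top ENNReal.coe_ne_top (edist_ne_top _ _)) (h n k)
    obtain ⟨T, hT⟩ := cauchySeq_tendsto_of_complete hc
    refine ⟨T, Lp.memLp T, ?_⟩
    rw [Lp.tendsto_Lp_iff_tendsto_eLpNorm'] at hT
    refine hT.congr fun n => eLpNorm_congr_ae ?_
    filter_upwards [(hμ n).coeFn_toLp] with y hy
    rw [Pi.sub_apply, hy]
  obtain ⟨W, hW, hW'⟩ := hdist (cellMeasure G) hψL fun n k => (hest n k).1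
  obtain ⟨T, hT, hT'⟩ := hdist (surfaceMeasure G) hψS fun n k => (hest n k).2
  have htr : IsTrace G W f T := by
    refine ⟨ψ, hψ, hψp, hW', ?_, hT'⟩
    rw [Lp.tendsto_Lp_iff_tendsto_eLpNorm'] at hlim
    refine hlim.congr fun n => eLpNorm_congr_ae ?_
    filter_upwards [hψu n] with y hy
    rw [Pi.sub_apply, hy]
  exact ⟨⟨W, f, T, hW, Lp.memLp f, hT, htr.isPeriodicWeakGradient hW (Lp.memLp f), htr⟩, rfl⟩

/-- Pairing a boundary density of zero mean with a trace is controlled by the gradient. -/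
theorem IsHole.exists_abs_integral_mul_trace_le (hG : IsHole G) (hN : 1 ≤ N) :
    ∃ C : ℝ, 0 ≤ C ∧ ∀ b : Space N → ℝ, MemLp b 2 (surfaceMeasure G) →
      ∫ y, b y ∂(surfaceMeasure G) = 0 → ∀ w : PerSobolev G,
        |∫ y, b y * w.trace y ∂(surfaceMeasure G)| ≤
          C * (eLpNorm b 2 (surfaceMeasure G)).toReal *
            (eLpNorm w.grad 2 (cellMeasure G)).toReal := by
  have := hG.isFiniteMeasure_surfaceMeasure hN
  obtain ⟨C, hC⟩ := hG.exists_poincare_trace_perSobolev hN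
  refine ⟨C, C.2, fun b hb hb0 w => ?_⟩
  obtain ⟨c, -, hc⟩ := hC w
  have hwc : MemLp (fun y => w.trace y - c) 2 (surfaceMeasure G) :=
    w.memLp_trace.sub (memLp_const c)
  have hbi : Integrable b (surfaceMeasure G) := hb.integrable one_le_two
  have hbw : Integrable (fun y => b y * w.trace y) (surfaceMeasure G) :=
    hb.integrable_mul w.memLp_trace
  -- Zero mean of b allows the constant of the trace inequality to be subtracted.
  have h1 : ∫ y, b y * w.trace y ∂(surfaceMeasure G) =
      ∫ y, b y * (w.trace y - c) ∂(surfaceMeasure G) := by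
    simp only [mul_sub]
    rw [integral_sub hbw (hbi.mul_const c), integral_mul_const, hb0, zero_mul, sub_zero]
  rw [h1]
  refine (abs_integral_mul_le hb hwc).trans ?_
  have h2 := ENNReal.toReal_mono (ENNReal.mul_ne_top ENNReal.coe_ne_top w.memLp_grad.2.ne) hc
  rw [ENNReal.toReal_mul, ENNReal.coe_toReal] at h2
  calc _ ≤ (eLpNorm b 2 (surfaceMeasure G)).toReal *
        (C * (eLpNorm w.grad 2 (cellMeasure G)).toReal) := by gcongr
    _ = _ := by ring

theorem integral_mul_linearComb {b : Space N → ℝ} (hb : MemLp b 2 (surfaceMeasure G)) (s t : ℝ)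
    (w w' : PerSobolev G) :
    ∫ y, b y * (PerSobolev.linearComb s t w w').trace y ∂(surfaceMeasure G) =
      s * ∫ y, b y * w.trace y ∂(surfaceMeasure G) +
        t * ∫ y, b y * w'.trace y ∂(surfaceMeasure G) := by
  have h1 : Integrable (fun y => b y * w.trace y) (surfaceMeasure G) :=
    hb.integrable_mul w.memLp_trace
  have h2 : Integrable (fun y => b y * w'.trace y) (surfaceMeasure G) :=
    hb.integrable_mul w'.memLp_trace
  rw [← integral_const_mul, ← integral_const_mul,
    ← integral_add (h1.const_mul s) (h2.const_mul t)]
  refine integral_congr_ae (ae_of_all _ fun y => ?_)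
  simp only [PerSobolev.linearComb, smul_eq_mul]
  ring

/-- The preceding bound is applied to w - w', whose gradient vanishes almost everywhere. -/
theorem IsHole.integral_mul_trace_congr (hG : IsHole G) (hN : 1 ≤ N) {b : Space N → ℝ}
    (hb : MemLp b 2 (surfaceMeasure G)) (hb0 : ∫ y, b y ∂(surfaceMeasure G) = 0)
    {w w' : PerSobolev G} (hw : w.grad =ᵐ[cellMeasure G] w'.grad) :
    ∫ y, b y * w.trace y ∂(surfaceMeasure G) = ∫ y, b y * w'.trace y ∂(surfaceMeasure G) := by
  obtain ⟨C, -, hC⟩ := hG.exists_abs_integral_mul_trace_le hN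
  have h := hC b hb hb0 (PerSobolev.linearComb 1 (-1) w w')
  have h0 : eLpNorm (PerSobolev.linearComb 1 (-1) w w').grad 2 (cellMeasure G) = 0 := by
    rw [← eLpNorm_zero (p := 2) (μ := cellMeasure G) (ε := Space N)]
    refine eLpNorm_congr_ae ?_
    filter_upwards [hw] with y hy
    simp [PerSobolev.linearComb, hy]
  rw [h0, ENNReal.toReal_zero, mul_zero, integral_mul_linearComb hb] at h
  have := abs_nonpos_iff.1 h
  linarith

/-- The boundary functional is represented by an element of `gradSpace`. -/
theorem IsHole.exists_riesz_trace (hG : IsHole G) (hN : 1 ≤ N) {b : Space N → ℝ}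
    (hb : MemLp b 2 (surfaceMeasure G)) (hb0 : ∫ y, b y ∂(surfaceMeasure G) = 0) :
    ∃ r : gradSpace G, ∀ (w : PerSobolev G) (f : gradSpace G),
      w.grad =ᵐ[cellMeasure G] (f : Lp (Space N) 2 (cellMeasure G)) →
        inner ℝ r f = ∫ y, b y * w.trace y ∂(surfaceMeasure G) := by
  obtain ⟨C, hC0, hC⟩ := hG.exists_abs_integral_mul_trace_le hN
  -- The choice of potentials need not be linear. Since the pairing depends only on the gradient,
  -- the functional is linear all the same.
  choose W hW using fun f : gradSpace G => hG.exists_perSobolev_of_mem_gradSpace hN f.2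
  let ℓ : gradSpace G →ₗ[ℝ] ℝ :=
    { toFun := fun f => ∫ y, b y * (W f).trace y ∂(surfaceMeasure G)
      map_add' := fun f g => by
        have h := integral_mul_linearComb hb 1 1 (W f) (W g)
        rw [one_mul, one_mul] at h
        rw [← h]
        refine hG.integral_mul_trace_congr hN hb hb0 ?_
        simp only [PerSobolev.linearComb, one_smul, hW]
        exact Lp.coeFn_add _ _
      map_smul' := fun c f => by
        have h := integral_mul_linearComb hb c 0 (W f) (W f)
        rw [zero_mul, add_zero] at h
        rw [RingHom.id_apply, smul_eq_mul, ← h]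
        refine hG.integral_mul_trace_congr hN hb hb0 ?_
        simp only [PerSobolev.linearComb, zero_smul, add_zero, hW]
        exact Lp.coeFn_smul _ _ }
  let L : gradSpace G →L[ℝ] ℝ := ℓ.mkContinuous (C * (eLpNorm b 2 (surfaceMeasure G)).toReal) (by
    intro f
    have h := hC b hb hb0 (W f)
    rw [hW] at h
    exact h)
  refine ⟨(InnerProductSpace.toDual ℝ (gradSpace G)).symm L, fun w f hwf => ?_⟩
  rw [InnerProductSpace.toDual_symm_apply]
  change ∫ y, b y * (W f).trace y ∂(surfaceMeasure G) = _
  refine hG.integral_mul_trace_congr hN hb hb0 ?_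
  rw [hW]
  exact hwf.symm

/-- A periodic test function of a single coordinate, supported away from the hole. -/
theorem IsHole.exists_coordinate_cutoff (hG : IsHole G) (j : Fin N) :
    ∃ ψ : Space N → ℝ, ContDiff ℝ ∞ ψ ∧ IsYPeriodic ψ ∧ Disjoint (tsupport ψ) (closure G) ∧
      (∀ y (t : ℝ) (i : Fin N), i ≠ j → ψ (y + t • EuclideanSpace.single i (1 : ℝ)) = ψ y) ∧
      0 < ∫ y, ψ y ∂(cellMeasure G) := by
  -- The function f equals 1 on the faces y j = ±1/2 and is at most some c < 1 on the compact
  -- closure of G. The cutoff switches on above the midpoint d of c and 1.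
  let f : Space N → ℝ := fun y => -Real.cos (2 * Real.pi * y j)
  have hf : Continuous f := by fun_prop
  have hfs : ContDiff ℝ ∞ f := by
    have h : ContDiff ℝ ∞ fun y : Space N => y j :=
      (EuclideanSpace.proj (𝕜 := ℝ) j : Space N →L[ℝ] ℝ).contDiff
    exact (Real.contDiff_cos.comp (contDiff_const.mul h)).neg
  have hfp : ∀ i y, f (y + EuclideanSpace.single i (1 : ℝ)) = f y := by
    intro i y
    by_cases hij : j = i
    · subst hij
      simp only [f, PiLp.add_apply, PiLp.single_apply, if_true]
      rw [mul_add, mul_one, Real.cos_add_two_pi]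
    · simp [f, hij]
  have hGc : IsCompact (closure G) := (isCompact_closedCube N).of_isClosed_subset isClosed_closure
    (hG.closure_subset.trans (openCube_subset_unitCube.trans unitCube_subset_closedCube))
  have hlt : ∀ y ∈ closure G, f y < 1 := by
    intro y hy
    have h := hG.closure_subset hy j
    have h1 : |2 * Real.pi * y j| < Real.pi := by
      rw [abs_mul, abs_of_pos Real.two_pi_pos]
      have : |y j| < 1 / 2 := abs_lt.2 ⟨by linarith [h.1], h.2⟩
      nlinarith [Real.pi_pos]
    have h2 := Real.cos_lt_cos_of_nonneg_of_le_pi (abs_nonneg _) le_rfl h1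
    rw [Real.cos_pi, Real.cos_abs] at h2
    simp only [f]
    linarith
  obtain ⟨c, hc1, hc⟩ : ∃ c < 1, ∀ y ∈ closure G, f y ≤ c := by
    rcases (closure G).eq_empty_or_nonempty with h | h
    · exact ⟨0, one_pos, by simp [h]⟩
    · obtain ⟨y, hy, hmax⟩ := hGc.exists_isMaxOn h hf.continuousOn
      exact ⟨f y, hlt y hy, fun z hz => hmax hz⟩
  set d := (c + 1) / 2 with hd
  let ψ : Space N → ℝ := fun y => Real.smoothTransition (f y - d)
  have hψ : ContDiff ℝ ∞ ψ := Real.smoothTransition.contDiff.comp (hfs.sub contDiff_const)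
  have hts : tsupport ψ ⊆ {y | d ≤ f y} := by
    refine closure_minimal (fun y hy => ?_) (isClosed_le continuous_const hf)
    by_contra h
    refine hy (Real.smoothTransition.zero_of_nonpos ?_)
    have h' : f y < d := not_le.1 h
    linarith
  have hdisj : Disjoint (tsupport ψ) (closure G) := by
    refine disjoint_left.2 fun y hy hyG => ?_
    have h1 : d ≤ f y := hts hy
    have h2 := hc y hyG
    linarith
  refine ⟨ψ, hψ, fun i y => by simp only [ψ, hfp], hdisj, fun y t i hij => ?_, ?_⟩
  · simp [ψ, f, hij.symm]
  · have hint : Integrable ψ (cellMeasure G) :=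
      (memLp_cellMeasure_of_continuous hψ.continuous 1).integrable le_rfl
    rw [integral_pos_iff_support_of_nonneg (fun y => Real.smoothTransition.nonneg _) hint]
    let y₀ : Space N := WithLp.toLp 2 fun _ => -(1 / 2)
    have hf0 : f y₀ = 1 := by
      simp only [f, y₀]
      rw [show 2 * Real.pi * -(1 / 2) = -Real.pi by ring, Real.cos_neg, Real.cos_pi, neg_neg]
    have hU : IsOpen {y | d < f y} := isOpen_lt continuous_const hf
    have hvol := volume_inter_unitCube_ne_zero hU (y := y₀)
      (by change d < f y₀; rw [hf0, hd]; linarith) (fun i => by simp [y₀])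
    have hsub : {y | d < f y} ∩ unitCube N ⊆ Function.support ψ ∩ cell G := by
      intro y hy
      have hy1 : d < f y := hy.1
      refine ⟨(Real.smoothTransition.pos_of_pos (by linarith)).ne', hy.2, fun hyG => ?_⟩
      have := hc y (subset_closure hyG)
      linarith
    rw [cellMeasure, Measure.restrict_apply' hG.measurableSet_cell, pos_iff_ne_zero]
    exact fun h0 => hvol (measure_mono_null hsub h0)

/-- Take the cutoff ψ for a coordinate j ≠ i, which exists as N ≥ 2. Then ∂ᵢψ = 0, so the
weak-gradient identity gives ∫ ψ ∂ᵢw = 0 and ∫ ψ (ηᵢ + ∂ᵢw) = ηᵢ ∫ ψ; Cauchy–Schwarz concludes. -/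
theorem IsHole.exists_abs_apply_le (hG : IsHole G) (hN : 2 ≤ N) (i : Fin N) :
    ∃ K : ℝ, 0 ≤ K ∧ ∀ (η : Space N) (w : PerSobolev G),
      |η i| ≤ K * (eLpNorm (fun y => η + w.grad y) 2 (cellMeasure G)).toReal := by
  have : Nontrivial (Fin N) := Fin.nontrivial_iff_two_le.2 hN
  obtain ⟨j, hj⟩ := exists_ne i
  obtain ⟨ψ, hψ, hψp, hψG, hψi, hψ0⟩ := hG.exists_coordinate_cutoff j
  set e : Space N := EuclideanSpace.single i (1 : ℝ) with he
  have hψL : MemLp ψ 2 (cellMeasure G) := memLp_cellMeasure_of_continuous hψ.continuous 2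
  have hψe : MemLp (fun y => ψ y • e) 2 (cellMeasure G) :=
    memLp_cellMeasure_of_continuous (hψ.continuous.smul continuous_const) 2
  have hgrad : ∀ y, inner ℝ e (gradient ψ y) = 0 := by
    intro y
    have hd : DifferentiableAt ℝ ψ y := (contDiff_one_of_infty hψ).differentiable one_ne_zero y
    rw [real_inner_comm, gradient, InnerProductSpace.toDual_symm_apply, ← hd.lineDeriv_eq_fderiv,
      lineDeriv]
    simp only [he, hψi y _ i hj.symm, deriv_const]
  set I := ∫ y, ψ y ∂(cellMeasure G) with hI
  refine ⟨I⁻¹ * (eLpNorm (fun y => ψ y • e) 2 (cellMeasure G)).toReal, by positivity,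
    fun η w => ?_⟩
  have hηw : MemLp (fun y => η + w.grad y) 2 (cellMeasure G) := (memLp_const η).add w.memLp_grad
  have h1 : ∫ y, inner ℝ e (ψ y • w.grad y) ∂(cellMeasure G) = 0 := by
    have hi1 : Integrable (fun y => ψ y • w.grad y) (cellMeasure G) :=
      memLp_one_iff_integrable.1 (w.memLp_grad.smul (p := 2) (q := 2) (r := 1) hψL)
    have hi2 : Integrable (fun y => w.val y • gradient ψ y) (cellMeasure G) :=
      memLp_one_iff_integrable.1 ((memLp_cellMeasure_of_continuous
        (continuous_gradient (contDiff_one_of_infty hψ)) 2).smul (p := 2) (q := 2) (r := 1)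
          w.memLp_val)
    rw [integral_inner hi1, ← neg_eq_zero, ← inner_neg_right, ← w.isWeakGradient ψ hψ hψp hψG, ← integral_inner hi2]
    simp [inner_smul_right, hgrad]
  have h2 : ∫ y, inner ℝ (ψ y • e) (η + w.grad y) ∂(cellMeasure G) = η i * I := by
    have hi1 : Integrable (fun y => inner ℝ e (ψ y • w.grad y)) (cellMeasure G) :=
      (memLp_one_iff_integrable.1
        (w.memLp_grad.smul (p := 2) (q := 2) (r := 1) hψL)).const_inner e
    have e1 : ∀ y, inner ℝ (ψ y • e) (η + w.grad y) = η i * ψ y + inner ℝ e (ψ y • w.grad y) := by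
      intro y
      rw [inner_add_right, inner_smul_left, inner_smul_left, inner_smul_right, he,
        EuclideanSpace.inner_single_left]
      simp [mul_comm]
    simp only [e1]
    rw [integral_add ((hψL.integrable one_le_two).const_mul _) hi1, h1, add_zero,
      integral_const_mul]
  have h3 := abs_integral_inner_le hψe hηw
  rw [h2, abs_mul, abs_of_pos hψ0] at h3
  rw [mul_assoc, ← div_eq_inv_mul, le_div_iff₀ hψ0]
  exact h3

/-- A constant vector is controlled by its perturbations by periodic gradients. -/
theorem IsHole.exists_norm_le_eLpNorm_add_grad (hG : IsHole G) (hN : 2 ≤ N) :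
    ∃ K : ℝ, 0 ≤ K ∧ ∀ (η : Space N) (w : PerSobolev G),
      ‖η‖ ≤ K * (eLpNorm (fun y => η + w.grad y) 2 (cellMeasure G)).toReal := by
  choose K hK0 hK using fun i => hG.exists_abs_apply_le hN i
  refine ⟨∑ i, K i, Finset.sum_nonneg fun i _ => hK0 i, fun η w => ?_⟩
  have h : ‖η‖ ≤ ∑ i, |η i| := by
    conv_lhs => rw [← (EuclideanSpace.basisFun (Fin N) ℝ).sum_repr η]
    refine (norm_sum_le _ _).trans (Finset.sum_le_sum fun i _ => ?_)
    simp [norm_smul]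
  rw [Finset.sum_mul]
  exact h.trans (Finset.sum_le_sum fun i _ => hK i η w)

end

end GradSpace

/-! ### Measurability of Carathéodory compositions -/

section Caratheodory

variable {α X Z : Type*} [MeasurableSpace α] {μ : Measure α} [TopologicalSpace X]
  [NormedAddCommGroup Z]

/-- For simple p the composition is a finite sum of indicators; continuity in x passes to the limit
along simple approximations. -/
theorem aestronglyMeasurable_caratheodory_comp {a : X → α → Z} {p : α → X}
    (ha : ∀ x, AEStronglyMeasurable (a x) μ) (hc : ∀ᵐ y ∂μ, Continuous fun x => a x y)
    (hp : AEStronglyMeasurable p μ) : AEStronglyMeasurable (fun y => a (p y) y) μ := by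
  classical
  have hsimple : ∀ s : SimpleFunc α X, AEStronglyMeasurable (fun y => a (s y) y) μ := by
    intro s
    have e : (fun y => a (s y) y) =
        fun y => ∑ x ∈ s.range, (s ⁻¹' {x}).indicator (a x) y := by
      ext1 y
      rw [Finset.sum_eq_single (s y)]
      · simp
      · intro x _ hx
        rw [indicator_of_notMem]
        exact fun h : s y = x => hx h.symm
      · exact fun h => absurd (s.mem_range_self y) h
    rw [e]
    exact Finset.aestronglyMeasurable_fun_sum _ fun x _ =>
      (ha x).indicator (s.measurableSet_preimage _)
  obtain ⟨p', hp', hpp'⟩ := hp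
  have h : AEStronglyMeasurable (fun y => a (p' y) y) μ := by
    refine aestronglyMeasurable_of_tendsto_ae atTop (fun n => hsimple (hp'.approx n)) ?_
    filter_upwards [hc] with y hy
    exact (hy.tendsto _).comp (hp'.tendsto_approx y)
  refine h.congr ?_
  filter_upwards [hpp'] with y hy
  rw [hy]

end Caratheodory

/-! ### The flux operator and solvability of the cell problem -/

section Flux

variable {N : ℕ} {G : Set (Space N)} {a : Space N → Space N → Space N}

theorem ae_cellMeasure_of_ae_unitCube {P : Space N → Prop}
    (h : ∀ᵐ y ∂(volume.restrict (unitCube N)), P y) : ∀ᵐ y ∂(cellMeasure G), P y :=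
  ae_restrict_of_ae_restrict_of_subset cell_subset_unitCube h

theorem IsFlux.aestronglyMeasurable (ha : IsFlux a) (ξ : Space N) :
    AEStronglyMeasurable (a ξ) (cellMeasure G) :=
  (ha.memLp ξ).1.mono_measure (Measure.restrict_mono_set _ cell_subset_unitCube)

theorem IsFlux.aestronglyMeasurable_comp (ha : IsFlux a) {p : Space N → Space N}
    (hp : AEStronglyMeasurable p (cellMeasure G)) :
    AEStronglyMeasurable (fun y => a (p y) y) (cellMeasure G) :=
  aestronglyMeasurable_caratheodory_comp ha.aestronglyMeasurable
    (ae_cellMeasure_of_ae_unitCube ha.continuous_ae) hp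

theorem IsFlux.memLp_comp (ha : IsFlux a) {p : Space N → Space N}
    (hp : MemLp p 2 (cellMeasure G)) : MemLp (fun y => a (p y) y) 2 (cellMeasure G) := by
  obtain ⟨C₃, C₄, h3, h4, h⟩ := ha.growth
  refine MemLp.mono' ((hp.norm.const_mul C₃).add (memLp_const C₄))
    (ha.aestronglyMeasurable_comp hp.1) ?_
  filter_upwards [ae_cellMeasure_of_ae_unitCube h] with y hy
  exact hy (p y)

theorem inner_toLp_eq_integral {f g : Space N → Space N} (hf : MemLp f 2 (cellMeasure G))
    (hg : MemLp g 2 (cellMeasure G)) :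
    inner ℝ (hf.toLp f) (hg.toLp g) = ∫ y, inner ℝ (f y) (g y) ∂(cellMeasure G) := by
  rw [L2.inner_def]
  refine integral_congr_ae ?_
  filter_upwards [hf.coeFn_toLp, hg.coeFn_toLp] with y h1 h2
  rw [h1, h2]

theorem integrable_inner_of_memLp_two {f g : Space N → Space N} (hf : MemLp f 2 (cellMeasure G))
    (hg : MemLp g 2 (cellMeasure G)) :
    Integrable (fun y => inner ℝ (f y) (g y)) (cellMeasure G) := by
  refine (L2.integrable_inner (𝕜 := ℝ) (hf.toLp f) (hg.toLp g)).congr ?_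
  filter_upwards [hf.coeFn_toLp, hg.coeFn_toLp] with y h1 h2
  rw [h1, h2]

theorem toReal_eLpNorm_two_sq {f : Space N → Space N} (hf : MemLp f 2 (cellMeasure G)) :
    (eLpNorm f 2 (cellMeasure G)).toReal ^ 2 = ∫ y, ‖f y‖ ^ 2 ∂(cellMeasure G) := by
  rw [← Lp.norm_toLp f hf, ← real_inner_self_eq_norm_sq, inner_toLp_eq_integral hf hf]
  simp only [real_inner_self_eq_norm_sq]

theorem IsFlux.exists_monotone (ha : IsFlux a) : ∃ κ : ℝ, 0 < κ ∧ ∀ p q : Space N → Space N,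
    MemLp p 2 (cellMeasure G) → MemLp q 2 (cellMeasure G) →
    κ * (eLpNorm (fun y => p y - q y) 2 (cellMeasure G)).toReal ^ 2 ≤
      ∫ y, inner ℝ (a (p y) y - a (q y) y) (p y - q y) ∂(cellMeasure G) := by
  obtain ⟨κ, hκ, h⟩ := ha.monotone
  refine ⟨κ, hκ, fun p q hp hq => ?_⟩
  have hpq : MemLp (fun y => p y - q y) 2 (cellMeasure G) := hp.sub hq
  have haa : MemLp (fun y => a (p y) y - a (q y) y) 2 (cellMeasure G) :=
    (ha.memLp_comp hp).sub (ha.memLp_comp hq)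
  rw [toReal_eLpNorm_two_sq hpq, ← integral_const_mul]
  refine integral_mono_ae (hpq.integrable_norm_pow two_ne_zero |>.const_mul κ)
    (integrable_inner_of_memLp_two haa hpq) ?_
  filter_upwards [ae_cellMeasure_of_ae_unitCube h] with y hy
  exact hy _ _

/-- The hemicontinuity needed for Minty's theorem; linear growth provides the dominating function
for |t| < 1. -/
theorem IsFlux.tendsto_integral_inner_line (ha : IsFlux a) {p h : Space N → Space N}
    (hp : MemLp p 2 (cellMeasure G)) (hh : MemLp h 2 (cellMeasure G)) :
    Tendsto (fun t : ℝ => ∫ y, inner ℝ (a (p y + t • h y) y) (h y) ∂(cellMeasure G)) (𝓝 0)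
      (𝓝 (∫ y, inner ℝ (a (p y) y) (h y) ∂(cellMeasure G))) := by
  obtain ⟨C₃, C₄, h3, h4, hg⟩ := ha.growth
  have hbound : MemLp (fun y => C₃ * (‖p y‖ + ‖h y‖) + C₄) 2 (cellMeasure G) :=
    ((hp.norm.add hh.norm).const_mul C₃).add (memLp_const C₄)
  refine tendsto_integral_filter_of_dominated_convergence
    (fun y => (C₃ * (‖p y‖ + ‖h y‖) + C₄) * ‖h y‖) ?_ ?_ (hbound.integrable_mul hh.norm) ?_
  · refine Eventually.of_forall fun t => ?_
    exact (ha.aestronglyMeasurable_comp (hp.add (hh.const_smul t)).1).inner hh.1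
  · filter_upwards [Metric.ball_mem_nhds (0 : ℝ) one_pos] with t ht
    rw [mem_ball_zero_iff, Real.norm_eq_abs] at ht
    filter_upwards [ae_cellMeasure_of_ae_unitCube hg] with y hy
    refine (norm_inner_le_norm _ _).trans ?_
    gcongr
    refine (hy _).trans ?_
    gcongr
    refine (norm_add_le _ _).trans ?_
    gcongr
    rw [norm_smul, Real.norm_eq_abs]
    nlinarith [norm_nonneg (h y)]
  · filter_upwards [ae_cellMeasure_of_ae_unitCube ha.continuous_ae] with y hy
    have h1 : Continuous fun t : ℝ => inner ℝ (a (p y + t • h y) y) (h y) :=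
      (hy.comp (by fun_prop : Continuous fun t : ℝ => p y + t • h y)).inner continuous_const
    simpa using h1.tendsto 0

theorem IsBoundaryLaw.memLp_two {g : ℝ → Space N → ℝ} (hg : IsBoundaryLaw G g)
    [IsFiniteMeasure (surfaceMeasure G)] (u : ℝ) : MemLp (g u) 2 (surfaceMeasure G) :=
  (hg.memLp u).mono_exponent le_top

/-- The cell problem is solvable. -/
theorem exists_isCellSolution (hN : 1 ≤ N) (hG : IsHole G) (ha : IsFlux a)
    {g : ℝ → Space N → ℝ} (hg : IsBoundaryLaw G g) (ξ : Space N) (u : ℝ) :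
    ∃ w : PerSobolev G, IsCellSolution a g ξ u w := by
  have := hG.isFiniteMeasure_surfaceMeasure hN
  obtain ⟨r, hr⟩ := hG.exists_riesz_trace hN (hg.memLp_two u) (hg.mean_zero u)
  obtain ⟨κ, hκ, hmono⟩ := ha.exists_monotone (G := G)
  have hξ : ∀ f : gradSpace G, MemLp (fun y => ξ + (f : Lp (Space N) 2 (cellMeasure G)) y) 2
      (cellMeasure G) := fun f => (memLp_const ξ).add (Lp.memLp _)
  let A : gradSpace G → Lp (Space N) 2 (cellMeasure G) := fun f =>
    (ha.memLp_comp (hξ f)).toLp _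
  -- Projecting onto `gradSpace G` amounts to testing with gradients only, so T f = 0 is the weak
  -- cell problem.
  let T : gradSpace G → gradSpace G := fun f => (gradSpace G).orthogonalProjectionOnto (A f) - r
  have hT : ∀ f h : gradSpace G, inner ℝ (T f) h =
      ∫ y, inner ℝ (a (ξ + (f : Lp (Space N) 2 (cellMeasure G)) y) y)
        ((h : Lp (Space N) 2 (cellMeasure G)) y) ∂(cellMeasure G) - inner ℝ r h := by
    intro f h
    have h1 := Submodule.inner_orthogonalProjectionOnto_eq_of_mem_right h (A f)
    rw [inner_sub_left, h1, L2.inner_def]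
    congr 1
    refine integral_congr_ae ?_
    filter_upwards [(ha.memLp_comp (hξ f)).coeFn_toLp] with y hy
    rw [hy]
  have hcoe : ∀ (f h : gradSpace G) (t : ℝ),
      ((f + t • h : gradSpace G) : Lp (Space N) 2 (cellMeasure G)) =ᵐ[cellMeasure G]
      fun y => (f : Lp (Space N) 2 (cellMeasure G)) y +
        t • (h : Lp (Space N) 2 (cellMeasure G)) y := by
    intro f h t
    rw [Submodule.coe_add, Submodule.coe_smul]
    filter_upwards [Lp.coeFn_add (f : Lp (Space N) 2 (cellMeasure G)) (t • h),
      Lp.coeFn_smul t (h : Lp (Space N) 2 (cellMeasure G))] with y h1 h2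
    rw [h1, Pi.add_apply, h2, Pi.smul_apply]
  obtain ⟨f, hf⟩ := exists_eq_zero_of_strongly_monotone T hκ (fun x y => by
    have e : ((x - y : gradSpace G) : Lp (Space N) 2 (cellMeasure G)) =ᵐ[cellMeasure G]
        fun z => (ξ + (x : Lp (Space N) 2 (cellMeasure G)) z) -
          (ξ + (y : Lp (Space N) 2 (cellMeasure G)) z) := by
      rw [Submodule.coe_sub]
      filter_upwards [Lp.coeFn_sub (x : Lp (Space N) 2 (cellMeasure G)) y] with z hz
      rw [hz, Pi.sub_apply, add_sub_add_left_eq_sub]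
    have h1 := hmono _ _ (hξ x) (hξ y)
    rw [← eLpNorm_congr_ae e] at h1
    have hd : MemLp (fun z => (x - y : gradSpace G).1 z) 2 (cellMeasure G) := Lp.memLp _
    rw [inner_sub_left, hT, hT, sub_sub_sub_cancel_right, ← integral_sub
      (integrable_inner_of_memLp_two (ha.memLp_comp (hξ x)) hd)
      (integrable_inner_of_memLp_two (ha.memLp_comp (hξ y)) hd)]
    refine h1.trans (le_of_eq (integral_congr_ae ?_))
    filter_upwards [e] with z hz
    rw [hz, ← inner_sub_left]) (fun x h => by
    simp only [hT]
    refine Tendsto.sub_const ?_ _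
    have h1 := ha.tendsto_integral_inner_line (hξ x) (Lp.memLp (h : Lp (Space N) 2 (cellMeasure G)))
    refine h1.congr fun t => integral_congr_ae ?_
    filter_upwards [hcoe x h t] with y hy
    rw [hy, add_assoc])
  obtain ⟨w, hw⟩ := hG.exists_perSobolev_of_mem_gradSpace hN f.2
  refine ⟨w, fun v => ?_⟩
  have h := hT f ⟨_, v.toLp_grad_mem⟩
  rw [hf, inner_zero_left, hr v _ v.memLp_grad.coeFn_toLp.symm, eq_comm, sub_eq_zero] at h
  rw [← h, hw]
  refine integral_congr_ae ?_
  filter_upwards [v.memLp_grad.coeFn_toLp] with y hy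
  rw [hy]

end Flux

/-! ### The boundary law and its derivative -/

section BoundaryLaw

variable {N : ℕ} {G : Set (Space N)} {g : ℝ → Space N → ℝ}

theorem toReal_eLpNorm_two_le {α F : Type*} [MeasurableSpace α] [NormedAddCommGroup F]
    {μ : Measure α} [IsFiniteMeasure μ] {f : α → F} {B : ℝ} (hB : 0 ≤ B)
    (h : ∀ᵐ y ∂μ, ‖f y‖ ≤ B) : (eLpNorm f 2 μ).toReal ≤ B * (μ.real univ) ^ (1 / 2 : ℝ) := by
  have h1 := eLpNorm_le_of_ae_bound (p := 2) h
  have h2 := ENNReal.toReal_mono (ENNReal.mul_ne_top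
    (ENNReal.rpow_ne_top_of_nonneg (by positivity) (measure_ne_top _ _)) ENNReal.ofReal_ne_top) h1
  rw [ENNReal.toReal_mul, ENNReal.toReal_ofReal hB, ← ENNReal.toReal_rpow, mul_comm] at h2
  simpa [measureReal_def] using h2

theorem IsBoundaryLaw.aestronglyMeasurable_deriv (hg : IsBoundaryLaw G g) (u : ℝ) :
    AEStronglyMeasurable (fun y => deriv (fun s => g s y) u) (surfaceMeasure G) := by
  refine aestronglyMeasurable_of_tendsto_ae (𝓝[≠] (0 : ℝ))
    (f := fun t y => t⁻¹ • (g (u + t) y - g u y)) (fun t =>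
    (((hg.memLp (u + t)).1.sub (hg.memLp u).1).const_smul t⁻¹ :)) ?_
  filter_upwards [hg.differentiable_ae] with y hy
  exact (hy u).hasDerivAt.tendsto_slope_zero

theorem IsBoundaryLaw.exists_abs_deriv_le (hg : IsBoundaryLaw G g) :
    ∃ C : ℝ, 0 < C ∧ (∀ᵐ y ∂(surfaceMeasure G), ∀ u v, |g u y - g v y| ≤ C * |u - v|) ∧
      ∀ᵐ y ∂(surfaceMeasure G), ∀ u, |deriv (fun s => g s y) u| ≤ C := by
  obtain ⟨C, hC, h⟩ := hg.lipschitz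
  refine ⟨C, hC, h, ?_⟩
  filter_upwards [h] with y hy u
  have hL : LipschitzWith C.toNNReal fun s => g s y := LipschitzWith.of_dist_le_mul fun s t => by
    rw [Real.dist_eq, Real.dist_eq, Real.coe_toNNReal _ hC.le]
    exact hy s t
  have := norm_deriv_le_of_lipschitz hL (x₀ := u)
  rwa [Real.coe_toNNReal _ hC.le] at this

variable [IsFiniteMeasure (surfaceMeasure G)]

theorem IsBoundaryLaw.memLp_deriv (hg : IsBoundaryLaw G g) (u : ℝ) :
    MemLp (fun y => deriv (fun s => g s y) u) 2 (surfaceMeasure G) := by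
  obtain ⟨C, -, -, h⟩ := hg.exists_abs_deriv_le
  refine MemLp.of_bound (hg.aestronglyMeasurable_deriv u) C ?_
  filter_upwards [h] with y hy using hy u

/-- The zero-mean condition is differentiated under the integral, with the Lipschitz constant as
dominating function. This makes b* blind to additive constants. -/
theorem IsBoundaryLaw.integral_deriv_eq_zero (hg : IsBoundaryLaw G g) (u : ℝ) :
    ∫ y, deriv (fun s => g s y) u ∂(surfaceMeasure G) = 0 := by
  obtain ⟨C, hC, h, -⟩ := hg.exists_abs_deriv_le
  have hd := (hasDerivAt_integral_of_dominated_loc_of_lip (𝕜 := ℝ) (μ := surfaceMeasure G)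
    (F := g) (F' := fun y => deriv (fun s => g s y) u) (x₀ := u) (bound := fun _ => C)
    (s := univ) univ_mem
    (Eventually.of_forall fun v => (hg.memLp v).1)
    ((hg.memLp_two u).integrable one_le_two) (hg.aestronglyMeasurable_deriv u) (by
      filter_upwards [h] with y hy
      refine LipschitzOnWith.of_dist_le_mul fun s _ t _ => ?_
      rw [Real.dist_eq, Real.dist_eq, Real.coe_nnabs, abs_of_pos hC]
      exact hy s t) (integrable_const _) (by
      filter_upwards [hg.differentiable_ae] with y hy
      exact (hy u).hasDerivAt)).2
  simp only [hg.mean_zero] at hd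
  exact hd.unique (hasDerivAt_const u 0)

end BoundaryLaw

/-! ### Energy, coercivity and growth estimates -/

section Estimates

variable {N : ℕ} {G : Set (Space N)} {a : Space N → Space N → Space N} {g : ℝ → Space N → ℝ}

/-- The `L²(Y*)` norm as a real number. -/
noncomputable def cellNorm (G : Set (Space N)) (f : Space N → Space N) : ℝ :=
  (eLpNorm f 2 (cellMeasure G)).toReal

theorem cellNorm_nonneg (f : Space N → Space N) : 0 ≤ cellNorm G f := ENNReal.toReal_nonneg

theorem PerSobolev.memLp_const_add_grad (w : PerSobolev G) (ξ : Space N) :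
    MemLp (fun y => ξ + w.grad y) 2 (cellMeasure G) := (memLp_const ξ).add w.memLp_grad

theorem cellNorm_grad_le (w : PerSobolev G) (η : Space N) :
    cellNorm G w.grad ≤ cellNorm G (fun y => η + w.grad y) +
      ‖η‖ * ((cellMeasure G).real univ) ^ (1 / 2 : ℝ) := by
  have h1 : cellNorm G w.grad ≤ cellNorm G (fun y => η + w.grad y) + cellNorm G fun _ => η := by
    rw [cellNorm, cellNorm, cellNorm, ← ENNReal.toReal_add (w.memLp_const_add_grad η).2.ne
      (memLp_const η).2.ne]
    refine ENNReal.toReal_mono (ENNReal.add_ne_top.2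
      ⟨(w.memLp_const_add_grad η).2.ne, (memLp_const η).2.ne⟩) ?_
    refine le_trans (le_of_eq ?_) (eLpNorm_sub_le (w.memLp_const_add_grad η).1
      aestronglyMeasurable_const one_le_two)
    congr 1
    ext1 y
    simp
  refine h1.trans (add_le_add le_rfl ?_)
  exact toReal_eLpNorm_two_le (norm_nonneg η) (ae_of_all _ fun _ => le_rfl)

/-- The gradient of a periodic function and the constant vector are both controlled by their
sum. -/
theorem IsHole.exists_cellNorm_grad_le (hG : IsHole G) (hN : 2 ≤ N) :
    ∃ K : ℝ, 0 < K ∧ ∀ (η : Space N) (w : PerSobolev G),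
      ‖η‖ ≤ K * cellNorm G (fun y => η + w.grad y) ∧
      cellNorm G w.grad ≤ K * cellNorm G (fun y => η + w.grad y) := by
  obtain ⟨K, hK0, hK⟩ := hG.exists_norm_le_eLpNorm_add_grad hN
  set M := ((cellMeasure G).real univ) ^ (1 / 2 : ℝ) with hM
  have hM0 : 0 ≤ M := by positivity
  refine ⟨1 + K + K * M, by positivity, fun η w => ?_⟩
  have h1 : ‖η‖ ≤ K * cellNorm G (fun y => η + w.grad y) := hK η w
  have h2 := cellNorm_grad_le w η
  have h3 := cellNorm_nonneg (G := G) fun y => η + w.grad y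
  have h4 : ‖η‖ * M ≤ K * cellNorm G (fun y => η + w.grad y) * M := by gcongr
  have h5 : 0 ≤ K * M * cellNorm G (fun y => η + w.grad y) := by positivity
  have h6 : 0 ≤ K * cellNorm G (fun y => η + w.grad y) := by positivity
  constructor <;> nlinarith

/-- The `L²(Y*)` distance between the full gradients `ξ + Dw` and `ζ + Dw'`. -/
noncomputable def gradDist (ξ ζ : Space N) (w w' : PerSobolev G) : ℝ :=
  cellNorm G fun y => (ξ - ζ) + (PerSobolev.linearComb 1 (-1) w w').grad y

theorem gradDist_eq (ξ ζ : Space N) (w w' : PerSobolev G) :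
    gradDist ξ ζ w w' = cellNorm G fun y => (ξ + w.grad y) - (ζ + w'.grad y) := by
  rw [gradDist]
  congr 1
  ext1 y
  simp only [PerSobolev.linearComb]
  module

theorem inner_fluxOf (ha : IsFlux a) (ξ η : Space N) (w : PerSobolev G) :
    inner ℝ (fluxOf a ξ w) η = ∫ y, inner ℝ (a (ξ + w.grad y) y) η ∂(cellMeasure G) := by
  have hi : Integrable (fun y => a (ξ + w.grad y) y) (cellMeasure G) :=
    (ha.memLp_comp (w.memLp_const_add_grad ξ)).integrable one_le_two
  rw [fluxOf, real_inner_comm, ← integral_inner hi]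
  exact integral_congr_ae (ae_of_all _ fun y => real_inner_comm _ _)

/-- The cell problem is tested with its own solution. -/
theorem IsCellSolution.integral_inner_self (ha : IsFlux a) {ξ : Space N} {u : ℝ}
    {w : PerSobolev G} (hw : IsCellSolution a g ξ u w) :
    ∫ y, inner ℝ (a (ξ + w.grad y) y) (ξ + w.grad y) ∂(cellMeasure G) =
      inner ℝ (fluxOf a ξ w) ξ + ∫ y, g u y * w.trace y ∂(surfaceMeasure G) := by
  have h := ha.memLp_comp (w.memLp_const_add_grad ξ)
  rw [inner_fluxOf ha, ← hw w, ← integral_add (integrable_inner_of_memLp_two h (memLp_const ξ))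
    (integrable_inner_of_memLp_two h w.memLp_grad)]
  exact integral_congr_ae (ae_of_all _ fun y => inner_add_right _ _ _)

theorem integral_norm_le_cellNorm {f : Space N → Space N} (hf : MemLp f 2 (cellMeasure G)) :
    ∫ y, ‖f y‖ ∂(cellMeasure G) ≤ ((cellMeasure G).real univ) ^ (1 / 2 : ℝ) * cellNorm G f := by
  have h5 := abs_integral_mul_le (memLp_const (1 : ℝ)) hf.norm
  have h6 : (eLpNorm (fun _ : Space N => (1 : ℝ)) 2 (cellMeasure G)).toReal ≤
      1 * ((cellMeasure G).real univ) ^ (1 / 2 : ℝ) :=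
    toReal_eLpNorm_two_le zero_le_one (ae_of_all _ fun _ => by simp)
  simp only [one_mul, eLpNorm_norm] at h5 h6
  exact (le_abs_self _).trans (h5.trans (mul_le_mul_of_nonneg_right h6 ENNReal.toReal_nonneg))

theorem exists_norm_fluxOf_le (ha : IsFlux a) :
    ∃ B : ℝ, 0 ≤ B ∧ ∀ (ξ : Space N) (w : PerSobolev G),
      ‖fluxOf a ξ w‖ ≤ B * (cellNorm G (fun y => ξ + w.grad y) + 1) := by
  obtain ⟨C₃, C₄, h3, h4, h⟩ := ha.growth
  set M := ((cellMeasure G).real univ) ^ (1 / 2 : ℝ) with hM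
  set V := (cellMeasure G).real univ
  refine ⟨C₃ * M + C₄ * V, by positivity, fun ξ w => ?_⟩
  have hp := w.memLp_const_add_grad ξ
  have h1 : ‖fluxOf a ξ w‖ ≤ ∫ y, (C₃ * ‖ξ + w.grad y‖ + C₄) ∂(cellMeasure G) := by
    refine norm_integral_le_of_norm_le (((hp.norm.integrable one_le_two).const_mul C₃).add
      (integrable_const _)) ?_
    filter_upwards [ae_cellMeasure_of_ae_unitCube h] with y hy
    exact hy _
  have h2 : ∫ y, ‖ξ + w.grad y‖ ∂(cellMeasure G) ≤ M * cellNorm G (fun y => ξ + w.grad y) :=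
    integral_norm_le_cellNorm hp
  rw [integral_add ((hp.norm.integrable one_le_two).const_mul C₃) (integrable_const _),
    integral_const_mul, integral_const, smul_eq_mul] at h1
  have h7 := mul_le_mul_of_nonneg_left h2 h3.le
  have h8 := cellNorm_nonneg (G := G) fun y => ξ + w.grad y
  have hM0 : 0 ≤ M := by positivity
  have hV0 : 0 ≤ V := measureReal_nonneg
  have h9 : 0 ≤ C₃ * M := by positivity
  have h10 : 0 ≤ C₄ * V * cellNorm G (fun y => ξ + w.grad y) := by positivity
  linear_combination h1 + h7 + h9 + h10

variable [IsFiniteMeasure (surfaceMeasure G)]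

/-- Both cell problems are tested with w - w' and subtracted. -/
theorem IsCellSolution.integral_inner_sub (ha : IsFlux a) (hg : IsBoundaryLaw G g)
    {ξ ζ : Space N} {u v : ℝ} {w w' : PerSobolev G} (hw : IsCellSolution a g ξ u w)
    (hw' : IsCellSolution a g ζ v w') :
    ∫ y, inner ℝ (a (ξ + w.grad y) y - a (ζ + w'.grad y) y)
        ((ξ + w.grad y) - (ζ + w'.grad y)) ∂(cellMeasure G) =
      inner ℝ (fluxOf a ξ w - fluxOf a ζ w') (ξ - ζ) +
        ∫ y, (g u y - g v y) * (PerSobolev.linearComb 1 (-1) w w').trace y ∂(surfaceMeasure G) := by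
  set z := PerSobolev.linearComb 1 (-1) w w' with hz
  have h1 := ha.memLp_comp (w.memLp_const_add_grad ξ)
  have h2 := ha.memLp_comp (w'.memLp_const_add_grad ζ)
  have hi1 : Integrable (fun y => g u y * z.trace y) (surfaceMeasure G) :=
    (hg.memLp_two u).integrable_mul z.memLp_trace
  have hi2 : Integrable (fun y => g v y * z.trace y) (surfaceMeasure G) :=
    (hg.memLp_two v).integrable_mul z.memLp_trace
  simp only [sub_mul]
  have hA1 := integrable_inner_of_memLp_two h1 (memLp_const (ξ - ζ))
  have hA2 := integrable_inner_of_memLp_two h2 (memLp_const (ξ - ζ))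
  have hB1 := integrable_inner_of_memLp_two h1 z.memLp_grad
  have hB2 := integrable_inner_of_memLp_two h2 z.memLp_grad
  rw [integral_sub hi1 hi2, ← hw z, ← hw' z, inner_sub_left, inner_fluxOf ha, inner_fluxOf ha,
    ← integral_sub hA1 hA2, ← integral_sub hB1 hB2]
  refine Eq.trans ?_ (integral_add (hA1.sub hA2) (hB1.sub hB2))
  refine integral_congr_ae (ae_of_all _ fun y => ?_)
  simp only [hz, PerSobolev.linearComb, ← inner_sub_left]
  rw [← inner_add_right]
  congr 1
  module

/-- Energy estimate for the difference of two solutions. -/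
theorem exists_energy_estimate (hN : 2 ≤ N) (hG : IsHole G) (ha : IsFlux a)
    (hg : IsBoundaryLaw G g) :
    ∃ κ B K : ℝ, 0 < κ ∧ 0 ≤ B ∧ 0 < K ∧ ∀ (ξ ζ : Space N) (u v : ℝ) (w w' : PerSobolev G),
      IsCellSolution a g ξ u w → IsCellSolution a g ζ v w' →
      κ * gradDist ξ ζ w w' ^ 2 ≤ inner ℝ (fluxOf a ξ w - fluxOf a ζ w') (ξ - ζ) +
        B * |u - v| * gradDist ξ ζ w w' ∧
      ‖ξ - ζ‖ ≤ K * gradDist ξ ζ w w' := by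
  obtain ⟨κ, hκ, hmono⟩ := ha.exists_monotone (G := G)
  obtain ⟨K, hK, hK'⟩ := hG.exists_cellNorm_grad_le hN
  obtain ⟨C, hC0, hC⟩ := hG.exists_abs_integral_mul_trace_le (by omega)
  obtain ⟨L, hL0, hL, -⟩ := hg.exists_abs_deriv_le
  set S := ((surfaceMeasure G).real univ) ^ (1 / 2 : ℝ) with hS
  refine ⟨κ, C * (L * S) * K, K, hκ, by positivity, hK, fun ξ ζ u v w w' hw hw' => ?_⟩
  refine ⟨?_, (hK' (ξ - ζ) _).1⟩
  have h1 := hmono _ _ (w.memLp_const_add_grad ξ) (w'.memLp_const_add_grad ζ)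
  rw [IsCellSolution.integral_inner_sub ha hg hw hw'] at h1
  rw [gradDist_eq, cellNorm]
  refine h1.trans (add_le_add le_rfl ?_)
  have hgL : MemLp (fun y => g u y - g v y) 2 (surfaceMeasure G) :=
    (hg.memLp_two u).sub (hg.memLp_two v)
  have hg0 : ∫ y, (g u y - g v y) ∂(surfaceMeasure G) = 0 := by
    rw [integral_sub ((hg.memLp_two u).integrable one_le_two)
      ((hg.memLp_two v).integrable one_le_two), hg.mean_zero, hg.mean_zero, sub_zero]
  have hgn : (eLpNorm (fun y => g u y - g v y) 2 (surfaceMeasure G)).toReal ≤ L * |u - v| * S :=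
    toReal_eLpNorm_two_le (by positivity) (hL.mono fun y hy => hy u v)
  have h2 := hC _ hgL hg0 (PerSobolev.linearComb 1 (-1) w w')
  have h3 := (hK' (ξ - ζ) (PerSobolev.linearComb 1 (-1) w w')).2
  change _ ≤ K * gradDist ξ ζ w w' at h3
  rw [gradDist_eq] at h3
  calc _ ≤ _ := (le_abs_self _).trans h2
    _ ≤ C * (L * |u - v| * S) *
        (K * cellNorm G fun y => (ξ + w.grad y) - (ζ + w'.grad y)) := by
      gcongr
      exact h3
    _ = _ := by rw [cellNorm]; ring

/-- Otherwise Z > t ≥ 1, each term on the right is at most a constant times t Z (with Z + 1 ≤ 2Z,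
whence the second B), and division by Z gives a contradiction. -/
theorem le_of_quadratic_le {c c₀ B D Z t x s : ℝ} (hc : 0 < c) (h0 : 0 ≤ c₀) (hB : 0 ≤ B)
    (hD : 0 ≤ D) (hZ : 0 ≤ Z) (ht : 1 ≤ t) (hx : 0 ≤ x) (hxt : x ≤ t) (hst : s ≤ t)
    (h : c * Z ^ 2 ≤ c₀ + B * (Z + 1) * x + D * s * Z) :
    Z ≤ ((c₀ + B + D + B) / c + 1) * t := by
  by_contra! hlt
  have hQ : 0 ≤ (c₀ + B + D + B) / c := by positivity
  have htZ : t < Z := lt_of_le_of_lt (by linarith [mul_nonneg hQ (zero_le_one.trans ht)]) hlt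
  have e2 : B * ((Z + 1) * x) ≤ B * ((Z + Z) * t) :=
    mul_le_mul_of_nonneg_left (mul_le_mul (by linarith) hxt hx (by linarith)) hB
  have e3 : D * Z * s ≤ D * Z * t := mul_le_mul_of_nonneg_left hst (mul_nonneg hD hZ)
  have e4 : c₀ * 1 ≤ c₀ * (t * Z) :=
    mul_le_mul_of_nonneg_left (one_le_mul_of_one_le_of_one_le ht (ht.trans htZ.le)) h0
  have e5 : c * Z * Z ≤ (c₀ + B + D + B) * t * Z := by
    linear_combination h + e2 + e3 + e4
  have e6 := le_of_mul_le_mul_right e5 (by linarith)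
  have e7 : c * (((c₀ + B + D + B) / c + 1) * t) < c * Z := mul_lt_mul_of_pos_left hlt hc
  have e8 : c * (((c₀ + B + D + B) / c + 1) * t) = (c₀ + B + D + B) * t + c * t := by
    field_simp
  have e9 : 0 < c * t := mul_pos hc (by linarith)
  linarith

/-- Completing the square, half of c Z² absorbs the term linear in Z; the other half controls x
through x ≤ K Z. -/
theorem sub_le_of_quadratic_le {c c₀ D K I Z x s : ℝ} (hc : 0 < c) (h0 : 0 ≤ c₀) (hK : 0 < K)
    (hx : 0 ≤ x) (hxZ : x ≤ K * Z) (h : c * Z ^ 2 ≤ c₀ + I + D * (s + 1) * Z) :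
    c / 2 / K ^ 2 * x ^ 2 - (c₀ + D ^ 2 / c) * (s ^ 2 + 1) ≤ I := by
  have e1 : 0 ≤ c / 2 * (Z - D * (s + 1) / c) ^ 2 := by positivity
  have e : c / 2 * (Z - D * (s + 1) / c) ^ 2 =
      c / 2 * Z ^ 2 - D * (s + 1) * Z + D ^ 2 / c * ((s + 1) ^ 2 / 2) := by
    field_simp
    ring
  have e2 : D ^ 2 / c * ((s + 1) ^ 2 / 2) ≤ D ^ 2 / c * (s ^ 2 + 1) :=
    mul_le_mul_of_nonneg_left (by linarith [sq_nonneg (s - 1)]) (by positivity)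
  have e3 : c / 2 / K ^ 2 * x ^ 2 ≤ c / 2 / K ^ 2 * (K * Z) ^ 2 :=
    mul_le_mul_of_nonneg_left (pow_le_pow_left₀ hx hxZ 2) (by positivity)
  have e4 : c / 2 / K ^ 2 * (K * Z) ^ 2 = c / 2 * Z ^ 2 := by
    field_simp
  have e5 : 0 ≤ c₀ * s ^ 2 := mul_nonneg h0 (sq_nonneg s)
  linarith

/-- Pointwise coercivity bounds the self-tested energy from below, while the boundary term is at
most linear in the norm of the full gradient. -/
theorem exists_coercivity_estimate (hN : 2 ≤ N) (hG : IsHole G) (ha : IsFlux a)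
    (hg : IsBoundaryLaw G g) :
    ∃ c c₀ D : ℝ, 0 < c ∧ 0 ≤ c₀ ∧ 0 ≤ D ∧ ∀ (ξ : Space N) (u : ℝ) (w : PerSobolev G),
      IsCellSolution a g ξ u w →
      c * cellNorm G (fun y => ξ + w.grad y) ^ 2 ≤ c₀ + inner ℝ (fluxOf a ξ w) ξ +
        D * (|u| + 1) * cellNorm G (fun y => ξ + w.grad y) := by
  obtain ⟨C₁, C₂, h1, h2, hco⟩ := ha.coercive
  obtain ⟨C₅, C₆, h5, h6, hgr⟩ := hg.growth
  obtain ⟨K, hK, hK'⟩ := hG.exists_cellNorm_grad_le hN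
  obtain ⟨C, hC0, hC⟩ := hG.exists_abs_integral_mul_trace_le (by omega)
  refine ⟨C₂, C₁ * (cellMeasure G).real univ,
    C * ((C₅ + C₆) * ((surfaceMeasure G).real univ) ^ (1 / 2 : ℝ)) * K, h2, by positivity,
    by positivity, fun ξ u w hw => ?_⟩
  have hp := w.memLp_const_add_grad ξ
  have hen : C₂ * cellNorm G (fun y => ξ + w.grad y) ^ 2 - C₁ * (cellMeasure G).real univ ≤
      inner ℝ (fluxOf a ξ w) ξ + ∫ y, g u y * w.trace y ∂(surfaceMeasure G) := by
    rw [← hw.integral_inner_self ha, cellNorm, toReal_eLpNorm_two_sq hp]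
    have hi := hp.integrable_norm_pow two_ne_zero |>.const_mul C₂
    have e : C₂ * ∫ y, ‖ξ + w.grad y‖ ^ 2 ∂(cellMeasure G) - C₁ * (cellMeasure G).real univ =
        ∫ y, (C₂ * ‖ξ + w.grad y‖ ^ 2 - C₁) ∂(cellMeasure G) := by
      rw [integral_sub hi (integrable_const _), integral_const_mul, integral_const, smul_eq_mul,
        mul_comm C₁]
    rw [e]
    refine integral_mono_ae (hi.sub (integrable_const _))
      (integrable_inner_of_memLp_two (ha.memLp_comp hp) hp) ?_
    filter_upwards [ae_cellMeasure_of_ae_unitCube hco] with y hy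
    have := hy (ξ + w.grad y)
    linarith
  have hgn : (eLpNorm (g u) 2 (surfaceMeasure G)).toReal ≤
      (C₅ + C₆) * (|u| + 1) * ((surfaceMeasure G).real univ) ^ (1 / 2 : ℝ) := by
    refine toReal_eLpNorm_two_le (by positivity) (hgr.mono fun y hy => (hy u).trans ?_)
    linarith [mul_nonneg h6.le (abs_nonneg u)]
  have hbd : |∫ y, g u y * w.trace y ∂(surfaceMeasure G)| ≤
      C * ((C₅ + C₆) * (|u| + 1) * ((surfaceMeasure G).real univ) ^ (1 / 2 : ℝ)) *
        (K * cellNorm G (fun y => ξ + w.grad y)) :=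
    (hC _ (hg.memLp_two u) (hg.mean_zero u) w).trans <|
      mul_le_mul (mul_le_mul_of_nonneg_left hgn hC0) (hK' ξ w).2 ENNReal.toReal_nonneg
        (by positivity)
  linear_combination hen + (le_abs_self _).trans hbd

/-- A priori estimates for a solution. -/
theorem exists_apriori_estimate (hN : 2 ≤ N) (hG : IsHole G) (ha : IsFlux a)
    (hg : IsBoundaryLaw G g) :
    ∃ γ A : ℝ, 0 < γ ∧ 0 ≤ A ∧ ∀ (ξ : Space N) (u : ℝ) (w : PerSobolev G),
      IsCellSolution a g ξ u w →
      γ * ‖ξ‖ ^ 2 - A * (|u| ^ 2 + 1) ≤ inner ℝ (fluxOf a ξ w) ξ ∧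
      ‖fluxOf a ξ w‖ ≤ A * (‖ξ‖ + |u| + 1) ∧
      cellNorm G w.grad ≤ A * (‖ξ‖ + |u| + 1) := by
  obtain ⟨K, hK, hK'⟩ := hG.exists_cellNorm_grad_le hN
  obtain ⟨B, hB, hflux⟩ := exists_norm_fluxOf_le (G := G) ha
  obtain ⟨c, c₀, D, hc, h0, hD, hco⟩ := exists_coercivity_estimate hN hG ha hg
  obtain ⟨P, hP, hP1⟩ : ∃ P, P = (c₀ + B + D + B) / c + 1 ∧ 0 ≤ P :=
    ⟨_, rfl, by positivity⟩
  -- The three summands of the second constant serve the coercivity, flux and gradient bounds, in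
  -- this order.
  refine ⟨c / 2 / K ^ 2, (c₀ + D ^ 2 / c) + B * (P + 1) + K * P, by positivity, by positivity,
    fun ξ u w hw => ?_⟩
  have hZ0 := cellNorm_nonneg (G := G) (fun y => ξ + w.grad y)
  have hen := hco ξ u w hw
  obtain ⟨hξ, hgw⟩ := hK' ξ w
  have hfl := hflux ξ w
  generalize cellNorm G (fun y => ξ + w.grad y) = Z at *
  -- Inserting the flux bound into the coercivity estimate closes the inequality for Z, so that Z ≤
  -- P t below.
  have hin : inner ℝ (fluxOf a ξ w) ξ ≤ B * (Z + 1) * ‖ξ‖ :=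
    (real_inner_le_norm _ _).trans (mul_le_mul_of_nonneg_right hfl (norm_nonneg _))
  have hu0 := abs_nonneg u
  have hξ0 := norm_nonneg ξ
  have hQ : 0 ≤ c₀ + D ^ 2 / c := by positivity
  have hsub := sub_le_of_quadratic_le hc h0 hK hξ0 hξ hen
  obtain ⟨t, ht⟩ : ∃ t, t = ‖ξ‖ + |u| + 1 := ⟨_, rfl⟩
  have hZt : Z ≤ P * t := by
    rw [hP]
    exact le_of_quadratic_le hc h0 hB hD hZ0 (x := ‖ξ‖) (s := |u| + 1) (by linarith) hξ0
      (by linarith) (by linarith) (by linarith)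
  rw [← ht]
  have ht1 : 1 ≤ t := by linarith
  have e1 : B * Z ≤ B * (P * t) := mul_le_mul_of_nonneg_left hZt hB
  have e2 : K * Z ≤ K * (P * t) := mul_le_mul_of_nonneg_left hZt hK.le
  have e3 : B * 1 ≤ B * t := mul_le_mul_of_nonneg_left ht1 hB
  have e4 : 0 ≤ (c₀ + D ^ 2 / c) * t := by positivity
  have e5 : 0 ≤ B * (P + 1) * t := by positivity
  have e6 : 0 ≤ K * P * t := by positivity
  have e7 : 0 ≤ (B * (P + 1) + K * P) * (|u| ^ 2 + 1) := by positivity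
  refine ⟨?_, ?_, ?_⟩
  · linear_combination hsub + e7
  · linear_combination hfl + e1 + e3 + e4 + e6
  · linear_combination hgw + e2 + e4 + e5

/-- Estimates for `b*` in terms of the solution. -/
theorem exists_couplingOf_estimate (hN : 2 ≤ N) (hG : IsHole G) (hg : IsBoundaryLaw G g) :
    ∃ B : ℝ, 0 ≤ B ∧ (∀ (u : ℝ) (w : PerSobolev G),
        |couplingOf g u w| ≤ B * cellNorm G w.grad) ∧
      ∀ (ξ ζ : Space N) (u v : ℝ) (w w' : PerSobolev G),
        |couplingOf g u w - couplingOf g v w'| ≤ B * gradDist ξ ζ w w' +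
          B * (|u - v| / (1 + |u - v|)) * cellNorm G w.grad := by
  obtain ⟨K, hK, hK'⟩ := hG.exists_cellNorm_grad_le hN
  obtain ⟨C, hC0, hC⟩ := hG.exists_abs_integral_mul_trace_le (by omega)
  obtain ⟨L, hL0, -, hL⟩ := hg.exists_abs_deriv_le
  obtain ⟨C₈, h8, hd⟩ := hg.deriv_lipschitz
  set S := ((surfaceMeasure G).real univ) ^ (1 / 2 : ℝ) with hS
  have hS0 : 0 ≤ S := by positivity
  have hbase : ∀ (u : ℝ) (w : PerSobolev G),
      |couplingOf g u w| ≤ C * (L * S) * cellNorm G w.grad := by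
    intro u w
    refine (hC _ (hg.memLp_deriv u) (hg.integral_deriv_eq_zero u) w).trans ?_
    gcongr
    · exact toReal_eLpNorm_two_le hL0.le (hL.mono fun y hy => hy u)
    · exact le_rfl
  refine ⟨C * (L * S) + C * (L * S) * K + C * (C₈ * S), by positivity, fun u w => ?_,
    fun ξ ζ u v w w' => ?_⟩
  · refine (hbase u w).trans (mul_le_mul_of_nonneg_right ?_ (cellNorm_nonneg _))
    have : 0 ≤ C * (L * S) * K + C * (C₈ * S) := by positivity
    linarith
  -- The difference splits into a change of solution with v frozen and a change of g'_u with w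
  -- frozen; only w enters the weighted term.
  · have e : couplingOf g u w - couplingOf g v w' =
        couplingOf g v (PerSobolev.linearComb 1 (-1) w w') +
          ∫ y, (deriv (fun s => g s y) u - deriv (fun s => g s y) v) * w.trace y
            ∂(surfaceMeasure G) := by
      have hi1 : Integrable (fun y => deriv (fun s => g s y) u * w.trace y) (surfaceMeasure G) :=
        (hg.memLp_deriv u).integrable_mul w.memLp_trace
      have hi2 : Integrable (fun y => deriv (fun s => g s y) v * w.trace y) (surfaceMeasure G) :=
        (hg.memLp_deriv v).integrable_mul w.memLp_trace
      simp only [sub_mul]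
      rw [integral_sub hi1 hi2, couplingOf, couplingOf, couplingOf,
        integral_mul_linearComb (hg.memLp_deriv v)]
      ring
    have hm : MemLp (fun y => deriv (fun s => g s y) u - deriv (fun s => g s y) v) 2
        (surfaceMeasure G) := (hg.memLp_deriv u).sub (hg.memLp_deriv v)
    have hm0 : ∫ y, (deriv (fun s => g s y) u - deriv (fun s => g s y) v) ∂(surfaceMeasure G) =
        0 := by
      rw [integral_sub ((hg.memLp_deriv u).integrable one_le_two)
        ((hg.memLp_deriv v).integrable one_le_two), hg.integral_deriv_eq_zero,
        hg.integral_deriv_eq_zero, sub_zero]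
    have hn : (eLpNorm (fun y => deriv (fun s => g s y) u - deriv (fun s => g s y) v) 2
        (surfaceMeasure G)).toReal ≤ C₈ * (|u - v| / (1 + |u - v|)) * S := by
      refine toReal_eLpNorm_two_le (by positivity) (hd.mono fun y hy => (hy u v).trans ?_)
      rw [mul_assoc, ← div_eq_mul_inv]
      -- By |u - v| ≤ |u| + |v| the weight (1 + |u| + |v|)⁻¹ is at most (1 + |u - v|)⁻¹.
      have := abs_sub u v
      exact mul_le_mul_of_nonneg_left (div_le_div_of_nonneg_left (abs_nonneg _) (by positivity)
        (by linarith)) h8.le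
    have h1 := hC _ hm hm0 w
    have h2 := (hbase v (PerSobolev.linearComb 1 (-1) w w')).trans
      (mul_le_mul_of_nonneg_left (hK' (ξ - ζ) _).2 (by positivity))
    change _ ≤ C * (L * S) * (K * gradDist ξ ζ w w') at h2
    have h3 : C * (eLpNorm (fun y => deriv (fun s => g s y) u - deriv (fun s => g s y) v) 2
        (surfaceMeasure G)).toReal * cellNorm G w.grad ≤
        C * (C₈ * (|u - v| / (1 + |u - v|)) * S) * cellNorm G w.grad := by
      gcongr
      exact cellNorm_nonneg _
    have hX : 0 ≤ gradDist ξ ζ w w' := cellNorm_nonneg _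
    have hW : 0 ≤ cellNorm G w.grad := cellNorm_nonneg _
    rw [e]
    refine (abs_add_le _ _).trans (add_le_add (h2.trans ?_) ((h1.trans h3).trans ?_))
    · have : 0 ≤ (C * (L * S) + C * (C₈ * S)) * gradDist ξ ζ w w' := by positivity
      nlinarith
    · have : 0 ≤ (C * (L * S) + C * (L * S) * K) * (|u - v| / (1 + |u - v|)) *
          cellNorm G w.grad := by positivity
      nlinarith

end Estimates

/-! ### Continuity of the flux and uniqueness up to constants -/

section Continuity

variable {N : ℕ} {G : Set (Space N)} {a : Space N → Space N → Space N} {g : ℝ → Space N → ℝ}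

/-- Continuity of the Nemytskii operator of `a` from `L²(Y*)` to `L¹(Y*)`, integrated. -/
theorem IsFlux.tendsto_integral_comp (ha : IsFlux a) {p : ℕ → Space N → Space N}
    {q : Space N → Space N} (hp : ∀ n, MemLp (p n) 2 (cellMeasure G))
    (hq : MemLp q 2 (cellMeasure G))
    (h : Tendsto (fun n => cellNorm G fun y => p n y - q y) atTop (𝓝 0)) :
    Tendsto (fun n => ∫ y, a (p n y) y ∂(cellMeasure G)) atTop
      (𝓝 (∫ y, a (q y) y ∂(cellMeasure G))) := by
  obtain ⟨C₃, C₄, h3, h4, hgr⟩ := ha.growth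
  -- It suffices to find, in every subsequence, a further one along which the integrals converge;
  -- almost everywhere convergence of p n is then available.
  refine tendsto_of_subseq_tendsto fun ns hns => ?_
  have hpq : ∀ n, MemLp (fun y => p n y - q y) 2 (cellMeasure G) := fun n => (hp n).sub hq
  have h' := h.comp hns
  have hmeas : TendstoInMeasure (cellMeasure G) (fun n => p (ns n)) atTop q := by
    refine tendstoInMeasure_of_tendsto_eLpNorm two_ne_zero (fun n => (hp _).1) hq.1 ?_
    exact (ENNReal.tendsto_toReal_iff (fun n => (hpq (ns n)).2.ne) ENNReal.zero_ne_top).1 h'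
  obtain ⟨ms, hms, hae⟩ := hmeas.exists_seq_tendsto_ae
  refine ⟨ms, ?_⟩
  have h'' := h'.comp hms.tendsto_atTop
  set P : ℕ → Space N → Space N := fun n => p (ns (ms n)) with hP
  have hPm : ∀ n, MemLp (P n) 2 (cellMeasure G) := fun n => hp _
  have hai : ∀ n, Integrable (fun y => a (P n y) y) (cellMeasure G) := fun n =>
    (ha.memLp_comp (hPm n)).integrable one_le_two
  have hqi : Integrable (fun y => a (q y) y) (cellMeasure G) :=
    (ha.memLp_comp hq).integrable one_le_two
  -- Linear growth gives ‖a(P) - a(q)‖ ≤ C₃‖P - q‖ + H, hence ‖a(P) - a(q)‖ ≤ C₃‖P - q‖ + min(‖a(P)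
  -- - a(q)‖, H). The first term vanishes in L¹, the second by dominated convergence.
  let H : Space N → ℝ := fun y => 2 * C₃ * ‖q y‖ + 2 * C₄
  have hH : Integrable H (cellMeasure G) :=
    ((hq.norm.integrable one_le_two).const_mul _).add (integrable_const _)
  have hφm : ∀ n, AEStronglyMeasurable (fun y => min ‖a (P n y) y - a (q y) y‖ (H y))
      (cellMeasure G) := fun n => ((hai n).sub hqi).1.norm.inf hH.1
  have hφb : ∀ n, ∀ᵐ y ∂(cellMeasure G), ‖min ‖a (P n y) y - a (q y) y‖ (H y)‖ ≤ H y := fun n =>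
    ae_of_all _ fun y => by
      have : 0 ≤ H y := by positivity
      rw [Real.norm_of_nonneg (le_min (norm_nonneg _) this)]
      exact min_le_right _ _
  have hφ : Tendsto (fun n => ∫ y, min ‖a (P n y) y - a (q y) y‖ (H y) ∂(cellMeasure G)) atTop
      (𝓝 (∫ _, (0 : ℝ) ∂(cellMeasure G))) := by
    refine tendsto_integral_of_dominated_convergence H hφm hH hφb ?_
    filter_upwards [hae, ae_cellMeasure_of_ae_unitCube ha.continuous_ae] with y hy hc
    have h1 : Tendsto (fun n => a (P n y) y) atTop (𝓝 (a (q y) y)) := (hc.tendsto _).comp hy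
    have h2 := ((h1.sub_const (a (q y) y)).norm).min (tendsto_const_nhds (x := H y))
    rwa [sub_self, norm_zero, min_eq_left (show 0 ≤ H y by positivity)] at h2
  rw [integral_zero] at hφ
  have hψ : Tendsto (fun n => C₃ * (((cellMeasure G).real univ) ^ (1 / 2 : ℝ) *
      cellNorm G fun y => P n y - q y) +
      ∫ y, min ‖a (P n y) y - a (q y) y‖ (H y) ∂(cellMeasure G)) atTop (𝓝 0) := by
    have := (((h''.const_mul (((cellMeasure G).real univ) ^ (1 / 2 : ℝ))).const_mul C₃)).add hφ
    simpa using this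
  rw [tendsto_iff_norm_sub_tendsto_zero]
  refine squeeze_zero (fun n => norm_nonneg _) (fun n => ?_) hψ
  rw [← integral_sub (hai n) hqi]
  have hd : Integrable (fun y => ‖P n y - q y‖) (cellMeasure G) :=
    (hpq (ns (ms n))).norm.integrable one_le_two
  have hφi : Integrable (fun y => min ‖a (P n y) y - a (q y) y‖ (H y)) (cellMeasure G) :=
    hH.mono' (hφm n) (hφb n)
  refine (norm_integral_le_of_norm_le ((hd.const_mul C₃).add hφi) ?_).trans ?_
  · filter_upwards [ae_cellMeasure_of_ae_unitCube hgr] with y hy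
    rcases le_total ‖a (P n y) y - a (q y) y‖ (H y) with hle | hle
    · simp only [Pi.add_apply, min_eq_left hle]
      exact le_add_of_nonneg_left (by positivity)
    · simp only [Pi.add_apply, min_eq_right hle]
      have e1 := norm_sub_le (a (P n y) y) (a (q y) y)
      have e2 : C₃ * ‖P n y‖ ≤ C₃ * (‖P n y - q y‖ + ‖q y‖) :=
        mul_le_mul_of_nonneg_left (norm_le_norm_sub_add _ _) h3.le
      have e3 := hy (P n y)
      have e4 := hy (q y)
      change _ ≤ C₃ * ‖P n y - q y‖ + (2 * C₃ * ‖q y‖ + 2 * C₄)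
      linarith
  · rw [integral_add' (hd.const_mul C₃) hφi, integral_const_mul]
    exact add_le_add (mul_le_mul_of_nonneg_left (integral_norm_le_cellNorm (hpq _)) h3.le) le_rfl

theorem IsFlux.tendsto_fluxOf (ha : IsFlux a) {ξ : ℕ → Space N} {w : ℕ → PerSobolev G}
    {ζ : Space N} {w' : PerSobolev G}
    (h : Tendsto (fun n => gradDist (ξ n) ζ (w n) w') atTop (𝓝 0)) :
    Tendsto (fun n => fluxOf a (ξ n) (w n)) atTop (𝓝 (fluxOf a ζ w')) := by
  simp only [gradDist_eq] at h
  exact ha.tendsto_integral_comp (fun n => (w n).memLp_const_add_grad _)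
    (w'.memLp_const_add_grad _) h

theorem gradDist_comm (ξ ζ : Space N) (w w' : PerSobolev G) :
    gradDist ξ ζ w w' = gradDist ζ ξ w' w := by
  rw [gradDist_eq, gradDist_eq, cellNorm, cellNorm]
  exact congrArg _ (eLpNorm_sub_comm (fun y => ξ + w.grad y) (fun y => ζ + w'.grad y) _ _)

theorem gradDist_nonneg (ξ ζ : Space N) (w w' : PerSobolev G) : 0 ≤ gradDist ξ ζ w w' :=
  cellNorm_nonneg _

theorem ae_eq_grad_of_gradDist_eq_zero {ξ : Space N} {w w' : PerSobolev G}
    (h : gradDist ξ ξ w w' = 0) : w.grad =ᵐ[cellMeasure G] w'.grad := by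
  rw [gradDist_eq, cellNorm, ENNReal.toReal_eq_zero_iff] at h
  have hm : MemLp (fun y => (ξ + w.grad y) - (ξ + w'.grad y)) 2 (cellMeasure G) :=
    (w.memLp_const_add_grad ξ).sub (w'.memLp_const_add_grad ξ)
  have h0 := (eLpNorm_eq_zero_iff hm.1 two_ne_zero).1 (h.resolve_right hm.2.ne)
  filter_upwards [h0] with y hy
  simpa [sub_eq_zero] using hy

theorem IsHole.exists_val_eq_add_const (hG : IsHole G) (hN : 1 ≤ N) {w w' : PerSobolev G}
    (h : w.grad =ᵐ[cellMeasure G] w'.grad) :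
    ∃ c : ℝ, ∀ᵐ y ∂(cellMeasure G), w'.val y = w.val y + c := by
  obtain ⟨C, hC⟩ := hG.exists_poincare_trace_perSobolev hN
  obtain ⟨c, hc, -⟩ := hC (PerSobolev.linearComb 1 (-1) w' w)
  have h0 : (PerSobolev.linearComb 1 (-1) w' w).grad =ᵐ[cellMeasure G] 0 := by
    filter_upwards [h] with y hy
    simp [PerSobolev.linearComb, hy]
  rw [eLpNorm_congr_ae h0, eLpNorm_zero, mul_zero, nonpos_iff_eq_zero] at hc
  refine ⟨c, ?_⟩
  filter_upwards [(eLpNorm_eq_zero_iff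
    ((PerSobolev.linearComb 1 (-1) w' w).memLp_val.1.sub aestronglyMeasurable_const)
    two_ne_zero).1 hc] with y hy
  simp only [PerSobolev.linearComb, Pi.zero_apply, Pi.sub_apply, smul_eq_mul] at hy
  linarith

end Continuity

/-! ### The effective coefficients -/

section Effective

variable {N : ℕ} {G : Set (Space N)} {a : Space N → Space N → Space N} {g : ℝ → Space N → ℝ}

/-- Energy estimate with the boundary term absorbed. -/
theorem exists_energy_estimate_sq (hN : 2 ≤ N) (hG : IsHole G) (ha : IsFlux a)
    (hg : IsBoundaryLaw G g) :
    ∃ κ R K : ℝ, 0 < κ ∧ 0 ≤ R ∧ 0 < K ∧ ∀ (ξ ζ : Space N) (u v : ℝ) (w w' : PerSobolev G),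
      IsCellSolution a g ξ u w → IsCellSolution a g ζ v w' →
      κ * gradDist ξ ζ w w' ^ 2 ≤
        inner ℝ (fluxOf a ξ w - fluxOf a ζ w') (ξ - ζ) + R * (u - v) ^ 2 ∧
      ‖ξ - ζ‖ ≤ K * gradDist ξ ζ w w' := by
  have := hG.isFiniteMeasure_surfaceMeasure (by omega)
  obtain ⟨κ, B, K, hκ, hB, hK, h⟩ := exists_energy_estimate hN hG ha hg
  refine ⟨κ / 2, B ^ 2 / (2 * κ), K, by positivity, by positivity, hK,
    fun ξ ζ u v w w' hw hw' => ⟨?_, (h ξ ζ u v w w' hw hw').2⟩⟩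
  have h1 := (h ξ ζ u v w w' hw hw').1
  generalize gradDist ξ ζ w w' = X at h1 ⊢
  rw [← sq_abs (u - v)]
  -- Half of κX² absorbs the boundary term, which fixes the constant B²/(2κ).
  have e : 0 ≤ κ / 2 * (X - B * |u - v| / κ) ^ 2 := by positivity
  have e' : κ / 2 * (X - B * |u - v| / κ) ^ 2 =
      κ / 2 * X ^ 2 - B * |u - v| * X + B ^ 2 / (2 * κ) * |u - v| ^ 2 := by
    field_simp
    ring
  linarith

theorem IsCellSolution.ae_eq_grad (hN : 2 ≤ N) (hG : IsHole G) (ha : IsFlux a)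
    (hg : IsBoundaryLaw G g) {ξ : Space N} {u : ℝ} {w w' : PerSobolev G}
    (hw : IsCellSolution a g ξ u w) (hw' : IsCellSolution a g ξ u w') :
    w.grad =ᵐ[cellMeasure G] w'.grad := by
  obtain ⟨κ, R, K, hκ, -, -, h⟩ := exists_energy_estimate_sq hN hG ha hg
  have h1 := (h ξ ξ u u w w' hw hw').1
  rw [sub_self, sub_self, inner_zero_right, zero_pow two_ne_zero, mul_zero, add_zero] at h1
  refine ae_eq_grad_of_gradDist_eq_zero (ξ := ξ) ?_
  by_contra hne
  have : 0 < κ * gradDist ξ ξ w w' ^ 2 := by positivity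
  linarith

theorem fluxOf_congr {ξ : Space N} {w w' : PerSobolev G}
    (h : w.grad =ᵐ[cellMeasure G] w'.grad) : fluxOf a ξ w = fluxOf a ξ w' := by
  refine integral_congr_ae ?_
  filter_upwards [h] with y hy
  rw [hy]

theorem IsCellSolution.aStar_eq (hN : 2 ≤ N) (hG : IsHole G) (ha : IsFlux a)
    (hg : IsBoundaryLaw G g) {ξ : Space N} {u : ℝ} {w : PerSobolev G}
    (hw : IsCellSolution a g ξ u w) : aStar a G g ξ u = fluxOf a ξ w := by
  have h : ∃ w : PerSobolev G, IsCellSolution a g ξ u w := ⟨w, hw⟩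
  rw [aStar, dif_pos h]
  exact fluxOf_congr (h.choose_spec.ae_eq_grad hN hG ha hg hw)

theorem IsCellSolution.bStar_eq (hN : 2 ≤ N) (hG : IsHole G) (ha : IsFlux a)
    (hg : IsBoundaryLaw G g) {ξ : Space N} {u : ℝ} {w : PerSobolev G}
    (hw : IsCellSolution a g ξ u w) : bStar a G g ξ u = couplingOf g u w := by
  have := hG.isFiniteMeasure_surfaceMeasure (by omega)
  have h : ∃ w : PerSobolev G, IsCellSolution a g ξ u w := ⟨w, hw⟩
  rw [bStar, dif_pos h]
  exact hG.integral_mul_trace_congr (by omega) (hg.memLp_deriv u) (hg.integral_deriv_eq_zero u)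
    (h.choose_spec.ae_eq_grad hN hG ha hg hw)

/-- The gradients of solutions depend continuously on `(ξ, u)` in `L²(Y*)`. -/
theorem tendsto_gradDist (hN : 2 ≤ N) (hG : IsHole G) (ha : IsFlux a) (hg : IsBoundaryLaw G g)
    {W : Space N × ℝ → PerSobolev G} (hW : ∀ p, IsCellSolution a g p.1 p.2 (W p))
    (q : Space N × ℝ) :
    Tendsto (fun p : Space N × ℝ => gradDist p.1 q.1 (W p) (W q)) (𝓝 q) (𝓝 0) := by
  have := hG.isFiniteMeasure_surfaceMeasure (by omega)
  obtain ⟨κ, R, K, hκ, hR, -, h⟩ := exists_energy_estimate_sq hN hG ha hg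
  obtain ⟨γ, A, -, hA, hap⟩ := exists_apriori_estimate hN hG ha hg
  -- The a priori flux bound makes the right side of the energy estimate a continuous function of p
  -- that vanishes at q.
  have hc : Continuous fun p : Space N × ℝ => √(((A * (‖p.1‖ + |p.2| + 1) +
      ‖fluxOf a q.1 (W q)‖) * ‖p.1 - q.1‖ + R * (p.2 - q.2) ^ 2) / κ) := by fun_prop
  have h0 := hc.tendsto q
  simp only [sub_self, norm_zero, mul_zero, zero_pow two_ne_zero, add_zero, zero_div,
    Real.sqrt_zero] at h0
  refine squeeze_zero (fun p => gradDist_nonneg _ _ _ _) (fun p => ?_) h0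
  refine Real.le_sqrt_of_sq_le ?_
  rw [le_div_iff₀ hκ, mul_comm]
  refine (h p.1 q.1 p.2 q.2 (W p) (W q) (hW p) (hW q)).1.trans (add_le_add ?_ le_rfl)
  refine (real_inner_le_norm _ _).trans (mul_le_mul_of_nonneg_right ?_ (norm_nonneg _))
  exact (norm_sub_le _ _).trans (add_le_add (hap _ _ _ (hW p)).2.1 le_rfl)

theorem continuous_fluxOf (hN : 2 ≤ N) (hG : IsHole G) (ha : IsFlux a) (hg : IsBoundaryLaw G g)
    {W : Space N × ℝ → PerSobolev G} (hW : ∀ p, IsCellSolution a g p.1 p.2 (W p)) :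
    Continuous fun p : Space N × ℝ => fluxOf a p.1 (W p) := by
  refine continuous_iff_continuousAt.2 fun q => tendsto_of_seq_tendsto fun p hp => ?_
  exact ha.tendsto_fluxOf ((tendsto_gradDist hN hG ha hg hW q).comp hp)

theorem continuous_couplingOf (hN : 2 ≤ N) (hG : IsHole G) (ha : IsFlux a)
    (hg : IsBoundaryLaw G g) {W : Space N × ℝ → PerSobolev G}
    (hW : ∀ p, IsCellSolution a g p.1 p.2 (W p)) :
    Continuous fun p : Space N × ℝ => couplingOf g p.2 (W p) := by
  have := hG.isFiniteMeasure_surfaceMeasure (by omega)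
  obtain ⟨B, hB, -, h⟩ := exists_couplingOf_estimate hN hG hg
  refine continuous_iff_continuousAt.2 fun q => ?_
  have hc : Continuous fun p : Space N × ℝ => B * (|q.2 - p.2| / (1 + |q.2 - p.2|)) *
      cellNorm G (W q).grad := by
    refine Continuous.mul_const (continuous_const.mul (Continuous.div (by fun_prop)
      (by fun_prop) fun p => by positivity)) _
  have h0 := ((tendsto_gradDist hN hG ha hg hW q).const_mul B).add (hc.tendsto q)
  simp only [sub_self, abs_zero, zero_div, mul_zero, zero_mul, add_zero] at h0
  refine tendsto_iff_norm_sub_tendsto_zero.2 (squeeze_zero (fun p => norm_nonneg _)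
    (fun p => ?_) h0)
  -- The roles are exchanged so that the weighted term contains the gradient of the fixed solution
  -- `W q`.
  rw [norm_sub_rev, gradDist_comm]
  exact h q.1 p.1 q.2 p.2 (W q) (W p)

/-- With δ = |u - v|, Young's inequality gives B X δ ≤ κX²/4 + B²δ²/κ, and a quarter of the energy
inequality bounds κX²/4; this is the origin of the factor 1/4. The other term keeps its weight δ²/(1
+ δ). -/
theorem mul_sub_le_of_energy {κ R A B I X W t β u v : ℝ} (hκ : 0 < κ) (hB : 0 ≤ B)
    (hW : W ≤ A * t) (hβ : |β| ≤ B * X + B * (|u - v| / (1 + |u - v|)) * W)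
    (hI : κ * X ^ 2 ≤ I + R * (u - v) ^ 2) :
    β * (v - u) ≤ 1 / 4 * I + (R / 4 + B ^ 2 / κ) * |u - v| ^ 2 +
      B * A * (|u - v| ^ 2 * t / (1 + |u - v|)) := by
  rw [← sq_abs (u - v)] at hI
  have e0 : β * (v - u) ≤ |β| * |u - v| := by
    rw [abs_sub_comm, ← abs_mul]
    exact le_abs_self _
  have hδ := abs_nonneg (u - v)
  generalize |u - v| = δ at *
  have e1 := mul_le_mul_of_nonneg_right hβ hδ
  have e2 : B * (δ / (1 + δ)) * δ * W ≤ B * (δ / (1 + δ)) * δ * (A * t) :=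
    mul_le_mul_of_nonneg_left hW (by positivity)
  have e3 : B * (δ / (1 + δ)) * δ * (A * t) = B * A * (δ ^ 2 * t / (1 + δ)) := by ring
  have e4 : 0 ≤ κ / 4 * (X - 2 * B * δ / κ) ^ 2 := by positivity
  have e5 : κ / 4 * (X - 2 * B * δ / κ) ^ 2 = κ / 4 * X ^ 2 - B * X * δ + B ^ 2 / κ * δ ^ 2 := by
    field_simp
    ring
  linarith

end Effective

end PerforatedCell

/-! ### The main theorem -/

theorem mainTheorem7 {N : ℕ} (hN : 2 ≤ N) (G : Set (PerforatedCell.Space N))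
    (hG : PerforatedCell.IsHole G)
    (a : PerforatedCell.Space N → PerforatedCell.Space N → PerforatedCell.Space N)
    (ha : PerforatedCell.IsFlux a)
    (g : ℝ → PerforatedCell.Space N → ℝ) (hg : PerforatedCell.IsBoundaryLaw G g) :
    (∀ ξ u, ∃ w : PerforatedCell.PerSobolev G, PerforatedCell.IsCellSolution a g ξ u w ∧
      ∀ w' : PerforatedCell.PerSobolev G, PerforatedCell.IsCellSolution a g ξ u w' →
        ∃ c : ℝ, ∀ᵐ y ∂(PerforatedCell.cellMeasure G), w'.val y = w.val y + c) ∧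
    (∀ ξ u, ∀ w : PerforatedCell.PerSobolev G, PerforatedCell.IsCellSolution a g ξ u w →
      PerforatedCell.aStar a G g ξ u = PerforatedCell.fluxOf a ξ w ∧
      PerforatedCell.bStar a G g ξ u = PerforatedCell.couplingOf g u w) ∧
    Continuous (fun p : PerforatedCell.Space N × ℝ => PerforatedCell.aStar a G g p.1 p.2) ∧
    Continuous (fun p : PerforatedCell.Space N × ℝ => PerforatedCell.bStar a G g p.1 p.2) ∧
    ∃ γ α r C : ℝ, 0 < γ ∧ 0 < α ∧ 0 < r ∧
      (∀ ξ u, γ * ‖ξ‖ ^ 2 - C * (|u| ^ 2 + 1) ≤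
        inner ℝ (PerforatedCell.aStar a G g ξ u) ξ) ∧
      (∀ ξ u, ‖PerforatedCell.aStar a G g ξ u‖ ≤ C * (‖ξ‖ + |u| + 1)) ∧
      (∀ ξ ζ u v, α * ‖ξ - ζ‖ ^ 2 - r * (u - v) ^ 2 ≤
        inner ℝ (PerforatedCell.aStar a G g ξ u - PerforatedCell.aStar a G g ζ v) (ξ - ζ)) ∧
      (∀ ξ u, |PerforatedCell.bStar a G g ξ u| ≤ C * (‖ξ‖ + |u| + 1)) ∧
      (∀ ξ ζ u v,
        (PerforatedCell.bStar a G g ξ u - PerforatedCell.bStar a G g ζ v) * (v - u) ≤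
          1 / 4 * inner ℝ (PerforatedCell.aStar a G g ξ u - PerforatedCell.aStar a G g ζ v)
            (ξ - ζ) +
          C * (|u - v| ^ 2 + |u - v| ^ 2 * (‖ξ‖ + |u| + 1) / (1 + |u - v|))) := by
  have hN1 : 1 ≤ N := by omega
  have := hG.isFiniteMeasure_surfaceMeasure hN1
  choose W hW using fun p : PerforatedCell.Space N × ℝ =>
    PerforatedCell.exists_isCellSolution hN1 hG ha hg p.1 p.2
  have hA : ∀ ξ u, PerforatedCell.aStar a G g ξ u = PerforatedCell.fluxOf a ξ (W (ξ, u)) :=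
    fun ξ u => (hW (ξ, u)).aStar_eq hN hG ha hg
  have hB : ∀ ξ u, PerforatedCell.bStar a G g ξ u = PerforatedCell.couplingOf g u (W (ξ, u)) :=
    fun ξ u => (hW (ξ, u)).bStar_eq hN hG ha hg
  refine ⟨fun ξ u => ⟨W (ξ, u), hW (ξ, u), fun w' hw' => ?_⟩,
    fun ξ u w hw => ⟨hw.aStar_eq hN hG ha hg, hw.bStar_eq hN hG ha hg⟩, ?_, ?_, ?_⟩
  · exact hG.exists_val_eq_add_const hN1 ((hW (ξ, u)).ae_eq_grad hN hG ha hg hw')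
  · simp only [hA]
    exact PerforatedCell.continuous_fluxOf hN hG ha hg hW
  · simp only [hB]
    exact PerforatedCell.continuous_couplingOf hN hG ha hg hW
  obtain ⟨κ, R, K, hκ, hR, hK, hen⟩ := PerforatedCell.exists_energy_estimate_sq hN hG ha hg
  obtain ⟨γ, A, hγ, hA0, hap⟩ := PerforatedCell.exists_apriori_estimate hN hG ha hg
  obtain ⟨B, hB0, hb, hbb⟩ := PerforatedCell.exists_couplingOf_estimate hN hG hg
  have h1 : 0 ≤ B * A := by positivity
  have h2 : 0 ≤ R / 4 + B ^ 2 / κ := by positivity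
  -- The value α = κ/K² comes from ‖ξ - ζ‖ ≤ K X, and R + 1 is used because only R ≥ 0 is known. The
  -- last constant is the sum of those needed separately, so each bound discards a nonnegative
  -- surplus.
  refine ⟨γ, κ / K ^ 2, R + 1, A + B * A + (R / 4 + B ^ 2 / κ), hγ, by positivity, by positivity,
    fun ξ u => ?_, fun ξ u => ?_, fun ξ ζ u v => ?_, fun ξ u => ?_, fun ξ ζ u v => ?_⟩
  · rw [hA]
    have e : 0 ≤ (B * A + (R / 4 + B ^ 2 / κ)) * (|u| ^ 2 + 1) := by positivity
    linear_combination (hap ξ u _ (hW (ξ, u))).1 + e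
  · rw [hA]
    have e : 0 ≤ (B * A + (R / 4 + B ^ 2 / κ)) * (‖ξ‖ + |u| + 1) := by positivity
    linear_combination (hap ξ u _ (hW (ξ, u))).2.1 + e
  · rw [hA, hA]
    obtain ⟨h3, h4⟩ := hen ξ ζ u v _ _ (hW (ξ, u)) (hW (ζ, v))
    generalize PerforatedCell.gradDist ξ ζ (W (ξ, u)) (W (ζ, v)) = X at h3 h4
    have e1 : κ / K ^ 2 * ‖ξ - ζ‖ ^ 2 ≤ κ / K ^ 2 * (K * X) ^ 2 :=
      mul_le_mul_of_nonneg_left (pow_le_pow_left₀ (norm_nonneg _) h4 2) (by positivity)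
    have e2 : κ / K ^ 2 * (K * X) ^ 2 = κ * X ^ 2 := by field_simp
    linear_combination h3 + e1 + e2 + sq_nonneg (u - v)
  · rw [hB]
    have e : 0 ≤ (A + (R / 4 + B ^ 2 / κ)) * (‖ξ‖ + |u| + 1) := by positivity
    have e1 := mul_le_mul_of_nonneg_left (hap ξ u _ (hW (ξ, u))).2.2 hB0
    linear_combination hb u (W (ξ, u)) + e1 + e
  · rw [hA, hA, hB, hB]
    have h3 := PerforatedCell.mul_sub_le_of_energy hκ hB0 (hap ξ u _ (hW (ξ, u))).2.2
      (hbb ξ ζ u v (W (ξ, u)) (W (ζ, v))) (hen ξ ζ u v _ _ (hW (ξ, u)) (hW (ζ, v))).1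
    have e1 : 0 ≤ (A + B * A) * |u - v| ^ 2 := by positivity
    have e2 : 0 ≤ (A + (R / 4 + B ^ 2 / κ)) *
      (|u - v| ^ 2 * (‖ξ‖ + |u| + 1) / (1 + |u - v|)) := by positivity
    linear_combination h3 + e1 + e2
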